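/- Let $a,\rho_0,S>0$, let $(s_j)_{j\ge1}$ be real numbers with $\inf_{i\ne j}|s_i-s_j|>0$, put $\mathcal S=\{s_1,s_2,\dots\}$, and let $K_j,M_j>0$ be such that the sequences $(K_j)$, $(M_j)$, $(K_j/M_j)$ and $(1/M_j)$ are bounded. On $\mathcal H=L^2(\mathbb R)\oplus L^2(\mathbb R)\oplus\ell^2\oplus\ell^2$ (complex valued) consider the scalar product (antilinear in the first argument) $$\langle\langle\Psi_1,\Psi_2\rangle\rangle=\frac1{a^2\rho_0}\langle p_1,p_2\rangle+\rho_0\langle v_1,v_2\rangle+\frac1S\sum_{j}\bigl(K_j\,\bar y_{1j}y_{2j}+M_j\,\bar z_{1j}z_{2j}\bigr),\qquad \Psi_k=(p_k,v_k,\underline y_k,\underline z_k).$$ Let $\hat A$ be the linear operator in $\mathcal H$ with domain $$D(\hat A)=\{(p,v,\underline y,\underline z):\ p\in L^2(\mathbb R)\cap H^1(\mathbb R\setminus\mathcal S),\ v\in H^1(\mathbb R),\ \underline y,\underline z\in\ell^2,\ p(s_j^+)-p(s_j^-)=\sigma_j,\ v(s_j)=z_j,\ \underline\sigma\in\ell^2\}$$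 and $$\hat A(p,v,\underline y,\underline z)=\Bigl(-a^2\rho_0\frac{dv}{dx},\ -\frac1{\rho_0}\frac{dp_0}{dx},\ \underline z,\ -\Bigl(\frac{K_j}{M_j}y_j+\frac S{M_j}\sigma_j\Bigr)_{j}\Bigr),$$ where $\frac{dp_0}{dx}=\frac{dp}{dx}-\sum_j\sigma_j\delta_{s_j}$, i.e. the weak derivative of $p$ on $\mathbb R\setminus\mathcal S$. Let $A(p,v,\underline y,\underline z)=(-a^2\rho_0v',-\rho_0^{-1}p',\underline z,-(K_jy_j/M_j)_j)$ with domain $H^1(\mathbb R)\oplus H^1(\mathbb R)\oplus\ell^2\oplus\ell^2$. Then the following hold. (1) $\hat A$ is real: it commutes with complex conjugation, hence preserves real vectors. (2) $\hat A$ is skew-adjoint with respect to $\langle\langle\cdot,\cdot\rangle\rangle$: $D(\hat A)$ is dense in $\mathcal H$, and for $\Psi,\Phi\in\mathcal H$ one has $\langle\langle\Psi,\hat AX\rangle\rangle=\langle\langle\Phi,X\rangle\rangle$ for all $X\in D(\hat A)$ if and only if $\Psi\in D(\hat A)$ and $\Phi=-\hat A\Psi$. (3) For $(p,v,\underline y,\underline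 z)\in D(\hat A)$ with jumps $\underline\sigma$, the regular part $$p_0(x)=p(x)-\frac12\sum_j\sigma_j\bigl(\operatorname{sgn}(x-s_j)-\operatorname{sgn}(-s_j)\bigr)$$ belongs to $\bar H^1(\mathbb R)$ (locally square-integrable functions with square-integrable weak derivative), and $-\rho_0^{-1}\,dp_0/dx$ is the second component of $\hat A(p,v,\underline y,\underline z)$. If $\underline\sigma\in\ell^1$, the same is true of $p_0(x)=p(x)-\frac12\sum_j\sigma_j\operatorname{sgn}(x-s_j)$, which differs from the former by a constant. (4) Let $\zeta\in\mathbb C\setminus i\mathbb R$ and let $\pm$ be the sign with $\pm\operatorname{Re}\zeta>0$. Then $-A+\zeta$ and $-\hat A+\zeta$ have bounded everywhere defined inverses, the infinite matrix $$\Gamma(\zeta)_{ij}=-\zeta\left(\pm\frac{e^{\mp\zeta|s_i-s_j|/a}}{2a\rho_0\zeta}+\frac{S\,\delta_{ij}}{K_j+\zeta^2M_j}\right)$$ defines a bounded operator on $\ell^2$ with bounded inverse, and $$(-\hat A+\zeta)^{-1}=(-A+\zeta)^{-1}+\sum_{i,j=1}^\infty\bigl(\Gamma(\zeta)^{-1}\bigr)_{ij}\,G^i_\zeta\otimes\breve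 G^j_{\bar\zeta},$$ where $(G\otimes\breve G)\Phi=\langle\langle\breve G,\Phi\rangle\rangle\,G$; the double series applied to any $\Phi\in\mathcal H$ converges in $\mathcal H$ as the limit of the sums over $i\in I$, $j\in J$ when the finite sets $I,J$ increase to $\mathbb N$. Here, with $\underline e_j$ the canonical basis of $\ell^2$, $$\breve G^j_\zeta=\Bigl(\mathcal G'_\zeta(\cdot-s_j),\ \tfrac{\zeta}{a^2\rho_0}\mathcal G_\zeta(\cdot-s_j),\ \tfrac{S}{K_j+\zeta^2M_j}\underline e_j,\ \tfrac{-\zeta S}{K_j+\zeta^2M_j}\underline e_j\Bigr),$$ $$G^j_\zeta=\Bigl(-\mathcal G'_\zeta(\cdot-s_j),\ \tfrac{\zeta}{a^2\rho_0}\mathcal G_\zeta(\cdot-s_j),\ \tfrac{-S}{K_j+\zeta^2M_j}\underline e_j,\ \tfrac{-\zeta S}{K_j+\zeta^2M_j}\underline e_j\Bigr),$$ $$\mathcal G_\zeta(x)=\pm\frac a{2\zeta}e^{\mp\zeta|x|/a},\qquad \mathcal G'_\zeta(x)=-\frac12\operatorname{sgn}(x)\,e^{\mp\zeta|x|/a}.$$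 -/

import Mathlib

open MeasureTheory Filter Topology Set
open scoped ENNReal ContDiff ComplexConjugate

noncomputable section

namespace Acoustic

/-- `L²(ℝ)`, complex valued, with Lebesgue measure. -/
abbrev L2 : Type := Lp ℂ 2 (volume : Measure ℝ)

/-- `ℓ²`, complex valued. -/
abbrev ell2 : Type := lp (fun _ : ℕ => ℂ) 2

/-- The space `L²(ℝ) ⊕ L²(ℝ) ⊕ ℓ² ⊕ ℓ²` of the states `(p, v, y, z)`, with the product topology,
which is the topology of the Hilbert direct sum. -/
abbrev State : Type := L2 × L2 × ell2 × ell2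

/-! ### Weak derivatives and traces -/

/-- `g` is the weak (distributional) derivative of `f` on the open set `U`. -/
def HasWeakDerivOn (U : Set ℝ) (f g : ℝ → ℂ) : Prop :=
  ∀ φ : ℝ → ℝ, ContDiff ℝ ∞ φ → HasCompactSupport φ → tsupport φ ⊆ U →
    ∫ x, deriv φ x • f x = - ∫ x, φ x • g x

/-- The square-integrable function `f` belongs to `H¹(U)`. It is used only for open sets `U` whose
complement is a null set, so that `L²(U) = L²(ℝ)`. -/
def MemH1On (U : Set ℝ) (f : L2) : Prop := ∃ g : L2, HasWeakDerivOn U f g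

/-- The homogeneous Sobolev space `H̄¹(ℝ)`: locally square-integrable functions with
square-integrable weak derivative on `ℝ`. -/
def MemHomH1 (f : ℝ → ℂ) : Prop :=
  (∀ k : Set ℝ, IsCompact k → MemLp f 2 (volume.restrict k)) ∧
    ∃ g : L2, HasWeakDerivOn univ f g

/-- `f` has the (essential) limit `c` along `l`, i.e. the limit up to modification on null sets.
With `l = 𝓝 x` this is the value at `x` of a continuous representative, with `l = 𝓝[>] x` and
`l = 𝓝[<] x` it gives the one-sided values `f(x⁺)` and `f(x⁻)` of a representative that is
continuous away from `x`. -/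
def HasTrace (f : ℝ → ℂ) (l : Filter ℝ) (c : ℂ) : Prop :=
  Tendsto f (l ⊓ ae (volume : Measure ℝ)) (𝓝 c)

/-- `f(x⁺) - f(x⁻) = c`. -/
def HasJump (f : ℝ → ℂ) (x : ℝ) (c : ℂ) : Prop :=
  ∃ r l : ℂ, HasTrace f (𝓝[>] x) r ∧ HasTrace f (𝓝[<] x) l ∧ r - l = c

instance neBot_right (x : ℝ) : (𝓝[>] x ⊓ ae (volume : Measure ℝ)).NeBot := by
  refine inf_neBot_iff.2 fun {s} hs {t} ht => ?_
  obtain ⟨u, hu, hsu⟩ := (mem_nhdsGT_iff_exists_Ioo_subset).1 hs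
  by_contra hne
  have h0 : volume (Ioo x u) = 0 := by
    refine measure_mono_null (fun w hw => ?_) (mem_ae_iff.1 ht)
    intro hwt
    exact hne ⟨w, hsu hw, hwt⟩
  rw [Real.volume_Ioo, ENNReal.ofReal_eq_zero] at h0
  have : x < u := hu
  linarith

instance neBot_left (x : ℝ) : (𝓝[<] x ⊓ ae (volume : Measure ℝ)).NeBot := by
  refine inf_neBot_iff.2 fun {s} hs {t} ht => ?_
  obtain ⟨u, hu, hsu⟩ := (mem_nhdsLT_iff_exists_Ioo_subset).1 hs
  by_contra hne
  have h0 : volume (Ioo u x) = 0 := by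
    refine measure_mono_null (fun w hw => ?_) (mem_ae_iff.1 ht)
    intro hwt
    exact hne ⟨w, hsu hw, hwt⟩
  rw [Real.volume_Ioo, ENNReal.ofReal_eq_zero] at h0
  have : u < x := hu
  linarith

theorem HasTrace.congr_ae {f g : ℝ → ℂ} {l : Filter ℝ} {c : ℂ} (h : HasTrace f l c)
    (hfg : f =ᵐ[volume] g) : HasTrace g l c :=
  Tendsto.congr' (hfg.filter_mono inf_le_right) h

theorem HasTrace.add {f g : L2} {l : Filter ℝ} {c d : ℂ} (hf : HasTrace f l c)
    (hg : HasTrace g l d) : HasTrace (f + g : L2) l (c + d) :=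
  HasTrace.congr_ae (f := fun x => f x + g x) (Tendsto.add hf hg) (Lp.coeFn_add f g).symm

theorem HasTrace.smul {f : L2} {l : Filter ℝ} {c : ℂ} (k : ℂ) (hf : HasTrace f l c) :
    HasTrace (k • f : L2) l (k • c) :=
  HasTrace.congr_ae (f := fun x => k • f x) (Tendsto.const_smul hf k) (Lp.coeFn_smul k f).symm

theorem HasTrace.zero {l : Filter ℝ} : HasTrace (0 : L2) l 0 :=
  HasTrace.congr_ae (f := fun _ => 0) tendsto_const_nhds (Lp.coeFn_zero ℂ 2 volume).symm

theorem HasJump.add {f g : L2} {x : ℝ} {c d : ℂ} (hf : HasJump f x c) (hg : HasJump g x d) :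
    HasJump (f + g : L2) x (c + d) := by
  obtain ⟨r, l, hr, hl, rfl⟩ := hf
  obtain ⟨r', l', hr', hl', rfl⟩ := hg
  exact ⟨r + r', l + l', hr.add hr', hl.add hl', by ring⟩

theorem HasJump.smul {f : L2} {x : ℝ} {c : ℂ} (k : ℂ) (hf : HasJump f x c) :
    HasJump (k • f : L2) x (k • c) := by
  obtain ⟨r, l, hr, hl, rfl⟩ := hf
  exact ⟨k • r, k • l, hr.smul k, hl.smul k, by simp [mul_sub]⟩

theorem HasJump.zero {x : ℝ} : HasJump (0 : L2) x 0 :=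
  ⟨0, 0, HasTrace.zero, HasTrace.zero, by simp⟩

theorem HasJump.unique {f : ℝ → ℂ} {x : ℝ} {c d : ℂ} (hc : HasJump f x c) (hd : HasJump f x d) :
    c = d := by
  obtain ⟨r, l, hr, hl, rfl⟩ := hc
  obtain ⟨r', l', hr', hl', rfl⟩ := hd
  rw [tendsto_nhds_unique hr hr', tendsto_nhds_unique hl hl']

theorem integrable_smul_L2 (f : L2) {φ : ℝ → ℝ} (hφ : Continuous φ) (hc : HasCompactSupport φ) :
    Integrable (fun x => φ x • f x) :=
  ((Lp.memLp f).locallyIntegrable (by norm_num)).integrable_smul_left_of_hasCompactSupport hφ hc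

theorem HasWeakDerivOn.add {U : Set ℝ} {f f' g g' : L2} (hf : HasWeakDerivOn U f f')
    (hg : HasWeakDerivOn U g g') : HasWeakDerivOn U (f + g : L2) (f' + g' : L2) := by
  intro φ h1 h2 h3
  have hd : Continuous (deriv φ) := h1.continuous_deriv (by simp)
  have e1 : ∫ x, deriv φ x • (f + g : L2) x = ∫ x, (deriv φ x • f x + deriv φ x • g x) :=
    integral_congr_ae (by
      filter_upwards [Lp.coeFn_add f g] with x hx
      simp only [hx, Pi.add_apply, smul_add])
  have e2 : ∫ x, φ x • (f' + g' : L2) x = ∫ x, (φ x • f' x + φ x • g' x) :=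
    integral_congr_ae (by
      filter_upwards [Lp.coeFn_add f' g'] with x hx
      simp only [hx, Pi.add_apply, smul_add])
  rw [e1, e2, integral_add (integrable_smul_L2 f hd h2.deriv) (integrable_smul_L2 g hd h2.deriv),
    integral_add (integrable_smul_L2 f' h1.continuous h2) (integrable_smul_L2 g' h1.continuous h2),
    hf φ h1 h2 h3, hg φ h1 h2 h3]
  ring

theorem HasWeakDerivOn.smul {U : Set ℝ} {f f' : L2} (k : ℂ) (hf : HasWeakDerivOn U f f') :
    HasWeakDerivOn U (k • f : L2) (k • f' : L2) := by
  intro φ h1 h2 h3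
  have e1 : ∫ x, deriv φ x • (k • f : L2) x = ∫ x, k • (deriv φ x • f x) :=
    integral_congr_ae (by
      filter_upwards [Lp.coeFn_smul k f] with x hx
      rw [hx, Pi.smul_apply, smul_comm])
  have e2 : ∫ x, φ x • (k • f' : L2) x = ∫ x, k • (φ x • f' x) :=
    integral_congr_ae (by
      filter_upwards [Lp.coeFn_smul k f'] with x hx
      rw [hx, Pi.smul_apply, smul_comm])
  rw [e1, e2, integral_smul, integral_smul, hf φ h1 h2 h3, smul_neg]

theorem HasWeakDerivOn.zero {U : Set ℝ} : HasWeakDerivOn U (0 : L2) (0 : L2) := by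
  intro φ _ _ _
  have h := Lp.coeFn_zero ℂ 2 (volume : Measure ℝ)
  rw [integral_eq_zero_of_ae, integral_eq_zero_of_ae, neg_zero]
  · filter_upwards [h] with x hx
    rw [hx, Pi.zero_apply, smul_zero]
  · filter_upwards [h] with x hx
    rw [hx, Pi.zero_apply, smul_zero]

theorem HasWeakDerivOn.unique {U : Set ℝ} (hU : IsOpen U) (hU0 : volume Uᶜ = 0) {f : ℝ → ℂ}
    {g g' : L2} (h : HasWeakDerivOn U f g) (h' : HasWeakDerivOn U f g') : g = g' := by
  have key : ∀ᵐ x : ℝ, x ∈ U → g x - g' x = 0 := by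
    refine hU.ae_eq_zero_of_integral_contDiff_smul_eq_zero ?_ ?_
    · exact (((Lp.memLp g).locallyIntegrable (by norm_num)).sub
        ((Lp.memLp g').locallyIntegrable (by norm_num))).locallyIntegrableOn U
    · intro φ h1 h2 h3
      simp only [smul_sub]
      rw [integral_sub (integrable_smul_L2 g h1.continuous h2)
        (integrable_smul_L2 g' h1.continuous h2), sub_eq_zero]
      exact neg_injective ((h φ h1 h2 h3).symm.trans (h' φ h1 h2 h3))
  have hUae : ∀ᵐ x : ℝ, x ∈ U := mem_ae_iff.2 hU0
  refine Lp.ext ?_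
  filter_upwards [key, hUae] with x hx hxU
  exact sub_eq_zero.1 (hx hxU)

/-- `H¹(U)` as a subspace of `L²(ℝ)`. -/
def H1On (U : Set ℝ) : Submodule ℂ L2 where
  carrier := {f | MemH1On U f}
  zero_mem' := ⟨0, HasWeakDerivOn.zero⟩
  add_mem' := fun ⟨f', hf⟩ ⟨g', hg⟩ => ⟨f' + g', hf.add hg⟩
  smul_mem' := fun k _ ⟨f', hf⟩ => ⟨k • f', hf.smul k⟩

/-- The weak derivative `H¹(U) → L²`. -/
def weakDeriv (U : Set ℝ) (hU : IsOpen U) (hU0 : volume Uᶜ = 0) : H1On U →ₗ[ℂ] L2 where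
  toFun f := Classical.choose f.2
  map_add' f g := HasWeakDerivOn.unique hU hU0 (Classical.choose_spec (f + g).2)
    ((Classical.choose_spec f.2).add (Classical.choose_spec g.2))
  map_smul' k f := HasWeakDerivOn.unique hU hU0 (Classical.choose_spec (k • f).2)
    ((Classical.choose_spec f.2).smul k)

/-- The subspace `H¹(ℝ)` of `L²(ℝ)`. -/
abbrev H1 : Submodule ℂ L2 := H1On univ

/-- The derivative `H¹(ℝ) → L²(ℝ)`. -/
def ddx : H1 →ₗ[ℂ] L2 := weakDeriv univ isOpen_univ (by simp)

/-! ### The physical system -/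

/-- The parameters of an infinite array of oscillators coupled to the acoustic field: velocity of
sound `a`, equilibrium density `ρ`, section `S`, and for each `j` the equilibrium position `s j`,
the elastic constant `K j` and the mass `M j`. -/
structure Chain where
  a : ℝ
  ρ : ℝ
  S : ℝ
  s : ℕ → ℝ
  K : ℕ → ℝ
  M : ℕ → ℝ
  a_pos : 0 < a
  ρ_pos : 0 < ρ
  S_pos : 0 < S
  K_pos : ∀ j, 0 < K j
  M_pos : ∀ j, 0 < M j
  spacing : ∃ d > 0, ∀ i j, i ≠ j → d ≤ |s i - s j|
  K_bdd : BddAbove (range K)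
  M_bdd : BddAbove (range M)
  KM_bdd : BddAbove (range fun j => K j / M j)
  invM_bdd : BddAbove (range fun j => 1 / M j)

/-- Multiplication of a square-summable sequence by a bounded nonnegative sequence. -/
def diagMul (c : ℕ → ℝ) (hc0 : ∀ j, 0 ≤ c j) (hc : BddAbove (range c)) : ell2 →ₗ[ℂ] ell2 where
  toFun y := ⟨fun j => (c j : ℂ) * y j, by
    obtain ⟨B, hB⟩ := hc
    have hB' : ∀ j, c j ≤ B := fun j => hB ⟨j, rfl⟩
    refine Memℓp.of_norm (memℓp_gen ?_)
    have hy : Summable fun j => ‖y j‖ ^ (2 : ℝ≥0∞).toReal :=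
      (lp.memℓp y).summable (by norm_num)
    refine Summable.of_nonneg_of_le (fun j => by positivity) (fun j => ?_)
      (hy.mul_left (B ^ (2 : ℝ≥0∞).toReal))
    have hBn : 0 ≤ B := (hc0 j).trans (hB' j)
    rw [← Real.mul_rpow hBn (norm_nonneg _)]
    refine Real.rpow_le_rpow (by positivity) ?_ (by positivity)
    rw [norm_norm, norm_mul, Complex.norm_real, Real.norm_of_nonneg (hc0 j)]
    exact mul_le_mul_of_nonneg_right (hB' j) (norm_nonneg _)⟩
  map_add' y y' := by
    ext j
    exact mul_add _ _ _
  map_smul' k y := by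
    ext j
    exact mul_left_comm _ _ _

namespace Chain

variable (P : Chain)

theorem isClosed_range : IsClosed (range P.s) := by
  obtain ⟨d, hd, h⟩ := P.spacing
  refine Metric.isClosed_of_pairwise_le_dist hd ?_
  rintro _ ⟨i, rfl⟩ _ ⟨j, rfl⟩ hij
  rw [Real.dist_eq]
  exact h i j fun e => hij (by rw [e])

/-- `ℝ ∖ 𝒮`, the real line without the positions of the oscillators. -/
def punctured : Set ℝ := (range P.s)ᶜ

theorem isOpen_punctured : IsOpen P.punctured := P.isClosed_range.isOpen_compl

theorem volume_punctured_compl : volume P.puncturedᶜ = 0 := by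
  rw [punctured, compl_compl]
  exact (countable_range P.s).measure_zero volume

/-- The derivative `H¹(ℝ ∖ 𝒮) → L²(ℝ)`, computed on `ℝ ∖ 𝒮`. -/
def ddxOff : H1On P.punctured →ₗ[ℂ] L2 :=
  weakDeriv P.punctured P.isOpen_punctured P.volume_punctured_compl

/-- `y ↦ (K_j / M_j · y_j)_j` on `ℓ²`. -/
def mulKM : ell2 →ₗ[ℂ] ell2 :=
  diagMul (fun j => P.K j / P.M j) (fun j => (div_pos (P.K_pos j) (P.M_pos j)).le) P.KM_bdd

/-- `y ↦ (1 / M_j · y_j)_j` on `ℓ²`. -/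
def mulInvM : ell2 →ₗ[ℂ] ell2 :=
  diagMul (fun j => 1 / P.M j) (fun j => (div_pos one_pos (P.M_pos j)).le) P.invM_bdd

/-- The energy scalar product, antilinear in the first argument:
`(a²ρ)⁻¹ ⟨p₁, p₂⟩ + ρ ⟨v₁, v₂⟩ + S⁻¹ ∑ⱼ (Kⱼ ȳ₁ⱼ y₂ⱼ + Mⱼ z̄₁ⱼ z₂ⱼ)`. -/
def energy : State → State → ℂ
  | (p₁, v₁, y₁, z₁), (p₂, v₂, y₂, z₂) =>
    (1 / (P.a ^ 2 * P.ρ) : ℂ) * inner ℂ p₁ p₂ + (P.ρ : ℂ) * inner ℂ v₁ v₂ +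
      (1 / P.S : ℂ) * ∑' j, ((P.K j : ℂ) * (conj (y₁ j) * y₂ j) +
        (P.M j : ℂ) * (conj (z₁ j) * z₂ j))

/-- The generator `A` of the uncoupled dynamics, with domain `H¹(ℝ) ⊕ H¹(ℝ) ⊕ ℓ² ⊕ ℓ²`:
`A (p, v, y, z) = (-a²ρ v', -ρ⁻¹ p', z, -(K_j / M_j · y_j)_j)`. -/
def freeA : State →ₗ.[ℂ] State where
  domain := H1.prod (H1.prod ⊤)
  toFun :=
    { toFun := fun Ψ =>
        (-(P.a ^ 2 * P.ρ : ℂ) • ddx ⟨Ψ.1.2.1, Ψ.2.2.1⟩,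
          -(1 / P.ρ : ℂ) • ddx ⟨Ψ.1.1, Ψ.2.1⟩,
          Ψ.1.2.2.2,
          -P.mulKM Ψ.1.2.2.1)
      map_add' := fun Ψ Φ => by
        have h1 := ddx.map_add ⟨Ψ.1.2.1, Ψ.2.2.1⟩ ⟨Φ.1.2.1, Φ.2.2.1⟩
        have h2 := ddx.map_add ⟨Ψ.1.1, Ψ.2.1⟩ ⟨Φ.1.1, Φ.2.1⟩
        refine Prod.ext ?_ (Prod.ext ?_ (Prod.ext rfl ?_))
        · exact (congrArg _ h1).trans (smul_add _ _ _)
        · exact (congrArg _ h2).trans (smul_add _ _ _)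
        · exact (congrArg _ (P.mulKM.map_add _ _)).trans (neg_add _ _)
      map_smul' := fun k Ψ => by
        have h1 := ddx.map_smul k ⟨Ψ.1.2.1, Ψ.2.2.1⟩
        have h2 := ddx.map_smul k ⟨Ψ.1.1, Ψ.2.1⟩
        refine Prod.ext ?_ (Prod.ext ?_ (Prod.ext rfl ?_))
        · exact (congrArg _ h1).trans (smul_comm _ _ _)
        · exact (congrArg _ h2).trans (smul_comm _ _ _)
        · exact (congrArg _ (P.mulKM.map_smul _ _)).trans (smul_neg _ _).symm }

/-- The subspace of the `p ∈ L²(ℝ) ∩ H¹(ℝ ∖ 𝒮)` whose jumps `σ_j = p(s_j⁺) - p(s_j⁻)` form a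
sequence `σ ∈ ℓ²`. -/
def pressureDomain : Submodule ℂ L2 where
  carrier := {p | p ∈ H1On P.punctured ∧ ∃ σ : ell2, ∀ j, HasJump p (P.s j) (σ j)}
  zero_mem' := ⟨Submodule.zero_mem _, 0, fun _ => HasJump.zero⟩
  add_mem' := fun ⟨h1, σ, hσ⟩ ⟨h1', σ', hσ'⟩ =>
    ⟨Submodule.add_mem _ h1 h1', σ + σ', fun j => (hσ j).add (hσ' j)⟩
  smul_mem' := fun k _ ⟨h1, σ, hσ⟩ =>
    ⟨Submodule.smul_mem _ k h1, k • σ, fun j => (hσ j).smul k⟩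

/-- The sequence of jumps `p ↦ σ`. -/
def jumps : P.pressureDomain →ₗ[ℂ] ell2 where
  toFun p := Classical.choose p.2.2
  map_add' p q := lp.ext (funext fun j => (Classical.choose_spec (p + q).2.2 j).unique
    ((Classical.choose_spec p.2.2 j).add (Classical.choose_spec q.2.2 j)))
  map_smul' k p := lp.ext (funext fun j => (Classical.choose_spec (k • p).2.2 j).unique
    ((Classical.choose_spec p.2.2 j).smul k))

theorem hasJump_jumps (p : P.pressureDomain) (j : ℕ) : HasJump (p : L2) (P.s j) (P.jumps p j) :=
  Classical.choose_spec p.2.2 j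

/-- The domain of the coupled generator: `p ∈ L²(ℝ) ∩ H¹(ℝ ∖ 𝒮)`, `v ∈ H¹(ℝ)`, `y, z ∈ ℓ²`,
`p(s_j⁺) - p(s_j⁻) = σ_j` with `σ ∈ ℓ²`, and `v(s_j) = z_j`. -/
def hatDomain : Submodule ℂ State where
  carrier := {Ψ | Ψ.1 ∈ P.pressureDomain ∧ Ψ.2.1 ∈ H1 ∧
    ∀ j, HasTrace Ψ.2.1 (𝓝 (P.s j)) (Ψ.2.2.2 j)}
  zero_mem' := ⟨Submodule.zero_mem _, Submodule.zero_mem _, fun _ => HasTrace.zero⟩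
  add_mem' := fun ⟨h1, h2, h3⟩ ⟨h1', h2', h3'⟩ =>
    ⟨Submodule.add_mem _ h1 h1', Submodule.add_mem _ h2 h2', fun j => (h3 j).add (h3' j)⟩
  smul_mem' := fun k _ ⟨h1, h2, h3⟩ =>
    ⟨Submodule.smul_mem _ k h1, Submodule.smul_mem _ k h2, fun j => (h3 j).smul k⟩

/-- The generator `Â` of the coupled dynamics:
`Â (p, v, y, z) = (-a²ρ v', -ρ⁻¹ p₀', z, -(K_j / M_j · y_j + S / M_j · σ_j)_j)`.
Here `p₀' = p' - ∑ⱼ σ_j δ_{s_j}`, the derivative of the regular part of `p`, is the derivative of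
`p` on `ℝ ∖ 𝒮`. -/
def hatA : State →ₗ.[ℂ] State where
  domain := P.hatDomain
  toFun :=
    { toFun := fun Ψ =>
        (-(P.a ^ 2 * P.ρ : ℂ) • ddx ⟨Ψ.1.2.1, Ψ.2.2.1⟩,
          -(1 / P.ρ : ℂ) • P.ddxOff ⟨Ψ.1.1, Ψ.2.1.1⟩,
          Ψ.1.2.2.2,
          -(P.mulKM Ψ.1.2.2.1 + (P.S : ℂ) • P.mulInvM (P.jumps ⟨Ψ.1.1, Ψ.2.1⟩)))
      map_add' := fun Ψ Φ => by
        have h1 := ddx.map_add ⟨Ψ.1.2.1, Ψ.2.2.1⟩ ⟨Φ.1.2.1, Φ.2.2.1⟩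
        have h2 := P.ddxOff.map_add ⟨Ψ.1.1, Ψ.2.1.1⟩ ⟨Φ.1.1, Φ.2.1.1⟩
        have h3 := (P.mulInvM ∘ₗ P.jumps).map_add ⟨Ψ.1.1, Ψ.2.1⟩ ⟨Φ.1.1, Φ.2.1⟩
        have h4 := P.mulKM.map_add Ψ.1.2.2.1 Φ.1.2.2.1
        refine Prod.ext ?_ (Prod.ext ?_ (Prod.ext rfl ?_))
        · exact (congrArg _ h1).trans (smul_add _ _ _)
        · exact (congrArg _ h2).trans (smul_add _ _ _)
        · refine (congrArg Neg.neg (congrArg₂ (· + ·) h4 (congrArg ((P.S : ℂ) • ·) h3))).trans ?_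
          simp only [LinearMap.comp_apply, smul_add, Prod.snd_add]
          abel
      map_smul' := fun k Ψ => by
        have h1 := ddx.map_smul k ⟨Ψ.1.2.1, Ψ.2.2.1⟩
        have h2 := P.ddxOff.map_smul k ⟨Ψ.1.1, Ψ.2.1.1⟩
        have h3 := (P.mulInvM ∘ₗ P.jumps).map_smul k ⟨Ψ.1.1, Ψ.2.1⟩
        have h4 := P.mulKM.map_smul k Ψ.1.2.2.1
        refine Prod.ext ?_ (Prod.ext ?_ (Prod.ext rfl ?_))
        · exact (congrArg _ h1).trans (smul_comm _ _ _)
        · exact (congrArg _ h2).trans (smul_comm _ _ _)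
        · refine (congrArg Neg.neg (congrArg₂ (· + ·) h4 (congrArg ((P.S : ℂ) • ·) h3))).trans ?_
          simp only [LinearMap.comp_apply, RingHom.id_apply, Prod.smul_snd, smul_neg, smul_add,
            smul_comm k (P.S : ℂ)] }

/-- The regular part `p₀ = p - ½ ∑ⱼ σ_j sgn(x - s_j)` of `p`, the series understood as it stands
(so it is meaningful for summable `σ`). -/
def regularPart (p : ℝ → ℂ) (σ : ℕ → ℂ) (x : ℝ) : ℂ :=
  p x - (1 / 2 : ℂ) * ∑' j, σ j * (Real.sign (x - P.s j) : ℂ)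

/-- The regular part of `p`, up to an additive constant: each term of the series is normalised to
vanish at `x = 0`, so that at each `x` only finitely many terms are nonzero and every `σ` is
admitted. -/
def regularPartNormalized (p : ℝ → ℂ) (σ : ℕ → ℂ) (x : ℝ) : ℂ :=
  p x - (1 / 2 : ℂ) * ∑' j, σ j * ((Real.sign (x - P.s j) : ℂ) - (Real.sign (0 - P.s j) : ℂ))

end Chain

/-! ### Operator notions -/

/-- `T` is skew-adjoint with respect to the scalar product `B`: it is densely defined and its
`B`-adjoint is `-T`, i.e. the pairs `(Ψ, Φ)` with `B Ψ (T X) = B Φ X` for all `X ∈ D(T)` are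
exactly those with `Ψ ∈ D(T)` and `Φ = -T Ψ`. -/
def IsSkewAdjoint (B : State → State → ℂ) (T : State →ₗ.[ℂ] State) : Prop :=
  Dense (T.domain : Set State) ∧
    ∀ Ψ Φ : State, (∀ X : T.domain, B Ψ (T X) = B Φ X) ↔ ∃ h : Ψ ∈ T.domain, Φ = -T ⟨Ψ, h⟩

/-- `T` is real: it commutes with complex conjugation of all four components (`star`); in
particular it maps real elements of its domain to real elements. -/
def IsRealOperator (T : State →ₗ.[ℂ] State) : Prop :=
  ∀ Ψ : T.domain, ∃ h : star (Ψ : State) ∈ T.domain, T ⟨star (Ψ : State), h⟩ = star (T Ψ)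

/-- The bounded operator `R` is the resolvent `(-T + ζ)⁻¹`. -/
def IsResolvent (T : State →ₗ.[ℂ] State) (ζ : ℂ) (R : State →L[ℂ] State) : Prop :=
  (∀ Φ, ∃ h : R Φ ∈ T.domain, -T ⟨R Φ, h⟩ + ζ • R Φ = Φ) ∧
    ∀ X : T.domain, R (-T X + ζ • (X : State)) = X

/-! ### The ingredients of the resolvent formula -/

/-- The sign `±` with `± Re ζ > 0`. -/
def sgnRe (ζ : ℂ) : ℝ := Real.sign ζ.re

/-- `𝒢_ζ(x) = ± a / (2ζ) · exp (∓ ζ |x| / a)` for `± Re ζ > 0`. -/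
def green (a : ℝ) (ζ : ℂ) (x : ℝ) : ℂ :=
  (sgnRe ζ : ℂ) * (a / (2 * ζ)) * Complex.exp (-(sgnRe ζ) * ζ * |x| / a)

/-- `𝒢_ζ'(x) = -½ sgn(x) exp (∓ ζ |x| / a)` for `± Re ζ > 0`. -/
def green' (a : ℝ) (ζ : ℂ) (x : ℝ) : ℂ :=
  -(1 / 2) * (Real.sign x : ℂ) * Complex.exp (-(sgnRe ζ) * ζ * |x| / a)

theorem conj_re_ne_zero {ζ : ℂ} (hζ : ζ.re ≠ 0) : (conj ζ).re ≠ 0 := by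
  rwa [Complex.conj_re]

theorem memLp_exp_abs {a : ℝ} (ha : 0 < a) {ζ : ℂ} (hζ : ζ.re ≠ 0) :
    MemLp (fun x : ℝ => Complex.exp (-(sgnRe ζ) * ζ * |x| / a)) 2 volume := by
  have hm : AEStronglyMeasurable (fun x : ℝ => Complex.exp (-(sgnRe ζ) * ζ * |x| / a)) volume := by
    apply Continuous.aestronglyMeasurable
    fun_prop
  refine (memLp_two_iff_integrable_sq_norm hm).2 ?_
  have hb : 0 < 2 * (|ζ.re| / a) := by positivity
  have h0 : IntegrableOn (fun x : ℝ => Real.exp (-(2 * (|ζ.re| / a)) * x)) (Ioi 0) :=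
    exp_neg_integrableOn_Ioi 0 hb
  have h1 : IntegrableOn (fun x : ℝ => Real.exp (2 * (|ζ.re| / a) * x)) (Iic 0) :=
    integrableOn_exp_mul_Iic hb 0
  have h2 : Integrable (fun x : ℝ => Real.exp (-(2 * (|ζ.re| / a)) * |x|)) := by
    rw [← integrableOn_univ, ← Iic_union_Ioi (a := (0 : ℝ))]
    refine IntegrableOn.union ?_ ?_
    · refine h1.congr_fun (fun x hx => ?_) measurableSet_Iic
      simp only [abs_of_nonpos (mem_Iic.1 hx), neg_mul_neg]
    · refine h0.congr_fun (fun x hx => ?_) measurableSet_Ioi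
      simp only [abs_of_pos (mem_Ioi.1 hx)]
  refine h2.congr (Eventually.of_forall fun x => ?_)
  have hs : Real.sign ζ.re * ζ.re = |ζ.re| := by
    rcases lt_or_gt_of_ne hζ with h | h
    · rw [Real.sign_of_neg h, abs_of_neg h]
      ring
    · rw [Real.sign_of_pos h, abs_of_pos h]
      ring
  have hre : (-(sgnRe ζ : ℂ) * ζ * (|x| : ℝ) / (a : ℝ)).re = -(|ζ.re| / a) * |x| := by
    rw [Complex.div_ofReal_re, Complex.re_mul_ofReal, ← Complex.ofReal_neg, Complex.re_ofReal_mul,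
      sgnRe, neg_mul, hs]
    ring
  simp only [Complex.norm_exp, hre]
  rw [← Real.exp_nat_mul]
  congr 1
  push_cast
  ring

theorem memLp_green {a : ℝ} (ha : 0 < a) {ζ : ℂ} (hζ : ζ.re ≠ 0) (s : ℝ) :
    MemLp (fun x => green a ζ (x - s)) 2 volume :=
  ((memLp_exp_abs ha hζ).const_mul _).comp_measurePreserving
    (measurePreserving_sub_right volume s)

theorem memLp_green' {a : ℝ} (ha : 0 < a) {ζ : ℂ} (hζ : ζ.re ≠ 0) (s : ℝ) :
    MemLp (fun x => green' a ζ (x - s)) 2 volume := by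
  have hsm : Measurable Real.sign := by
    unfold Real.sign
    exact Measurable.ite measurableSet_Iio measurable_const
      (Measurable.ite measurableSet_Ioi measurable_const measurable_const)
  have h : MemLp (green' a ζ) 2 volume := by
    refine (memLp_exp_abs ha hζ).of_le ?_ (Eventually.of_forall fun x => ?_)
    · refine Measurable.aestronglyMeasurable ?_
      unfold green'
      fun_prop
    · rw [green', norm_mul]
      refine mul_le_of_le_one_left (norm_nonneg _) ?_
      rw [norm_mul, Complex.norm_real]
      rcases Real.sign_apply_eq x with h | h | h <;> rw [h] <;> norm_num
  exact h.comp_measurePreserving (measurePreserving_sub_right volume s)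

/-- The vector `c • e_j` of `ℓ²`. -/
abbrev basisVec (j : ℕ) (c : ℂ) : ell2 := lp.single 2 j c

namespace Chain

variable (P : Chain)

/-- `Ğ_ζ^j = (𝒢_ζ'(x - s_j), ζ/(a²ρ) 𝒢_ζ(x - s_j), S/(K_j + ζ²M_j) e_j, -ζS/(K_j + ζ²M_j) e_j)`. -/
def breveG (ζ : ℂ) (hζ : ζ.re ≠ 0) (j : ℕ) : State :=
  ((memLp_green' P.a_pos hζ (P.s j)).toLp,
    (ζ / (P.a ^ 2 * P.ρ) : ℂ) • (memLp_green P.a_pos hζ (P.s j)).toLp,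
    basisVec j (P.S / (P.K j + ζ ^ 2 * P.M j)),
    basisVec j (-ζ * P.S / (P.K j + ζ ^ 2 * P.M j)))

/-- `G_ζ^j = (-𝒢_ζ'(x - s_j), ζ/(a²ρ) 𝒢_ζ(x - s_j), -S/(K_j + ζ²M_j) e_j, -ζS/(K_j + ζ²M_j) e_j)`. -/
def vecG (ζ : ℂ) (hζ : ζ.re ≠ 0) (j : ℕ) : State :=
  (-(memLp_green' P.a_pos hζ (P.s j)).toLp,
    (ζ / (P.a ^ 2 * P.ρ) : ℂ) • (memLp_green P.a_pos hζ (P.s j)).toLp,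
    basisVec j (-P.S / (P.K j + ζ ^ 2 * P.M j)),
    basisVec j (-ζ * P.S / (P.K j + ζ ^ 2 * P.M j)))

/-- The entries of the infinite matrix `Γ(ζ)`:
`Γ(ζ)_{ij} = -ζ (± exp (∓ ζ |s_i - s_j| / a) / (2aρζ) + S δ_{ij} / (K_j + ζ² M_j))`
for `± Re ζ > 0`. -/
def gammaEntry (ζ : ℂ) (i j : ℕ) : ℂ :=
  -ζ * ((sgnRe ζ : ℂ) * Complex.exp (-(sgnRe ζ) * ζ * |P.s i - P.s j| / P.a)
      / (2 * P.a * P.ρ * ζ) +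
    (P.S : ℂ) * (if i = j then 1 else 0) / (P.K j + ζ ^ 2 * P.M j))

end Chain

end Acoustic

end

/-! The coupled generator differs from a skew-adjoint free one only through the jumps of `p` at the
points `s_j`, so the proof isolates the jumps as a separate variable `σ ∈ ℓ²`.

On the line, `f' = k f` with `k ≠ 0` real has no nonzero solution in `L²`. Hence the pairs `(φ, φ')`
span a dense subspace of the graph of the weak derivative (`derivGraph_le_closure`). This gives
integration by parts in `H¹(ℝ)`, and then a right inverse of `d/dx + κ` for `Re κ ≠ 0`.

Since the `s_j` are uniformly separated, sawteeth with unit jumps at the `s_j` can be given disjoint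
supports. They are then orthogonal, and `σ ↦ ∑ σ_j saw_j` is a bounded operator `lift : ℓ² → L²`.
Every `p` in the pressure domain is an `H¹(ℝ)` function plus `lift σ` (`hasWeakDerivOn_sub_lift`),
and the adjoints of `lift` and `liftDeriv` produce the values `(v(s_j))_j`, automatically in `ℓ²`.
The outcome is `⟨p, v'⟩ + ⟨p₀', v⟩ = -⟨σ, (v(s_j))_j⟩` (`inner_deriv_of_jumps`). Skew-symmetry
follows because the force `S σ_j / M_j` on the oscillators cancels this boundary term when `v(s_j) =
z_j`. Testing the adjoint relation on a parametrised family of domain vectors recovers every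
condition defining the domain (`adjoint_hatA`), and the same argument with `Ψ = 0` gives density.

For the resolvent, the constraint `v(s_j) = z_j` is first dropped and the jumps are prescribed
(`SolvesWithJumps`). This relaxed problem has exactly one solution, `R₀ Φ + ∑ σ_j G^j`. Restoring
the constraint gives the linear equation `Γ(ζ) σ = t`, where `t` is the defect `(v(s_j) - z_j)_j` of
`R₀ Φ`. An energy identity for the relaxed problem, together with the positivity of `± Re (ζ / (K_j
+ ζ² M_j))`, makes `Γ(ζ)` coercive, hence invertible. Finally `t_j` is the energy product of `Ğ^j`
with `Φ` (`energy_breveG`), which is Krein's formula. -/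

noncomputable section

namespace Acoustic

/-! ### Test functions -/

/-- Real test functions on the line: smooth with compact support. -/
structure IsTest (φ : ℝ → ℝ) : Prop where
  contDiff : ContDiff ℝ ∞ φ
  hasCompactSupport : HasCompactSupport φ

namespace IsTest

variable {φ ψ : ℝ → ℝ}

protected theorem deriv (h : IsTest φ) : IsTest (deriv φ) :=
  ⟨(contDiff_infty_iff_deriv.1 h.1).2, h.2.deriv⟩

theorem continuous (h : IsTest φ) : Continuous φ := h.1.continuous

theorem differentiable (h : IsTest φ) : Differentiable ℝ φ := h.1.differentiable (by simp)

theorem hasDerivAt (h : IsTest φ) (x : ℝ) : HasDerivAt φ (deriv φ x) x :=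
  (h.differentiable x).hasDerivAt

theorem integrable (h : IsTest φ) : Integrable φ :=
  h.continuous.integrable_of_hasCompactSupport h.2

theorem mul (h : IsTest φ) (hψ : ContDiff ℝ ∞ ψ) : IsTest (fun x => ψ x * φ x) :=
  ⟨hψ.mul h.1, h.2.mul_left⟩

theorem comp_sub (h : IsTest φ) (t : ℝ) : IsTest (fun x => φ (x - t)) :=
  ⟨h.1.comp (contDiff_id.sub contDiff_const),
    h.2.comp_homeomorph (Homeomorph.subRight t)⟩

theorem memLp (h : IsTest φ) : MemLp (fun x => (φ x : ℂ)) 2 volume :=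
  Continuous.memLp_of_hasCompactSupport (Complex.continuous_ofReal.comp h.continuous)
    (h.2.comp_left Complex.ofReal_zero)

/-- The moving integral `∫_{x-t}^x ψ` of a test function is a test function. -/
theorem movingIntegral (h : IsTest ψ) (t : ℝ) : IsTest (fun x => ∫ u in (x - t)..x, ψ u) ∧
    ∀ x, HasDerivAt (fun x => ∫ u in (x - t)..x, ψ u) (ψ x - ψ (x - t)) x := by
  have hi : ∀ a b, IntervalIntegrable ψ volume a b := fun a b => h.continuous.intervalIntegrable a b
  have e : (fun x => ∫ u in (x - t)..x, ψ u) =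
      fun x => (∫ u in (0 : ℝ)..x, ψ u) - ∫ u in (0 : ℝ)..(x - t), ψ u := by
    funext x
    rw [intervalIntegral.integral_interval_sub_left (hi _ _) (hi _ _)]
  have hd : ∀ x, HasDerivAt (fun x => ∫ u in (x - t)..x, ψ u) (ψ x - ψ (x - t)) x := by
    intro x
    have hF : ∀ y, HasDerivAt (fun x => ∫ u in (0 : ℝ)..x, ψ u) (ψ y) y := fun y =>
      intervalIntegral.integral_hasDerivAt_right (hi _ _)
        (h.continuous.stronglyMeasurableAtFilter _ _) h.continuous.continuousAt
    rw [e]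
    exact (hF x).sub ((hF (x - t)).comp_sub_const x t)
  refine ⟨⟨?_, ?_⟩, hd⟩
  · rw [contDiff_infty_iff_deriv]
    refine ⟨fun x => (hd x).differentiableAt, ?_⟩
    rw [funext fun x => (hd x).deriv]
    exact h.1.sub (h.comp_sub t).1
  · obtain ⟨R, hR⟩ := h.2.isCompact.isBounded.subset_closedBall 0
    -- The radius `R` is not known to be nonnegative, hence `|R|`; the window of integration can
    -- move the support by `|t|`.
    refine HasCompactSupport.intro (isCompact_Icc (a := -(|R| + |t|)) (b := |R| + |t|)) ?_
    intro x hx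
    refine intervalIntegral.integral_zero_ae (Eventually.of_forall fun u hu => ?_)
    by_contra hne
    have hu' : u ∈ Metric.closedBall (0 : ℝ) R := hR (subset_tsupport _ hne)
    rw [Metric.mem_closedBall, Real.dist_eq, sub_zero] at hu'
    have h1 := abs_le.1 (hu'.trans (le_abs_self R))
    have h2 := abs_le.1 (le_refl |t|)
    apply hx
    rw [mem_uIoc] at hu
    constructor <;> rcases hu with hu | hu <;> linarith [hu.1, hu.2, h1.1, h1.2, h2.1, h2.2]

end IsTest

/-- A test function as an element of `L²(ℝ)`. -/
def testLp {φ : ℝ → ℝ} (h : IsTest φ) : L2 := h.memLp.toLp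

theorem coeFn_testLp {φ : ℝ → ℝ} (h : IsTest φ) : testLp h =ᵐ[volume] fun x => (φ x : ℂ) :=
  h.memLp.coeFn_toLp

theorem norm_testLp_comp_sub {φ : ℝ → ℝ} (h : IsTest φ) (t : ℝ) :
    ‖testLp (h.comp_sub t)‖ = ‖testLp h‖ := by
  rw [testLp, testLp, Lp.norm_toLp, Lp.norm_toLp]
  exact congrArg ENNReal.toReal (eLpNorm_comp_measurePreserving (g := fun x => (φ x : ℂ))
    h.memLp.1 (measurePreserving_sub_right volume t))

theorem inner_testLp {φ : ℝ → ℝ} (h : IsTest φ) (f : L2) :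
    inner ℂ (testLp h) f = ∫ x, φ x • f x := by
  rw [L2.inner_def]
  refine integral_congr_ae ?_
  filter_upwards [coeFn_testLp h] with x hx
  rw [hx, RCLike.inner_apply, Complex.conj_ofReal, Complex.real_smul, mul_comm]

/-- Written with inner products against fixed vectors, the condition is visibly closed in `L² × L²`.
-/
theorem hasWeakDerivOn_univ_iff {f g : L2} : HasWeakDerivOn univ f g ↔
    ∀ (φ : ℝ → ℝ) (h : IsTest φ), inner ℂ (testLp h.deriv) f = -inner ℂ (testLp h) g := by
  refine ⟨fun H φ h => ?_, fun H φ h1 h2 _ => ?_⟩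
  · rw [inner_testLp, inner_testLp]
    exact H φ h.1 h.2 (subset_univ _)
  · have := H φ ⟨h1, h2⟩
    rwa [inner_testLp, inner_testLp] at this

theorem eq_zero_of_inner_testLp {f : L2}
    (H : ∀ (φ : ℝ → ℝ) (h : IsTest φ), inner ℂ (testLp h) f = 0) : f = 0 := by
  have key := ae_eq_zero_of_integral_contDiff_smul_eq_zero (f := f) (μ := volume)
    ((Lp.memLp f).locallyIntegrable (by norm_num))
    (fun φ h1 h2 => by rw [← inner_testLp ⟨h1, h2⟩]; exact H φ _)
  exact Lp.eq_zero_iff_ae_eq_zero.2 key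

theorem IsTest.hasWeakDerivOn {φ : ℝ → ℝ} (h : IsTest φ) :
    HasWeakDerivOn univ (testLp h) (testLp h.deriv) := by
  rw [hasWeakDerivOn_univ_iff]
  intro ψ hψ
  rw [inner_testLp, inner_testLp, ← add_eq_zero_iff_eq_neg,
    ← integral_add (integrable_smul_L2 _ hψ.deriv.continuous hψ.deriv.2)
      (integrable_smul_L2 _ hψ.continuous hψ.2)]
  have e : ∀ᵐ x, deriv ψ x • testLp h x + ψ x • testLp h.deriv x =
      ((deriv ψ x * φ x + ψ x * deriv φ x : ℝ) : ℂ) := by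
    filter_upwards [coeFn_testLp h, coeFn_testLp h.deriv] with x h1 h2
    rw [h1, h2]
    simp
  rw [integral_congr_ae e, integral_complex_ofReal,
    integral_eq_zero_of_hasDerivAt_of_integrable (f := fun x => ψ x * φ x)
      (fun x => (hψ.hasDerivAt x).mul (h.hasDerivAt x)), Complex.ofReal_zero]
  · exact (h.mul hψ.deriv.1).integrable.add (h.deriv.mul hψ.1).integrable
  · exact (h.mul hψ.1).integrable

/-- The equation `f' = k f` has no nonzero square-integrable solution on the line. -/
theorem eq_zero_of_hasWeakDerivOn_smul {k : ℝ} (hk : k ≠ 0) {f : L2}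
    (H : HasWeakDerivOn univ f ((k : ℂ) • f : L2)) : f = 0 := by
  refine eq_zero_of_inner_testLp fun η hη => ?_
  have hE : ∀ c : ℝ, ContDiff ℝ ∞ fun x => Real.exp (c * x) := fun c => by fun_prop
  have hψ : IsTest (fun x => Real.exp (k * x) * η x) := hη.mul (hE k)
  -- The function `Φ(x) = e^{-kx} ∫_{x-t}^x e^{ku} η(u) du` satisfies `Φ' + k Φ = η - e^{-kt} η(· -
  -- t)`, and the moving window keeps its support compact. Testing `f' = k f` with `Φ` leaves `⟨η,
  -- f⟩ = e^{-kt} ⟨η(· - t), f⟩`.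
  have bound : ∀ t : ℝ, ‖inner ℂ (testLp hη) f‖ ≤ Real.exp (-k * t) * (‖testLp hη‖ * ‖f‖) := by
    intro t
    obtain ⟨hθ, hθd⟩ := hψ.movingIntegral t
    have hΦ := hθ.mul (hE (-k))
    have hd : deriv (fun x => Real.exp (-k * x) * ∫ u in (x - t)..x, Real.exp (k * u) * η u) =
        fun x => -k * (Real.exp (-k * x) * ∫ u in (x - t)..x, Real.exp (k * u) * η u) +
          (η x - Real.exp (-k * t) * η (x - t)) := by
      funext x
      have h1 : HasDerivAt (fun x => Real.exp (-k * x)) (Real.exp (-k * x) * (-k)) x := by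
        simpa using ((hasDerivAt_id x).const_mul (-k)).exp
      refine (h1.mul (hθd x)).deriv.trans ?_
      have e1 : Real.exp (-k * x) * Real.exp (k * x) = 1 := by rw [← Real.exp_add]; simp
      have e2 : Real.exp (-k * x) * Real.exp (k * (x - t)) = Real.exp (-k * t) := by
        rw [← Real.exp_add]; congr 1; ring
      linear_combination η x * e1 - η (x - t) * e2
    have e := hasWeakDerivOn_univ_iff.1 H _ hΦ
    have e' : testLp hΦ.deriv = (-k : ℂ) • testLp hΦ +
        (testLp hη - (Real.exp (-k * t) : ℂ) • testLp (hη.comp_sub t)) := by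
      refine Lp.ext ?_
      filter_upwards [coeFn_testLp hΦ.deriv, coeFn_testLp hΦ, coeFn_testLp hη,
        coeFn_testLp (hη.comp_sub t), Lp.coeFn_add ((-k : ℂ) • testLp hΦ)
          (testLp hη - (Real.exp (-k * t) : ℂ) • testLp (hη.comp_sub t)),
        Lp.coeFn_smul (-k : ℂ) (testLp hΦ),
        Lp.coeFn_sub (testLp hη) ((Real.exp (-k * t) : ℂ) • testLp (hη.comp_sub t)),
        Lp.coeFn_smul (Real.exp (-k * t) : ℂ) (testLp (hη.comp_sub t))]
        with x h1 h2 h3 h4 h5 h6 h7 h8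
      rw [h1, h5, Pi.add_apply, h6, h7, Pi.sub_apply, h8, Pi.smul_apply, Pi.smul_apply, h2, h3, h4,
        hd]
      push_cast
      simp
    rw [e', inner_add_left, inner_sub_left, inner_smul_left, inner_smul_left, inner_smul_right]
      at e
    have e3 : inner ℂ (testLp hη) f = (Real.exp (-k * t) : ℂ) *
        inner ℂ (testLp (hη.comp_sub t)) f := by
      simp only [map_neg, Complex.conj_ofReal] at e
      linear_combination e
    rw [e3, norm_mul, Complex.norm_real, Real.norm_of_nonneg (Real.exp_pos _).le]
    refine mul_le_mul_of_nonneg_left ?_ (Real.exp_pos _).le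
    refine (norm_inner_le_norm _ _).trans (le_of_eq ?_)
    congr 1
    exact norm_testLp_comp_sub hη t
  -- The choice `t = k n` makes the exponent `-k² n`, whatever the sign of `k`.
  have hlim : Tendsto (fun n : ℕ => Real.exp (-k * (k * n)) * (‖testLp hη‖ * ‖f‖)) atTop
      (𝓝 (0 * (‖testLp hη‖ * ‖f‖))) := by
    refine Tendsto.mul_const _ (Real.tendsto_exp_atBot.comp ?_)
    have : (fun n : ℕ => -k * (k * n)) = fun n : ℕ => -((k * k) * (n : ℝ)) := by funext n; ring
    rw [this]
    exact tendsto_neg_atTop_atBot.comp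
      (tendsto_natCast_atTop_atTop.const_mul_atTop (mul_self_pos.2 hk))
  rw [zero_mul] at hlim
  exact norm_le_zero_iff.1 (ge_of_tendsto' hlim fun n => bound _)

theorem HasWeakDerivOn.sub {U : Set ℝ} {f f' g g' : L2} (hf : HasWeakDerivOn U f f')
    (hg : HasWeakDerivOn U g g') : HasWeakDerivOn U (f - g : L2) (f' - g' : L2) := by
  have := hf.add (hg.smul (-1))
  simpa only [neg_smul, one_smul, ← sub_eq_add_neg] using this

/-! ### Density of test functions in `H¹(ℝ)` and integration by parts -/

/-- The graph of the weak derivative on the line. -/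
def derivGraph : Submodule ℂ (WithLp 2 (L2 × L2)) where
  carrier := {x | HasWeakDerivOn univ x.fst x.snd}
  zero_mem' := HasWeakDerivOn.zero
  add_mem' := fun h h' => h.add h'
  smul_mem' := fun k _ h => h.smul k

theorem isClosed_derivGraph : IsClosed (derivGraph : Set (WithLp 2 (L2 × L2))) := by
  have : (derivGraph : Set (WithLp 2 (L2 × L2))) = ⋂ (φ : ℝ → ℝ) (h : IsTest φ),
      {x | inner ℂ (testLp h.deriv) x.fst = -inner ℂ (testLp h) x.snd} := by
    ext x
    simp only [mem_iInter]
    exact hasWeakDerivOn_univ_iff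
  rw [this]
  exact isClosed_iInter fun φ => isClosed_iInter fun h => isClosed_eq (by fun_prop) (by fun_prop)

/-- The pairs `(φ, φ')`, `φ` a complex linear combination of test functions. -/
def testGraph : Submodule ℂ (WithLp 2 (L2 × L2)) :=
  Submodule.span ℂ {x | ∃ (φ : ℝ → ℝ) (h : IsTest φ), x = WithLp.toLp 2 (testLp h, testLp h.deriv)}

/-- If `(f, f')` lies in the graph and is orthogonal to every `(φ, φ')`, then `f'` has weak
derivative `f`. Hence `f ± f'` solves `u' = ± u` and vanishes. This gives density without cut-offs
or mollifiers. -/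
theorem derivGraph_le_closure : derivGraph ≤ testGraph.topologicalClosure := by
  have hsub : testGraph.topologicalClosure ≤ derivGraph := by
    refine Submodule.topologicalClosure_minimal _ (Submodule.span_le.2 ?_) isClosed_derivGraph
    rintro _ ⟨φ, h, rfl⟩
    exact h.hasWeakDerivOn
  intro x hx
  obtain ⟨w, hw, u, hu, rfl⟩ :=
    Submodule.exists_add_mem_mem_orthogonal (K := testGraph.topologicalClosure) x
  have huG : u ∈ derivGraph := by simpa using Submodule.sub_mem _ hx (hsub hw)
  have h1 : HasWeakDerivOn univ u.fst u.snd := huG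
  have h2 : HasWeakDerivOn univ u.snd u.fst := by
    rw [hasWeakDerivOn_univ_iff]
    intro φ h
    have h0 := hu _ (Submodule.le_topologicalClosure _ (Submodule.subset_span ⟨φ, h, rfl⟩))
    rw [WithLp.prod_inner_apply] at h0
    exact eq_neg_of_add_eq_zero_right h0
  have h3 : u.fst + u.snd = 0 := by
    refine eq_zero_of_hasWeakDerivOn_smul one_ne_zero ?_
    rw [Complex.ofReal_one, one_smul]
    nth_rw 2 [add_comm]
    exact h1.add h2
  have h4 : u.fst - u.snd = 0 := by
    refine eq_zero_of_hasWeakDerivOn_smul (neg_ne_zero.2 one_ne_zero) ?_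
    have := h1.sub h2
    rwa [← neg_sub u.fst u.snd, ← neg_one_smul ℂ (u.fst - u.snd), ← Complex.ofReal_one,
      ← Complex.ofReal_neg] at this
  have h5 : u.fst = u.snd := sub_eq_zero.1 h4
  have h6 : u.snd = 0 := by
    rw [h5, ← two_smul ℂ] at h3
    exact (smul_eq_zero.1 h3).resolve_left two_ne_zero
  have h7 : u = 0 := (WithLp.ofLp_eq_zero 2).1 (Prod.ext (h5.trans h6) h6)
  rw [h7, add_zero]
  exact hw

/-- Integration by parts in `H¹(ℝ)`. -/
theorem inner_deriv_left {f f' h h' : L2} (hf : HasWeakDerivOn univ f f')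
    (hh : HasWeakDerivOn univ h h') : inner ℂ f' h = -inner ℂ f h' := by
  let B : WithLp 2 (L2 × L2) →L[ℂ] ℂ :=
    (innerSL ℂ f').comp (WithLp.fstL 2 ℂ L2 L2) + (innerSL ℂ f).comp (WithLp.sndL 2 ℂ L2 L2)
  -- For fixed `f` the identity says that a continuous linear form in `(h, h')` vanishes. On test
  -- pairs this is the definition of the weak derivative of `f`, so it extends to the closure.
  have hB : testGraph.topologicalClosure ≤ LinearMap.ker (B : WithLp 2 (L2 × L2) →ₗ[ℂ] ℂ) := by
    refine Submodule.topologicalClosure_minimal _ (Submodule.span_le.2 ?_) B.isClosed_ker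
    rintro _ ⟨φ, hφ, rfl⟩
    have e := congrArg (starRingEnd ℂ) (hasWeakDerivOn_univ_iff.1 hf φ hφ)
    rw [map_neg, inner_conj_symm, inner_conj_symm] at e
    change inner ℂ f' (testLp hφ) + inner ℂ f (testLp hφ.deriv) = 0
    rw [e, add_neg_cancel]
  have hx : WithLp.toLp 2 (h, h') ∈ derivGraph := hh
  exact eq_neg_of_add_eq_zero_left (hB (derivGraph_le_closure hx))

theorem re_inner_deriv_self {f f' : L2} (hf : HasWeakDerivOn univ f f') :
    (inner ℂ f f').re = 0 := by
  have h := inner_deriv_left hf hf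
  rw [← inner_conj_symm] at h
  have := congrArg Complex.re h
  simp only [Complex.conj_re, Complex.neg_re] at this
  linarith

/-- `f` has weak derivative `g` if it does so when tested against `H¹(ℝ)`. -/
theorem hasWeakDerivOn_of_inner {f g : L2}
    (H : ∀ h h' : L2, HasWeakDerivOn univ h h' → inner ℂ f h' = -inner ℂ g h) :
    HasWeakDerivOn univ f g := by
  rw [hasWeakDerivOn_univ_iff]
  intro φ hφ
  have := congrArg (starRingEnd ℂ) (H _ _ hφ.hasWeakDerivOn)
  rwa [map_neg, inner_conj_symm, inner_conj_symm] at this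

/-! ### The resolvent of the derivative -/

/-- `Re ⟨f, f'⟩ = 0` by skew-symmetry, while `Re ⟨f, κ f⟩ = Re κ ‖f‖²`. -/
theorem eq_zero_of_hasWeakDerivOn_complex_smul {κ : ℂ} (hκ : κ.re ≠ 0) {f : L2}
    (H : HasWeakDerivOn univ f (κ • f : L2)) : f = 0 := by
  have h0 := re_inner_deriv_self H
  rw [inner_smul_right, inner_self_eq_norm_sq_to_K] at h0
  simp only [Complex.coe_algebraMap] at h0
  rw [← Complex.ofReal_pow, Complex.re_mul_ofReal] at h0
  simpa [hκ] using h0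

/-- For `Re κ ≠ 0`, the operator `d/dx + κ` has a bounded right inverse on `L²(ℝ)`. -/
theorem exists_resolvent_deriv {κ : ℂ} (hκ : κ.re ≠ 0) :
    ∃ T : L2 →L[ℂ] L2, ∀ f, HasWeakDerivOn univ (T f) (f - κ • T f : L2) := by
  let B : derivGraph →L[ℂ] L2 := ((WithLp.sndL 2 ℂ L2 L2) + κ • (WithLp.fstL 2 ℂ L2 L2)).comp
    derivGraph.subtypeL
  have hBx : ∀ x : derivGraph, B x = x.1.snd + κ • x.1.fst := fun x => rfl
  have : CompleteSpace derivGraph := isClosed_derivGraph.completeSpace_coe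
  -- Skew-symmetry removes the derivative from `Re ⟨f, f' + κ f⟩`, leaving `Re κ ‖f‖²`.
  have low : ∀ x : derivGraph, |κ.re| * ‖x.1.fst‖ ≤ ‖B x‖ := by
    intro x
    have h0 := re_inner_deriv_self x.2
    have h1 : (inner ℂ x.1.fst (B x)).re = κ.re * ‖x.1.fst‖ ^ 2 := by
      rw [hBx, inner_add_right, inner_smul_right, inner_self_eq_norm_sq_to_K, Complex.add_re, h0,
        zero_add]
      simp only [Complex.coe_algebraMap]
      rw [← Complex.ofReal_pow, Complex.re_mul_ofReal]
    have h2 : |κ.re| * ‖x.1.fst‖ ^ 2 ≤ ‖x.1.fst‖ * ‖B x‖ := by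
      rw [← abs_of_nonneg (sq_nonneg ‖x.1.fst‖), ← abs_mul, ← h1]
      exact (Complex.abs_re_le_norm _).trans (norm_inner_le_norm _ _)
    rcases eq_or_lt_of_le (norm_nonneg x.1.fst) with h | h
    · rw [← h, mul_zero]
      exact norm_nonneg _
    · nlinarith
  have low' : ∀ x : derivGraph, ‖x‖ ≤ (1 + (‖κ‖ + 1) / |κ.re|) * ‖B x‖ := by
    intro x
    have hp : 0 < |κ.re| := abs_pos.2 hκ
    have h1 : ‖x.1.fst‖ ≤ ‖B x‖ / |κ.re| := by
      rw [le_div_iff₀ hp, mul_comm]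
      exact low x
    have h2 : ‖x.1.snd‖ ≤ ‖B x‖ + ‖κ‖ * ‖x.1.fst‖ := by
      rw [← norm_smul]
      have : x.1.snd = B x - κ • x.1.fst := by rw [hBx, add_sub_cancel_right]
      rw [this]
      exact norm_sub_le _ _
    have h3 : ‖x‖ ≤ ‖x.1.fst‖ + ‖x.1.snd‖ := by
      have e : ‖x‖ ^ 2 = ‖x.1.fst‖ ^ 2 + ‖x.1.snd‖ ^ 2 := WithLp.prod_norm_sq_eq_of_L2 x.1
      refine abs_le_of_sq_le_sq' ?_ (by positivity) |>.2
      rw [e]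
      nlinarith [norm_nonneg x.1.fst, norm_nonneg x.1.snd]
    calc ‖x‖ ≤ ‖x.1.fst‖ + (‖B x‖ + ‖κ‖ * ‖x.1.fst‖) := h3.trans (by linarith)
      _ = ‖B x‖ + (‖κ‖ + 1) * ‖x.1.fst‖ := by ring
      _ ≤ ‖B x‖ + (‖κ‖ + 1) * (‖B x‖ / |κ.re|) := by gcongr
      _ = _ := by ring
  have anti : AntilipschitzWith (Real.toNNReal (1 + (‖κ‖ + 1) / |κ.re|)) B := by
    refine ContinuousLinearMap.antilipschitz_of_bound _ fun x => ?_
    rw [Real.coe_toNNReal _ (by positivity)]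
    exact low' x
  have hclosed : IsClosed (LinearMap.range (B : derivGraph →ₗ[ℂ] L2) : Set L2) :=
    anti.isClosed_range B.uniformContinuous
  have : CompleteSpace (LinearMap.range (B : derivGraph →ₗ[ℂ] L2)) := hclosed.completeSpace_coe
  -- A vector `g` orthogonal to the range satisfies `⟨g, h'⟩ = -⟨conj κ g, h⟩` for all `h ∈ H¹(ℝ)`.
  -- So `g' = conj κ g`, and `g = 0`.
  have hrange : LinearMap.range (B : derivGraph →ₗ[ℂ] L2) = ⊤ := by
    rw [← Submodule.orthogonal_eq_bot_iff, Submodule.eq_bot_iff]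
    intro g hg
    have hg' : HasWeakDerivOn univ g (conj κ • g : L2) := by
      refine hasWeakDerivOn_of_inner fun h h' hh => ?_
      have h0 := inner_eq_zero_symm.1 (hg (B ⟨WithLp.toLp 2 (h, h'), hh⟩) ⟨_, rfl⟩)
      rw [hBx, inner_add_right, inner_smul_right] at h0
      rw [inner_smul_left, Complex.conj_conj]
      exact eq_neg_of_add_eq_zero_left h0
    exact eq_zero_of_hasWeakDerivOn_complex_smul (by rwa [Complex.conj_re]) hg'
  let E : derivGraph ≃L[ℂ] L2 := ContinuousLinearEquiv.ofBijective B
    (LinearMap.ker_eq_bot.2 anti.injective) hrange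
  refine ⟨(WithLp.fstL 2 ℂ L2 L2).comp (derivGraph.subtypeL.comp (E.symm : L2 →L[ℂ] derivGraph)),
    fun f => ?_⟩
  have h1 : HasWeakDerivOn univ (E.symm f).1.fst (E.symm f).1.snd := (E.symm f).2
  have h2 : (E.symm f).1.snd + κ • (E.symm f).1.fst = f := E.apply_symm_apply f
  have h3 : (E.symm f).1.snd = f - κ • (E.symm f).1.fst := eq_sub_of_add_eq h2
  rw [h3] at h1
  exact h1

/-! ### Diagonal operators on `ℓ²` and synthesis operators -/

theorem memℓp_mul_of_bounded {c : ℕ → ℂ} {B : ℝ} (hc : ∀ j, ‖c j‖ ≤ B) (y : ell2) :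
    Memℓp (fun j => c j * y j) 2 := by
  refine memℓp_gen ?_
  have hy : Summable fun j => ‖y j‖ ^ (2 : ℝ≥0∞).toReal := (lp.memℓp y).summable (by norm_num)
  refine Summable.of_nonneg_of_le (fun j => by positivity) (fun j => ?_)
    (hy.mul_left (B ^ (2 : ℝ≥0∞).toReal))
  have hB : 0 ≤ B := (norm_nonneg _).trans (hc j)
  rw [← Real.mul_rpow hB (norm_nonneg _), norm_mul]
  exact Real.rpow_le_rpow (by positivity) (mul_le_mul_of_nonneg_right (hc j) (norm_nonneg _))
    (by positivity)

/-- Multiplication of a square-summable sequence by a bounded complex sequence. -/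
def diagCLM (c : ℕ → ℂ) {B : ℝ} (hc : ∀ j, ‖c j‖ ≤ B) : ell2 →L[ℂ] ell2 :=
  LinearMap.mkContinuous
    { toFun := fun y => ⟨fun j => c j * y j, memℓp_mul_of_bounded hc y⟩
      map_add' := fun y y' => by
        ext j
        exact mul_add _ _ _
      map_smul' := fun k y => by
        ext j
        exact mul_left_comm _ _ _ } B fun y => by
    have hB : 0 ≤ B := (norm_nonneg _).trans (hc 0)
    refine lp.norm_le_of_forall_sum_le (by norm_num) (by positivity) fun s => ?_
    rw [Real.mul_rpow hB (norm_nonneg _)]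
    refine le_trans ?_ (mul_le_mul_of_nonneg_left
      (lp.sum_rpow_le_norm_rpow (by norm_num) y s) (by positivity))
    rw [Finset.mul_sum]
    refine Finset.sum_le_sum fun j _ => ?_
    rw [← Real.mul_rpow hB (norm_nonneg _)]
    refine Real.rpow_le_rpow (norm_nonneg _) ?_ (by positivity)
    change ‖c j * y j‖ ≤ _
    rw [norm_mul]
    exact mul_le_mul_of_nonneg_right (hc j) (norm_nonneg _)

@[simp]
theorem diagCLM_apply (c : ℕ → ℂ) {B : ℝ} (hc : ∀ j, ‖c j‖ ≤ B) (y : ell2) (j : ℕ) :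
    diagCLM c hc y j = c j * y j := rfl

/-- A bounded orthogonal sequence of nonzero vectors of a Hilbert space defines a bounded
operator `σ ↦ ∑ⱼ σⱼ eⱼ` on `ℓ²`. -/
theorem exists_synthesis {H : Type*} [NormedAddCommGroup H] [InnerProductSpace ℂ H]
    [CompleteSpace H] {e : ℕ → H} {B : ℝ} (hB : ∀ j, ‖e j‖ ≤ B) (hne : ∀ j, e j ≠ 0)
    (ho : ∀ i j, i ≠ j → inner ℂ (e i) (e j) = 0) :
    ∃ X : ell2 →L[ℂ] H, ∀ σ : ell2, HasSum (fun j => σ j • e j) (X σ) := by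
  -- The vectors are normalised and their norms absorbed into a bounded diagonal multiplier.
  have hv : Orthonormal ℂ fun j => ((‖e j‖ : ℂ)⁻¹) • e j := by
    refine ⟨fun j => ?_, fun i j hij => ?_⟩
    · rw [norm_smul, norm_inv, Complex.norm_real, norm_norm,
        inv_mul_cancel₀ (norm_ne_zero_iff.2 (hne j))]
    · change inner ℂ _ _ = _
      rw [inner_smul_left, inner_smul_right, ho i j hij, mul_zero, mul_zero]
  have hc : ∀ j, ‖((‖e j‖ : ℝ) : ℂ)‖ ≤ B := fun j => by
    rw [Complex.norm_real, norm_norm]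
    exact hB j
  refine ⟨hv.orthogonalFamily.linearIsometry.toContinuousLinearMap.comp (diagCLM _ hc),
    fun σ => ?_⟩
  have h := hv.orthogonalFamily.hasSum_linearIsometry (diagCLM _ hc σ)
  have e : ∀ j, LinearIsometry.toSpanSingleton ℂ H (hv.1 j)
      (diagCLM (fun j => (‖e j‖ : ℂ)) hc σ j) = σ j • e j := fun j => ?_
  · simp only [e] at h
    exact h
  rw [LinearIsometry.toSpanSingleton_apply, diagCLM_apply, smul_smul]
  congr 1
  have : (‖e j‖ : ℂ) ≠ 0 := Complex.ofReal_ne_zero.2 (norm_ne_zero_iff.2 (hne j))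
  field_simp

/-! ### Functions supported on translates of an interval -/

/-- The function `w(· - s)` cut off to the interval `[s, s + δ)`. -/
def piece (w : ℝ → ℂ) (δ s : ℝ) : ℝ → ℂ := (Ico s (s + δ)).indicator fun x => w (x - s)

variable {w : ℝ → ℂ}

theorem memLp_piece (hw : Continuous w) (δ s : ℝ) : MemLp (piece w δ s) 2 volume := by
  unfold piece
  rw [memLp_indicator_iff_restrict measurableSet_Ico]
  have hc : Continuous fun x => w (x - s) := by fun_prop
  obtain ⟨C, hC⟩ := (isCompact_Icc (a := s) (b := s + δ)).exists_bound_of_continuousOn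
    hc.continuousOn
  have : IsFiniteMeasure (volume.restrict (Ico s (s + δ))) := ⟨by simp⟩
  refine MemLp.of_bound hc.aestronglyMeasurable C ?_
  rw [ae_restrict_iff' measurableSet_Ico]
  exact Eventually.of_forall fun x hx => hC x (Ico_subset_Icc_self hx)

/-- `piece` as an element of `L²(ℝ)`. -/
def pieceLp (hw : Continuous w) (δ s : ℝ) : L2 := (memLp_piece hw δ s).toLp

theorem coeFn_pieceLp (hw : Continuous w) (δ s : ℝ) : pieceLp hw δ s =ᵐ[volume] piece w δ s :=
  (memLp_piece hw δ s).coeFn_toLp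

theorem norm_pieceLp (hw : Continuous w) (δ s : ℝ) : ‖pieceLp hw δ s‖ = ‖pieceLp hw δ 0‖ := by
  rw [pieceLp, pieceLp, Lp.norm_toLp, Lp.norm_toLp]
  have e : piece w δ s = piece w δ 0 ∘ fun x => x - s := by
    funext x
    have : x ∈ Ico s (s + δ) ↔ x - s ∈ Ico 0 (0 + δ) := by
      rw [mem_Ico, mem_Ico]
      constructor <;> rintro ⟨h1, h2⟩ <;> constructor <;> linarith
    simp only [piece, Function.comp_apply, indicator, this, sub_zero]
  rw [e]
  exact congrArg ENNReal.toReal (eLpNorm_comp_measurePreserving (memLp_piece hw δ 0).1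
    (measurePreserving_sub_right volume s))

theorem inner_pieceLp (hw : Continuous w) (δ s : ℝ) (f : L2) :
    inner ℂ (pieceLp hw δ s) f = ∫ x in Ico s (s + δ), conj (w (x - s)) * f x := by
  rw [L2.inner_def, ← integral_indicator measurableSet_Ico]
  refine integral_congr_ae ?_
  filter_upwards [coeFn_pieceLp hw δ s] with x hx
  rw [hx, piece, RCLike.inner_apply, mul_comm]
  by_cases h : x ∈ Ico s (s + δ) <;> simp [h]

theorem pieceLp_ne_zero (hw : Continuous w) {δ : ℝ} (hδ : 0 < δ) (h0 : w 0 ≠ 0) (s : ℝ) :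
    pieceLp hw δ s ≠ 0 := by
  intro h
  have h1 : ∀ᵐ x, piece w δ s x = 0 := by
    filter_upwards [coeFn_pieceLp hw δ s, Lp.eq_zero_iff_ae_eq_zero.1 h] with x hx hx'
    rw [← hx, hx', Pi.zero_apply]
  have h2 : ∀ᶠ x in 𝓝[>] s, w (x - s) ≠ 0 ∧ x ∈ Ico s (s + δ) := by
    have hc : ContinuousAt (fun x => w (x - s)) s := by fun_prop
    refine ((hc.eventually_ne (by simpa using h0)).filter_mono nhdsWithin_le_nhds).and ?_
    exact Ico_mem_nhdsGT (by linarith)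
  have h3 := (h2.filter_mono inf_le_left).and (h1.filter_mono inf_le_right :
    ∀ᶠ x in 𝓝[>] s ⊓ ae volume, _)
  obtain ⟨x, ⟨hx1, hx2⟩, hx3⟩ := h3.exists
  rw [piece, indicator_of_mem hx2] at hx3
  exact hx1 hx3

theorem piece_eq_zero {δ s x : ℝ} (h : δ ≤ |x - s|) : piece w δ s x = 0 := by
  refine indicator_of_notMem (fun hx => ?_) _
  rw [abs_of_nonneg (by linarith [hx.1])] at h
  linarith [hx.2]

theorem inner_pieceLp_pieceLp {w' : ℝ → ℂ} (hw : Continuous w) (hw' : Continuous w') {δ s t : ℝ}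
    (h : 2 * δ ≤ |s - t|) : inner ℂ (pieceLp hw δ s) (pieceLp hw' δ t) = 0 := by
  rw [L2.inner_def]
  refine integral_eq_zero_of_ae ?_
  filter_upwards [coeFn_pieceLp hw δ s, coeFn_pieceLp hw' δ t] with x hx hx'
  rw [hx, hx', Pi.zero_apply]
  rcases le_or_gt δ |x - s| with h1 | h1
  · rw [piece_eq_zero h1, inner_zero_left]
  · rw [piece_eq_zero (s := t), inner_zero_right]
    have := abs_sub_le s x t
    rw [abs_sub_comm s x] at this
    linarith

/-! ### Traces of `H¹(ℝ)` functions -/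

/-- The linear function decreasing from `1` at `0` to `0` at `δ`. -/
def ramp (δ : ℝ) (t : ℝ) : ℂ := ((1 - t / δ : ℝ) : ℂ)

/-- The derivative of `ramp`. -/
def rampDeriv (δ : ℝ) (_ : ℝ) : ℂ := ((-(1 / δ) : ℝ) : ℂ)

theorem continuous_ramp (δ : ℝ) : Continuous (ramp δ) := by unfold ramp; fun_prop

theorem continuous_rampDeriv (δ : ℝ) : Continuous (rampDeriv δ) := continuous_const

/-- The sawtooth on `[s, s + δ)`, with jump `1` at `s`. -/
def saw (δ s : ℝ) : L2 := pieceLp (continuous_ramp δ) δ s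

/-- The derivative of the sawtooth away from `s`. -/
def sawDeriv (δ s : ℝ) : L2 := pieceLp (continuous_rampDeriv δ) δ s

/-- The ramp falls from `1` to `0` on `[s, s + δ]`, so integration by parts keeps only the endpoint
`s`. In distributions, `saw' = sawDeriv + δ_s`; both point values and prescribed jumps come from
this identity. -/
theorem inner_saw_testLp {δ : ℝ} (hδ : 0 < δ) (s : ℝ) {φ : ℝ → ℝ} (h : IsTest φ) :
    inner ℂ (saw δ s) (testLp h.deriv) + inner ℂ (sawDeriv δ s) (testLp h) = -(φ s : ℂ) := by
  have hle : s ≤ s + δ := by linarith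
  have e1 : inner ℂ (saw δ s) (testLp h.deriv) =
      ((∫ x in s..(s + δ), (1 - (x - s) / δ) * deriv φ x : ℝ) : ℂ) := by
    rw [saw, inner_pieceLp, intervalIntegral.integral_of_le hle, ← integral_Ico_eq_integral_Ioc,
      ← integral_complex_ofReal]
    refine integral_congr_ae (ae_restrict_of_ae ?_)
    filter_upwards [coeFn_testLp h.deriv] with x hx
    rw [hx, ramp, Complex.conj_ofReal, ← Complex.ofReal_mul]
  have e2 : inner ℂ (sawDeriv δ s) (testLp h) =
      ((∫ x in s..(s + δ), (-(1 / δ)) * φ x : ℝ) : ℂ) := by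
    rw [sawDeriv, inner_pieceLp, intervalIntegral.integral_of_le hle,
      ← integral_Ico_eq_integral_Ioc, ← integral_complex_ofReal]
    refine integral_congr_ae (ae_restrict_of_ae ?_)
    filter_upwards [coeFn_testLp h] with x hx
    rw [hx, rampDeriv, Complex.conj_ofReal, ← Complex.ofReal_mul]
  have hc1 : Continuous fun x => (1 - (x - s) / δ) * deriv φ x := by
    have := h.deriv.continuous
    fun_prop
  have hc2 : Continuous fun x => (-(1 / δ)) * φ x := h.continuous.const_mul _
  rw [e1, e2, ← Complex.ofReal_add, ← Complex.ofReal_neg, ← intervalIntegral.integral_add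
    (hc1.intervalIntegrable _ _) (hc2.intervalIntegrable _ _)]
  congr 1
  refine (intervalIntegral.integral_eq_sub_of_hasDerivAt (f := fun x => (1 - (x - s) / δ) * φ x)
    (fun x _ => ?_) ((hc1.add hc2).intervalIntegrable _ _)).trans ?_
  · have h1 : HasDerivAt (fun x => 1 - (x - s) / δ) (-(1 / δ)) x :=
      (((hasDerivAt_id x).sub_const s).div_const δ).const_sub 1
    refine (h1.mul (h.hasDerivAt x)).congr_deriv ?_
    rw [Pi.add_apply]
    ring
  · field_simp
    ring

/-- The value at `s` of the function `h ∈ H¹(ℝ)` with derivative `h'`. -/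
def pointValue (δ : ℝ) (h h' : L2) (s : ℝ) : ℂ :=
  -inner ℂ (saw δ s) h' - inner ℂ (sawDeriv δ s) h

/-- Translates of a sawtooth have equal norm, so the bound does not depend on `s`. Convergence in
the graph norm therefore becomes uniform convergence of point values. -/
theorem norm_pointValue_sub_le (δ : ℝ) (h h' k k' : L2) (s : ℝ) :
    ‖pointValue δ h h' s - pointValue δ k k' s‖ ≤
      ‖saw δ 0‖ * ‖h' - k'‖ + ‖sawDeriv δ 0‖ * ‖h - k‖ := by
  have e : pointValue δ h h' s - pointValue δ k k' s =
      -inner ℂ (saw δ s) (h' - k') - inner ℂ (sawDeriv δ s) (h - k) := by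
    simp only [pointValue, inner_sub_right]
    ring
  rw [e]
  refine (norm_sub_le _ _).trans (add_le_add ?_ ?_)
  · rw [norm_neg]
    exact (norm_inner_le_norm _ _).trans_eq (by rw [saw, norm_pieceLp, saw])
  · exact (norm_inner_le_norm _ _).trans_eq (by rw [sawDeriv, norm_pieceLp, sawDeriv])

theorem pointValue_of_mem_testGraph {δ : ℝ} (hδ : 0 < δ) {x : WithLp 2 (L2 × L2)}
    (hx : x ∈ testGraph) : Continuous (pointValue δ x.fst x.snd) ∧
      x.fst =ᵐ[volume] pointValue δ x.fst x.snd := by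
  induction hx using Submodule.span_induction with
  | mem x h =>
    obtain ⟨φ, hφ, rfl⟩ := h
    have e : pointValue δ (testLp hφ) (testLp hφ.deriv) = fun s => (φ s : ℂ) := by
      funext s
      rw [pointValue, ← neg_add', inner_saw_testLp hδ, neg_neg]
    change Continuous (pointValue δ (testLp hφ) (testLp hφ.deriv)) ∧
      testLp hφ =ᵐ[volume] pointValue δ (testLp hφ) (testLp hφ.deriv)
    rw [e]
    exact ⟨Complex.continuous_ofReal.comp hφ.continuous, coeFn_testLp hφ⟩
  | zero =>
    have e : pointValue δ (0 : L2) (0 : L2) = fun s => 0 := by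
      funext s
      simp [pointValue]
    change Continuous (pointValue δ (0 : L2) (0 : L2)) ∧
      (0 : L2) =ᵐ[volume] pointValue δ (0 : L2) (0 : L2)
    rw [e]
    exact ⟨continuous_const, Lp.coeFn_zero _ _ _⟩
  | add x y _ _ hx hy =>
    have e : pointValue δ (x + y).fst (x + y).snd =
        fun s => pointValue δ x.fst x.snd s + pointValue δ y.fst y.snd s := by
      funext s
      simp only [pointValue, WithLp.add_fst, WithLp.add_snd, inner_add_right]
      ring
    rw [e]
    refine ⟨hx.1.add hy.1, ?_⟩
    rw [WithLp.add_fst]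
    filter_upwards [hx.2, hy.2, Lp.coeFn_add x.fst y.fst] with s h1 h2 h3
    rw [h3, Pi.add_apply, ← h1, ← h2]
  | smul k x _ hx =>
    have e : pointValue δ (k • x).fst (k • x).snd = fun s => k * pointValue δ x.fst x.snd s := by
      funext s
      simp only [pointValue, WithLp.smul_fst, WithLp.smul_snd, inner_smul_right]
      ring
    rw [e]
    refine ⟨hx.1.const_mul k, ?_⟩
    rw [WithLp.smul_fst]
    filter_upwards [hx.2, Lp.coeFn_smul k x.fst] with s h1 h3
    rw [h3, Pi.smul_apply, ← h1, smul_eq_mul]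

/-- Functions in `H¹(ℝ)` have a continuous representative. -/
theorem pointValue_continuous_ae_eq {δ : ℝ} (hδ : 0 < δ) {h h' : L2}
    (hh : HasWeakDerivOn univ h h') :
    Continuous (pointValue δ h h') ∧ h =ᵐ[volume] pointValue δ h h' := by
  have hx : WithLp.toLp 2 (h, h') ∈ derivGraph := hh
  obtain ⟨u, hu, hlim⟩ := mem_closure_iff_seq_limit.1 (derivGraph_le_closure hx)
  have h1 : Tendsto (fun n => (u n).fst) atTop (𝓝 h) :=
    ((WithLp.fstL 2 ℂ L2 L2).continuous.tendsto _).comp hlim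
  have h2 : Tendsto (fun n => (u n).snd) atTop (𝓝 h') :=
    ((WithLp.sndL 2 ℂ L2 L2).continuous.tendsto _).comp hlim
  have hunif : TendstoUniformly (fun n => pointValue δ (u n).fst (u n).snd)
      (pointValue δ h h') atTop := by
    rw [Metric.tendstoUniformly_iff]
    intro ε hε
    have h3 : Tendsto (fun n => ‖saw δ 0‖ * ‖h' - (u n).snd‖ + ‖sawDeriv δ 0‖ * ‖h - (u n).fst‖)
        atTop (𝓝 (‖saw δ 0‖ * ‖h' - h'‖ + ‖sawDeriv δ 0‖ * ‖h - h‖)) :=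
      ((h2.const_sub h').norm.const_mul _).add ((h1.const_sub h).norm.const_mul _)
    simp only [sub_self, norm_zero, mul_zero, add_zero] at h3
    filter_upwards [h3.eventually_lt_const hε] with n hn s
    rw [dist_eq_norm]
    exact (norm_pointValue_sub_le δ _ _ _ _ s).trans_lt hn
  refine ⟨hunif.continuous (Eventually.of_forall fun n =>
    (pointValue_of_mem_testGraph hδ (hu n)).1).frequently, ?_⟩
  -- A subsequence of the approximations converges almost everywhere to `h`. Their representatives
  -- converge everywhere to `pointValue δ h h'`, so the two limits agree almost everywhere.
  obtain ⟨ns, hns, hae⟩ := (tendstoInMeasure_of_tendsto_Lp h1).exists_seq_tendsto_ae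
  have hall : ∀ᵐ s, ∀ n, (u n).fst s = pointValue δ (u n).fst (u n).snd s :=
    ae_all_iff.2 fun n => (pointValue_of_mem_testGraph hδ (hu n)).2
  filter_upwards [hae, hall] with s hs1 hs2
  simp only [hs2] at hs1
  exact tendsto_nhds_unique hs1 ((hunif.tendsto_at s).comp hns.tendsto_atTop)

theorem hasTrace_pointValue {δ : ℝ} (hδ : 0 < δ) {h h' : L2} (hh : HasWeakDerivOn univ h h')
    (s : ℝ) : HasTrace h (𝓝 s) (pointValue δ h h' s) := by
  obtain ⟨hc, hae⟩ := pointValue_continuous_ae_eq hδ hh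
  exact HasTrace.congr_ae ((hc.tendsto s).mono_left inf_le_left) hae.symm

theorem HasTrace.mono {f : ℝ → ℂ} {l l' : Filter ℝ} {c : ℂ} (h : HasTrace f l c) (hl : l' ≤ l) :
    HasTrace f l' c :=
  Tendsto.mono_left h (inf_le_inf_right _ hl)

theorem HasTrace.hasJump_zero {f : ℝ → ℂ} {s : ℝ} {c : ℂ} (h : HasTrace f (𝓝 s) c) :
    HasJump f s 0 :=
  ⟨c, c, h.mono nhdsWithin_le_nhds, h.mono nhdsWithin_le_nhds, sub_self c⟩

theorem HasTrace.unique {f : ℝ → ℂ} {s : ℝ} {c d : ℂ} (hc : HasTrace f (𝓝 s) c)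
    (hd : HasTrace f (𝓝 s) d) : c = d :=
  tendsto_nhds_unique (hc.mono (nhdsWithin_le_nhds (s := Ioi s)))
    (hd.mono (nhdsWithin_le_nhds (s := Ioi s)))

/-! ### Removable points of weak derivatives -/

/-- A smooth bump equal to `1` on `[-1, 1]` and to `0` off `(-2, 2)`. -/
def unitBump : ContDiffBump (0 : ℝ) := ⟨1, 2, one_pos, one_lt_two⟩

/-- The bump of width `ε` centred at `s`. -/
def bumpAt (s ε : ℝ) (x : ℝ) : ℝ := unitBump ((x - s) / ε)

theorem contDiff_bumpAt (s ε : ℝ) : ContDiff ℝ ∞ (bumpAt s ε) :=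
  unitBump.contDiff.comp ((contDiff_id.sub contDiff_const).div_const ε)

theorem bumpAt_eq_one {s ε x : ℝ} (hε : 0 < ε) (h : |x - s| ≤ ε) : bumpAt s ε x = 1 := by
  refine unitBump.one_of_mem_closedBall ?_
  rw [Metric.mem_closedBall, Real.dist_eq, sub_zero, abs_div, abs_of_pos hε]
  exact (div_le_one hε).2 h

theorem bumpAt_eq_zero {s ε x : ℝ} (hε : 0 < ε) (h : 2 * ε ≤ |x - s|) : bumpAt s ε x = 0 := by
  refine unitBump.zero_of_le_dist ?_
  rw [Real.dist_eq, sub_zero, abs_div, abs_of_pos hε]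
  exact (le_div_iff₀ hε).2 h

theorem isTest_bumpAt (s : ℝ) {ε : ℝ} (hε : 0 < ε) : IsTest (bumpAt s ε) := by
  refine ⟨contDiff_bumpAt s ε, HasCompactSupport.intro
    (isCompact_Icc (a := s - 2 * ε) (b := s + 2 * ε)) fun x hx => bumpAt_eq_zero hε ?_⟩
  by_contra hlt
  have := abs_lt.1 (not_le.1 hlt)
  exact hx ⟨by linarith [this.1], by linarith [this.2]⟩

theorem norm_bumpAt_le (s ε x : ℝ) : ‖bumpAt s ε x‖ ≤ 1 := by
  rw [bumpAt, Real.norm_of_nonneg unitBump.nonneg]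
  exact unitBump.le_one

theorem exists_deriv_bumpAt_le : ∃ C, 0 ≤ C ∧ ∀ s ε x : ℝ, 0 < ε →
    ‖deriv (bumpAt s ε) x‖ ≤ C / ε := by
  have hu : Continuous (deriv unitBump) := unitBump.contDiff.continuous_deriv (n := ∞) (by simp)
  obtain ⟨C, hC⟩ := unitBump.hasCompactSupport.deriv.exists_bound_of_continuous hu
  refine ⟨C, (norm_nonneg _).trans (hC 0), fun s ε x hε => ?_⟩
  have h1 : HasDerivAt (bumpAt s ε) (deriv unitBump ((x - s) / ε) * (1 / ε)) x := by
    have h2 : HasDerivAt unitBump (deriv unitBump ((x - s) / ε)) ((x - s) / ε) :=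
      ((unitBump.contDiff (n := 1)).differentiable (by simp) _).hasDerivAt
    exact h2.comp x (((hasDerivAt_id x).sub_const s).div_const ε)
  rw [h1.deriv, norm_mul, norm_div, norm_one, Real.norm_of_nonneg hε.le, mul_one_div]
  exact div_le_div_of_nonneg_right (hC _) hε.le

theorem deriv_bumpAt_eq_zero {s ε x : ℝ} (hε : 0 < ε) (h : x ∉ Icc (s - 2 * ε) (s + 2 * ε)) :
    deriv (bumpAt s ε) x = 0 := by
  have : bumpAt s ε =ᶠ[𝓝 x] fun _ => 0 := by
    filter_upwards [isClosed_Icc.isOpen_compl.mem_nhds h] with y hy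
    refine bumpAt_eq_zero hε ?_
    by_contra hlt
    have := abs_lt.1 (not_le.1 hlt)
    exact hy ⟨by linarith [this.1], by linarith [this.2]⟩
  rw [this.deriv_eq, deriv_const]

theorem tendsto_integral_bumpAt (s : ℝ) {ε : ℕ → ℝ} (hε : ∀ n, 0 < ε n)
    (hlim : Tendsto ε atTop (𝓝 0)) {k : ℝ → ℂ} (hk : Integrable k) :
    Tendsto (fun n => ∫ x, bumpAt s (ε n) x • k x) atTop (𝓝 0) := by
  rw [← integral_zero ℝ ℂ]
  refine tendsto_integral_of_dominated_convergence (fun x => ‖k x‖)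
    (fun n => (contDiff_bumpAt s (ε n)).continuous.aestronglyMeasurable.smul hk.1) hk.norm
    (fun n => Eventually.of_forall fun x => ?_) ?_
  · rw [norm_smul]
    exact mul_le_of_le_one_left (norm_nonneg _) (norm_bumpAt_le _ _ _)
  · have hs : ∀ᵐ x : ℝ, x ≠ s := by simp [ae_iff]
    filter_upwards [hs] with x hx
    have hpos : 0 < |x - s| / 2 := by
      have := abs_pos.2 (sub_ne_zero.2 hx)
      linarith
    refine tendsto_const_nhds.congr' ?_
    filter_upwards [hlim.eventually_lt_const hpos] with n hn
    rw [bumpAt_eq_zero (hε n) (by linarith), zero_smul]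

/-- Equal one-sided limits control `f` on a punctured neighbourhood up to null sets, and the point
`s` is itself null. -/
theorem HasTrace.exists_ae_norm_sub_le {f : ℝ → ℂ} {s : ℝ} {c : ℂ}
    (hr : HasTrace f (𝓝[>] s) c) (hl : HasTrace f (𝓝[<] s) c) {η : ℝ} (hη : 0 < η) :
    ∃ r > 0, ∀ᵐ x, |x - s| < r → ‖f x - c‖ ≤ η := by
  have hev : ∀ l : Filter ℝ, HasTrace f l c → ∃ t ∈ l, ∀ᵐ x, x ∈ t → ‖f x - c‖ ≤ η := by
    intro l hf
    have h1 : ∀ᶠ x in l ⊓ ae volume, ‖f x - c‖ ≤ η := by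
      filter_upwards [Metric.tendsto_nhds.1 hf η hη] with x hx
      rw [← dist_eq_norm]
      exact hx.le
    obtain ⟨t, ht, v, hv, e⟩ := mem_inf_iff.1 h1
    refine ⟨t, ht, ?_⟩
    filter_upwards [hv] with x hx hxt
    have : x ∈ {x | ‖f x - c‖ ≤ η} := e ▸ ⟨hxt, hx⟩
    exact this
  obtain ⟨t, ht, h1⟩ := hev _ hr
  obtain ⟨t', ht', h2⟩ := hev _ hl
  have hmem : t ∪ t' ∈ 𝓝[≠] s := by
    rw [← nhdsLT_sup_nhdsGT]
    exact ⟨mem_of_superset ht' subset_union_right, mem_of_superset ht subset_union_left⟩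
  obtain ⟨r, hr0, hsub⟩ := Metric.mem_nhdsWithin_iff.1 hmem
  refine ⟨r, hr0, ?_⟩
  have hs : ∀ᵐ x : ℝ, x ≠ s := by simp [ae_iff]
  filter_upwards [h1, h2, hs] with x hx1 hx2 hxs hxr
  rcases hsub ⟨by rwa [Metric.mem_ball, Real.dist_eq], hxs⟩ with h | h
  · exact hx1 h
  · exact hx2 h

/-- The derivative of the bump has integral zero, so `h` may be replaced by `h - c`. That derivative
is of size `C / ε` on an interval of length `4 ε`, and `h - c` is small there. -/
theorem tendsto_integral_deriv_bumpAt {h : ℝ → ℂ} {s : ℝ} {c : ℂ} (hh : LocallyIntegrable h)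
    (hr : HasTrace h (𝓝[>] s) c) (hl : HasTrace h (𝓝[<] s) c) {ε : ℕ → ℝ} (hε : ∀ n, 0 < ε n)
    (hlim : Tendsto ε atTop (𝓝 0)) :
    Tendsto (fun n => ∫ x, deriv (bumpAt s (ε n)) x • h x) atTop (𝓝 0) := by
  obtain ⟨C, hC0, hC⟩ := exists_deriv_bumpAt_le
  rw [Metric.tendsto_nhds]
  intro η hη
  -- The product of height and length is `4 C`; the extra `1` gives a strict inequality and covers
  -- `C = 0`.
  obtain ⟨r, hr0, hae⟩ := hr.exists_ae_norm_sub_le hl (η := η / (4 * C + 1)) (by positivity)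
  filter_upwards [hlim.eventually_lt_const (show 0 < r / 2 by linarith)] with n hn
  have htest := isTest_bumpAt s (hε n)
  have hint : Integrable fun x => deriv (bumpAt s (ε n)) x • h x :=
    hh.integrable_smul_left_of_hasCompactSupport htest.deriv.continuous htest.deriv.2
  have hintc : Integrable fun x => deriv (bumpAt s (ε n)) x • c :=
    htest.deriv.integrable.smul_const c
  have h0 : ∫ x, deriv (bumpAt s (ε n)) x • c = 0 := by
    rw [integral_smul_const, integral_eq_zero_of_hasDerivAt_of_integrable
      (fun x => htest.hasDerivAt x) htest.deriv.integrable htest.integrable, zero_smul]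
  have e : ∫ x, deriv (bumpAt s (ε n)) x • h x =
      ∫ x in Icc (s - 2 * ε n) (s + 2 * ε n), deriv (bumpAt s (ε n)) x • (h x - c) := by
    rw [setIntegral_eq_integral_of_forall_compl_eq_zero fun x hx => by
      rw [deriv_bumpAt_eq_zero (hε n) hx, zero_smul]]
    simp only [smul_sub]
    rw [integral_sub hint hintc, h0, sub_zero]
  rw [dist_zero_right, e]
  refine lt_of_le_of_lt (norm_setIntegral_le_of_norm_le_const_ae'
    (C := C / ε n * (η / (4 * C + 1))) (by simp) ?_) ?_
  · filter_upwards [hae] with x hx hxI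
    rw [norm_smul]
    refine mul_le_mul (hC _ _ _ (hε n)) (hx ?_) (norm_nonneg _) (by have := hε n; positivity)
    rw [abs_lt]
    constructor <;> linarith [hxI.1, hxI.2]
  · have hp := hε n
    rw [Real.volume_real_Icc_of_le (by linarith)]
    have : C / ε n * (η / (4 * C + 1)) * (s + 2 * ε n - (s - 2 * ε n)) =
        η * ((4 * C) / (4 * C + 1)) := by
      field_simp
      ring
    rw [this]
    exact mul_lt_of_lt_one_right hη ((div_lt_one (by positivity)).2 (by linarith))

/-- A weak derivative on the complement of a finite set of points at which the function has no
jump is a weak derivative. -/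
theorem HasWeakDerivOn.of_diff_finset {U : Set ℝ} {f g : ℝ → ℂ} (hf : LocallyIntegrable f)
    (hg : LocallyIntegrable g) (T : Finset ℝ) (hw : HasWeakDerivOn (U \ T) f g)
    (hj : ∀ s ∈ T, HasJump f s 0) : HasWeakDerivOn U f g := by
  induction T using Finset.induction_on generalizing U with
  | empty => simpa using hw
  | insert s T hs ih =>
    have hw' : HasWeakDerivOn (U \ {s}) f g := by
      refine ih ?_ fun t ht => hj t (Finset.mem_insert_of_mem ht)
      rw [sdiff_sdiff, ← Finset.coe_singleton, ← Finset.coe_union]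
      exact hw
    obtain ⟨r, l, hr, hl, hrl⟩ := hj s (Finset.mem_insert_self _ _)
    rw [sub_eq_zero] at hrl
    subst hrl
    intro φ h1 h2 h3
    have hφ : IsTest φ := ⟨h1, h2⟩
    obtain ⟨ε, hεpos, hεlim⟩ : ∃ ε : ℕ → ℝ, (∀ n, 0 < ε n) ∧ Tendsto ε atTop (𝓝 0) :=
      ⟨fun n => 1 / ((n : ℝ) + 1), fun n => by positivity, tendsto_one_div_add_atTop_nhds_zero_nat⟩
    have hint : ∀ {k : ℝ → ℂ} {ψ : ℝ → ℝ}, LocallyIntegrable k → IsTest ψ →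
        Integrable fun x => ψ x • k x := fun hk hψ =>
      hk.integrable_smul_left_of_hasCompactSupport hψ.continuous hψ.2
    -- The test function `(1 - bump) φ` vanishes near `s`, so the hypothesis applies to it. Of the
    -- three error terms, those containing the bump itself vanish as `ε → 0` by dominated
    -- convergence. The one containing its derivative vanishes because `φ f` has equal one-sided
    -- values at `s`.
    have key : ∀ n, (∫ x, deriv φ x • f x) + ∫ x, φ x • g x =
        (∫ x, bumpAt s (ε n) x • (deriv φ x • f x)) +
          (∫ x, deriv (bumpAt s (ε n)) x • (φ x • f x)) +
            ∫ x, bumpAt s (ε n) x • (φ x • g x) := by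
      intro n
      have hb := isTest_bumpAt s (hεpos n)
      have hψ : IsTest fun x => (1 - bumpAt s (ε n) x) * φ x :=
        hφ.mul (contDiff_const.sub hb.1)
      have hd : deriv (fun x => (1 - bumpAt s (ε n) x) * φ x) = fun x =>
          deriv φ x - bumpAt s (ε n) x * deriv φ x - deriv (bumpAt s (ε n)) x * φ x := by
        funext x
        refine (((hb.hasDerivAt x).const_sub 1).mul (hφ.hasDerivAt x)).deriv.trans ?_
        ring
      have hsupp : tsupport (fun x => (1 - bumpAt s (ε n) x) * φ x) ⊆ U \ {s} := by
        intro x hx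
        refine ⟨h3 (tsupport_mul_subset_right hx), fun hxs => ?_⟩
        rw [mem_singleton_iff] at hxs
        subst hxs
        refine notMem_tsupport_iff_eventuallyEq.2 ?_ hx
        filter_upwards [Metric.ball_mem_nhds x (hεpos n)] with y hy
        rw [Metric.mem_ball, Real.dist_eq] at hy
        rw [bumpAt_eq_one (hεpos n) hy.le, sub_self, zero_mul, Pi.zero_apply]
      have e := hw' _ hψ.1 hψ.2 hsupp
      rw [hd] at e
      have i1 := hint hf hφ.deriv
      have i2 := hint hf (hφ.deriv.mul hb.1)
      have i3 := hint hf (hφ.mul hb.deriv.1)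
      have i4 := hint hg hφ
      have i5 := hint hg (hφ.mul hb.1)
      have e1 : ∫ x, (deriv φ x - bumpAt s (ε n) x * deriv φ x -
          deriv (bumpAt s (ε n)) x * φ x) • f x = (∫ x, deriv φ x • f x) -
            (∫ x, (bumpAt s (ε n) x * deriv φ x) • f x) -
              ∫ x, (deriv (bumpAt s (ε n)) x * φ x) • f x := by
        simp only [sub_smul]
        refine (integral_sub (i1.sub i2) i3).trans ?_
        congr 1
        exact integral_sub i1 i2
      have e2 : ∫ x, ((1 - bumpAt s (ε n) x) * φ x) • g x = (∫ x, φ x • g x) -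
          ∫ x, (bumpAt s (ε n) x * φ x) • g x := by
        simp only [sub_mul, one_mul, sub_smul]
        rw [integral_sub i4 i5]
      rw [e1, e2] at e
      simp only [smul_smul]
      linear_combination e
    have htr : ∀ {l' : Filter ℝ}, l' ≤ 𝓝 s → HasTrace f l' r →
        HasTrace (fun x => φ x • f x) l' (φ s • r) := fun hl' h =>
      Tendsto.smul ((hφ.continuous.tendsto s).mono_left (inf_le_left.trans hl')) h
    have lim := ((tendsto_integral_bumpAt s hεpos hεlim (hint hf hφ.deriv)).add
      (tendsto_integral_deriv_bumpAt (hint hf hφ).locallyIntegrable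
        (htr nhdsWithin_le_nhds hr) (htr nhdsWithin_le_nhds hl) hεpos hεlim)).add
      (tendsto_integral_bumpAt s hεpos hεlim (hint hg hφ))
    simp only [← key, add_zero] at lim
    exact eq_neg_of_add_eq_zero_left (tendsto_nhds_unique tendsto_const_nhds lim)

theorem HasWeakDerivOn.mono {U V : Set ℝ} {f g : ℝ → ℂ} (h : HasWeakDerivOn V f g) (hUV : U ⊆ V) :
    HasWeakDerivOn U f g :=
  fun φ h1 h2 h3 => h φ h1 h2 (h3.trans hUV)

theorem locallyIntegrable_L2 (f : L2) : LocallyIntegrable f volume :=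
  (Lp.memLp f).locallyIntegrable (by norm_num)

namespace Chain

variable (P : Chain)

/-! ### Lifting of jumps and traces at the oscillators -/

theorem exists_gap : ∃ δ > 0, ∀ i j, i ≠ j → 2 * δ ≤ |P.s i - P.s j| := by
  obtain ⟨d, hd, h⟩ := P.spacing
  exact ⟨d / 2, by positivity, fun i j hij => by linarith [h i j hij]⟩

/-- Half of a lower bound for the distance of two oscillators. -/
def gap : ℝ := Classical.choose P.exists_gap

theorem gap_pos : 0 < P.gap := (Classical.choose_spec P.exists_gap).1

theorem two_mul_gap_le {i j : ℕ} (h : i ≠ j) : 2 * P.gap ≤ |P.s i - P.s j| :=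
  (Classical.choose_spec P.exists_gap).2 i j h

theorem s_injective : Function.Injective P.s := by
  intro i j h
  by_contra hne
  have := P.two_mul_gap_le hne
  rw [h, sub_self, abs_zero] at this
  linarith [P.gap_pos]

theorem finite_setOf_mem {k : Set ℝ} (hk : Bornology.IsBounded k) : {j | P.s j ∈ k}.Finite := by
  have : DiscreteTopology (range P.s) := by
    refine DiscreteTopology.of_forall_le_dist (r := 2 * P.gap) (by linarith [P.gap_pos]) ?_
    rintro ⟨_, i, rfl⟩ ⟨_, j, rfl⟩ hij
    refine P.two_mul_gap_le fun e => hij ?_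
    rw [e]
  have hfin := Metric.finite_isBounded_inter_isClosed ⟨this⟩ hk P.isClosed_range
  exact (hfin.preimage P.s_injective.injOn).subset fun j hj => ⟨hj, j, rfl⟩

theorem exists_lift : ∃ X : ell2 →L[ℂ] L2, ∀ σ : ell2,
    HasSum (fun j => σ j • saw P.gap (P.s j)) (X σ) :=
  exists_synthesis (B := ‖saw P.gap 0‖) (fun j => (norm_pieceLp _ _ _).le)
    (fun j => pieceLp_ne_zero _ P.gap_pos (by simp [ramp]) _)
    (fun i j hij => inner_pieceLp_pieceLp _ _ (P.two_mul_gap_le hij))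

theorem exists_liftDeriv : ∃ X : ell2 →L[ℂ] L2, ∀ σ : ell2,
    HasSum (fun j => σ j • sawDeriv P.gap (P.s j)) (X σ) :=
  exists_synthesis (B := ‖sawDeriv P.gap 0‖) (fun j => (norm_pieceLp _ _ _).le)
    (fun j => pieceLp_ne_zero _ P.gap_pos (by simp [rampDeriv, P.gap_pos.ne']) _)
    (fun i j hij => inner_pieceLp_pieceLp _ _ (P.two_mul_gap_le hij))

/-- A square-integrable function with prescribed jumps `σ`. -/
def lift : ell2 →L[ℂ] L2 := Classical.choose P.exists_lift

theorem hasSum_lift (σ : ell2) : HasSum (fun j => σ j • saw P.gap (P.s j)) (P.lift σ) :=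
  Classical.choose_spec P.exists_lift σ

/-- The derivative off `𝒮` of `lift σ`. -/
def liftDeriv : ell2 →L[ℂ] L2 := Classical.choose P.exists_liftDeriv

theorem hasSum_liftDeriv (σ : ell2) :
    HasSum (fun j => σ j • sawDeriv P.gap (P.s j)) (P.liftDeriv σ) :=
  Classical.choose_spec P.exists_liftDeriv σ

theorem lift_single (j : ℕ) : P.lift (basisVec j 1) = saw P.gap (P.s j) := by
  refine (P.hasSum_lift _).unique ?_
  convert hasSum_single j fun i hi => ?_ using 1
  · simp
  · rw [lp.single_apply_ne _ _ _ hi, zero_smul]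

theorem liftDeriv_single (j : ℕ) : P.liftDeriv (basisVec j 1) = sawDeriv P.gap (P.s j) := by
  refine (P.hasSum_liftDeriv _).unique ?_
  convert hasSum_single j fun i hi => ?_ using 1
  · simp
  · rw [lp.single_apply_ne _ _ _ hi, zero_smul]

/-- The values `(h(s_j))_j` of the function `h ∈ H¹(ℝ)` with derivative `h'`. -/
def trace (h h' : L2) : ell2 :=
  -(ContinuousLinearMap.adjoint P.lift h') - ContinuousLinearMap.adjoint P.liftDeriv h

/-- Defining the trace through adjoints makes the values square summable at once. Pairing with a
basis vector turns the adjoint back into a pairing with one sawtooth. -/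
theorem trace_apply (h h' : L2) (j : ℕ) : P.trace h h' j = pointValue P.gap h h' (P.s j) := by
  have e : ∀ y : ell2, y j = inner ℂ (basisVec j 1) y := fun y => by
    rw [lp.inner_single_left]
    simp
  rw [e, trace, inner_sub_right, inner_neg_right, ContinuousLinearMap.adjoint_inner_right,
    ContinuousLinearMap.adjoint_inner_right, lift_single, liftDeriv_single, pointValue]

theorem inner_lift (σ : ell2) (h h' : L2) :
    inner ℂ (P.lift σ) h' + inner ℂ (P.liftDeriv σ) h = -inner ℂ σ (P.trace h h') := by
  rw [trace, inner_sub_right, inner_neg_right, ContinuousLinearMap.adjoint_inner_right,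
    ContinuousLinearMap.adjoint_inner_right]
  ring

theorem hasTrace_trace {h h' : L2} (hh : HasWeakDerivOn univ h h') (j : ℕ) :
    HasTrace h (𝓝 (P.s j)) (P.trace h h' j) := by
  rw [trace_apply]
  exact hasTrace_pointValue P.gap_pos hh _

theorem eq_trace {h h' : L2} (hh : HasWeakDerivOn univ h h') {z : ell2}
    (hz : ∀ j, HasTrace h (𝓝 (P.s j)) (z j)) : z = P.trace h h' :=
  lp.ext (funext fun j => (hz j).unique (P.hasTrace_trace hh j))

theorem trace_testLp {φ : ℝ → ℝ} (h : IsTest φ) (j : ℕ) :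
    P.trace (testLp h) (testLp h.deriv) j = φ (P.s j) := by
  rw [trace_apply, pointValue, ← neg_add', inner_saw_testLp P.gap_pos, neg_neg]

/-- In distributions, `(lift σ)' = liftDeriv σ + ∑ σ_j δ_{s_j}`. -/
theorem inner_testLp_lift {φ : ℝ → ℝ} (h : IsTest φ) (σ : ell2) :
    inner ℂ (testLp h.deriv) (P.lift σ) =
      -inner ℂ (testLp h) (P.liftDeriv σ) - ∑' j, φ (P.s j) * σ j := by
  have e := congrArg (starRingEnd ℂ) (P.inner_lift σ (testLp h) (testLp h.deriv))
  rw [map_add, map_neg, inner_conj_symm, inner_conj_symm, inner_conj_symm, lp.inner_eq_tsum] at e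
  have : ∀ j, inner ℂ (P.trace (testLp h) (testLp h.deriv) j) (σ j) = φ (P.s j) * σ j := by
    intro j
    rw [trace_testLp, RCLike.inner_apply, Complex.conj_ofReal, mul_comm]
  simp only [this] at e
  linear_combination e

theorem hasWeakDerivOn_lift (σ : ell2) :
    HasWeakDerivOn P.punctured (P.lift σ) (P.liftDeriv σ) := by
  intro φ h1 h2 h3
  have h : IsTest φ := ⟨h1, h2⟩
  have h0 : ∀ j, φ (P.s j) = 0 := fun j => by
    by_contra hne
    exact h3 (subset_tsupport _ hne) ⟨j, rfl⟩
  rw [← inner_testLp h, ← inner_testLp h.deriv, P.inner_testLp_lift h]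
  simp [h0]

/-- The series defining `lift σ` converges only in `L²`. Restriction to a neighbourhood of `s_j` is
a continuous operator, and it annihilates every other sawtooth. -/
theorem lift_ae_eq (σ : ell2) (j : ℕ) : ∀ᵐ x, x ∈ Ioo (P.s j - P.gap) (P.s j + P.gap) →
    P.lift σ x = σ j * piece (ramp P.gap) P.gap (P.s j) x := by
  set N := Ioo (P.s j - P.gap) (P.s j + P.gap) with hN
  let R := LpToLpRestrictCLM ℝ ℂ ℂ volume 2 N
  have h1 : HasSum (fun i => σ i • R (saw P.gap (P.s i))) (R (P.lift σ)) := by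
    simpa only [map_smul] using (P.hasSum_lift σ).mapL R
  have h2 : ∀ i, i ≠ j → σ i • R (saw P.gap (P.s i)) = 0 := by
    intro i hi
    suffices h : R (saw P.gap (P.s i)) = 0 by rw [h, smul_zero]
    refine Lp.eq_zero_iff_ae_eq_zero.2 ?_
    filter_upwards [LpToLpRestrictCLM_coeFn ℂ N (saw P.gap (P.s i)),
      ae_restrict_of_ae (coeFn_pieceLp (continuous_ramp P.gap) P.gap (P.s i)),
      ae_restrict_mem measurableSet_Ioo] with x hx1 hx2 hx3
    rw [hx1, saw, hx2, piece_eq_zero, Pi.zero_apply]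
    have h4 := P.two_mul_gap_le hi
    have h5 : |x - P.s j| ≤ P.gap := abs_le.2 ⟨by linarith [hx3.1], by linarith [hx3.2]⟩
    have h6 := abs_sub_le (P.s i) x (P.s j)
    rw [abs_sub_comm (P.s i) x] at h6
    linarith
  have h3 := h1.unique (hasSum_single j h2)
  have h4 : ∀ᵐ x ∂(volume.restrict N),
      P.lift σ x = σ j * piece (ramp P.gap) P.gap (P.s j) x := by
    filter_upwards [LpToLpRestrictCLM_coeFn ℂ N (P.lift σ),
      LpToLpRestrictCLM_coeFn ℂ N (saw P.gap (P.s j)),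
      Lp.coeFn_smul (σ j) (R (saw P.gap (P.s j))),
      ae_restrict_of_ae (coeFn_pieceLp (continuous_ramp P.gap) P.gap (P.s j))]
      with x hx1 hx2 hx3 hx4
    rw [← hx1]
    change (R (P.lift σ)) x = _
    rw [h3, hx3, Pi.smul_apply, hx2, saw, hx4, smul_eq_mul]
  exact (ae_restrict_iff' measurableSet_Ioo).1 h4

theorem hasJump_lift (σ : ell2) (j : ℕ) : HasJump (P.lift σ) (P.s j) (σ j) := by
  have hg := P.gap_pos
  refine ⟨σ j, 0, ?_, ?_, sub_zero _⟩
  · have hc : Continuous fun x => σ j * ramp P.gap (x - P.s j) := by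
      have := continuous_ramp P.gap
      fun_prop
    have hlim : Tendsto (fun x => σ j * ramp P.gap (x - P.s j))
        (𝓝[>] P.s j ⊓ ae volume) (𝓝 (σ j)) := by
      have := (hc.tendsto (P.s j)).mono_left (inf_le_left.trans nhdsWithin_le_nhds :
        𝓝[>] P.s j ⊓ ae volume ≤ _)
      simpa [ramp] using this
    refine hlim.congr' ?_
    have h1 : ∀ᶠ x in 𝓝[>] P.s j ⊓ ae volume, x ∈ Ioo (P.s j) (P.s j + P.gap) :=
      Eventually.filter_mono inf_le_left (Ioo_mem_nhdsGT (by linarith))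
    filter_upwards [h1, (P.lift_ae_eq σ j).filter_mono inf_le_right] with x hx hx'
    rw [hx' ⟨by linarith [hx.1], hx.2⟩, piece,
      indicator_of_mem (show x ∈ Ico _ _ from ⟨hx.1.le, hx.2⟩)]
  · refine tendsto_const_nhds.congr' ?_
    have h1 : ∀ᶠ x in 𝓝[<] P.s j ⊓ ae volume, x ∈ Ioo (P.s j - P.gap) (P.s j) :=
      Eventually.filter_mono inf_le_left (Ioo_mem_nhdsLT (by linarith))
    filter_upwards [h1, (P.lift_ae_eq σ j).filter_mono inf_le_right] with x hx hx'
    rw [hx' ⟨hx.1, by linarith [hx.2]⟩, piece,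
      indicator_of_notMem (fun h => absurd h.1 (not_le.2 hx.2)), mul_zero]

/-! ### The structure of the pressure domain -/

/-- The support of one test function contains finitely many of the `s_j`, and each of them is
removable. -/
theorem hasWeakDerivOn_univ_of_jump_zero {f g : ℝ → ℂ} (hf : LocallyIntegrable f)
    (hg : LocallyIntegrable g) (hw : HasWeakDerivOn P.punctured f g)
    (hj : ∀ j, HasJump f (P.s j) 0) : HasWeakDerivOn univ f g := by
  intro φ h1 h2 _
  have hfin := P.finite_setOf_mem h2.isCompact.isBounded
  have h : HasWeakDerivOn (tsupport φ) f g := by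
    refine HasWeakDerivOn.of_diff_finset hf hg (hfin.toFinset.image P.s) (hw.mono ?_) ?_
    · rintro x ⟨hx, hxT⟩ ⟨j, rfl⟩
      refine hxT (Finset.mem_coe.2 (Finset.mem_image_of_mem _ ?_))
      exact hfin.mem_toFinset.2 hx
    · intro s hs
      obtain ⟨j, _, rfl⟩ := Finset.mem_image.1 hs
      exact hj j
  exact h φ h1 h2 subset_rfl

/-- Subtracting `lift σ` cancels all jumps. This reduces the pressure domain to `H¹(ℝ)` plus the
range of `lift`. -/
theorem hasWeakDerivOn_sub_lift {p g : L2} {σ : ell2} (hp : HasWeakDerivOn P.punctured p g)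
    (hσ : ∀ j, HasJump p (P.s j) (σ j)) :
    HasWeakDerivOn univ (p - P.lift σ : L2) (g - P.liftDeriv σ : L2) := by
  refine P.hasWeakDerivOn_univ_of_jump_zero (locallyIntegrable_L2 _) (locallyIntegrable_L2 _)
    (hp.sub (P.hasWeakDerivOn_lift σ)) fun j => ?_
  have := (hσ j).add ((P.hasJump_lift σ j).smul (-1))
  simpa only [neg_smul, one_smul, ← sub_eq_add_neg, sub_self] using this

theorem hasWeakDerivOn_add_lift {q q' : L2} (hq : HasWeakDerivOn univ q q') (σ : ell2) :
    HasWeakDerivOn P.punctured (q + P.lift σ : L2) (q' + P.liftDeriv σ : L2) :=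
  (hq.mono (subset_univ _)).add (P.hasWeakDerivOn_lift σ)

theorem hasJump_add_lift {q q' : L2} (hq : HasWeakDerivOn univ q q') (σ : ell2) (j : ℕ) :
    HasJump (q + P.lift σ : L2) (P.s j) (σ j) := by
  have := (P.hasTrace_trace hq j).hasJump_zero.add (P.hasJump_lift σ j)
  rwa [zero_add] at this

/-- Integration by parts for a function with jumps `σ`. -/
theorem inner_deriv_of_jumps {p g v v' : L2} {σ : ell2} (hp : HasWeakDerivOn P.punctured p g)
    (hσ : ∀ j, HasJump p (P.s j) (σ j)) (hv : HasWeakDerivOn univ v v') :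
    inner ℂ p v' + inner ℂ g v = -inner ℂ σ (P.trace v v') := by
  have h1 := inner_deriv_left (P.hasWeakDerivOn_sub_lift hp hσ) hv
  have h2 := P.inner_lift σ v v'
  rw [inner_sub_left, inner_sub_left] at h1
  linear_combination h1 + h2

/-! ### Weak derivatives as operators -/

end Chain

theorem hasWeakDerivOn_ddx (f : H1) : HasWeakDerivOn univ (f : L2) (ddx f) :=
  Classical.choose_spec f.2

theorem ddx_eq {f f' : L2} (h : HasWeakDerivOn univ f f') : ddx ⟨f, f', h⟩ = f' :=
  HasWeakDerivOn.unique isOpen_univ (by simp) (Classical.choose_spec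
    (⟨f', h⟩ : ∃ g : L2, HasWeakDerivOn univ f g)) h

theorem Chain.hasWeakDerivOn_ddxOff (P : Chain) (f : H1On P.punctured) :
    HasWeakDerivOn P.punctured (f : L2) (P.ddxOff f) :=
  Classical.choose_spec f.2

theorem Chain.ddxOff_eq (P : Chain) {f f' : L2} (h : HasWeakDerivOn P.punctured f f') :
    P.ddxOff ⟨f, f', h⟩ = f' :=
  HasWeakDerivOn.unique P.isOpen_punctured P.volume_punctured_compl (Classical.choose_spec
    (⟨f', h⟩ : ∃ g : L2, HasWeakDerivOn P.punctured f g)) h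

theorem Chain.jumps_eq (P : Chain) (p : P.pressureDomain) {σ : ell2}
    (h : ∀ j, HasJump (p : L2) (P.s j) (σ j)) : P.jumps p = σ :=
  lp.ext (funext fun j => (P.hasJump_jumps p j).unique (h j))

theorem diagMul_apply (c : ℕ → ℝ) (hc0 : ∀ j, 0 ≤ c j) (hc : BddAbove (range c)) (y : ell2)
    (j : ℕ) : diagMul c hc0 hc y j = c j * y j := rfl

theorem inner_diagCLM_ofReal {c : ℕ → ℝ} {B : ℝ} (hc : ∀ j, ‖(c j : ℂ)‖ ≤ B) (y z : ell2) :
    inner ℂ (diagCLM (fun j => (c j : ℂ)) hc y) z =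
      inner ℂ y (diagCLM (fun j => (c j : ℂ)) hc z) := by
  rw [lp.inner_eq_tsum, lp.inner_eq_tsum]
  refine tsum_congr fun j => ?_
  rw [diagCLM_apply, diagCLM_apply, RCLike.inner_apply, RCLike.inner_apply, map_mul,
    Complex.conj_ofReal]
  ring

namespace Chain

variable (P : Chain)

theorem a_ne_zero : (P.a : ℂ) ≠ 0 := Complex.ofReal_ne_zero.2 P.a_pos.ne'

theorem ρ_ne_zero : (P.ρ : ℂ) ≠ 0 := Complex.ofReal_ne_zero.2 P.ρ_pos.ne'

theorem S_ne_zero : (P.S : ℂ) ≠ 0 := Complex.ofReal_ne_zero.2 P.S_pos.ne'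

theorem K_ne_zero (j : ℕ) : (P.K j : ℂ) ≠ 0 := Complex.ofReal_ne_zero.2 (P.K_pos j).ne'

theorem M_ne_zero (j : ℕ) : (P.M j : ℂ) ≠ 0 := Complex.ofReal_ne_zero.2 (ne_of_gt (P.M_pos j))

/-! ### The energy scalar product -/

theorem norm_K_le (j : ℕ) : ‖(P.K j : ℂ)‖ ≤ Classical.choose P.K_bdd := by
  rw [Complex.norm_real, Real.norm_of_nonneg (P.K_pos j).le]
  exact Classical.choose_spec P.K_bdd ⟨j, rfl⟩

theorem norm_M_le (j : ℕ) : ‖(P.M j : ℂ)‖ ≤ Classical.choose P.M_bdd := by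
  rw [Complex.norm_real, Real.norm_of_nonneg (P.M_pos j).le]
  exact Classical.choose_spec P.M_bdd ⟨j, rfl⟩

/-- `y ↦ (K_j y_j)_j` on `ℓ²`. -/
def mulK : ell2 →L[ℂ] ell2 := diagCLM (fun j => (P.K j : ℂ)) P.norm_K_le

/-- `y ↦ (M_j y_j)_j` on `ℓ²`. -/
def mulM : ell2 →L[ℂ] ell2 := diagCLM (fun j => (P.M j : ℂ)) P.norm_M_le

theorem mulK_apply (y : ell2) (j : ℕ) : P.mulK y j = P.K j * y j := rfl

theorem mulM_apply (y : ell2) (j : ℕ) : P.mulM y j = P.M j * y j := rfl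

theorem mulKM_apply (y : ell2) (j : ℕ) : P.mulKM y j = P.K j / P.M j * y j := by
  rw [mulKM, diagMul_apply, Complex.ofReal_div]

theorem mulInvM_apply (y : ell2) (j : ℕ) : P.mulInvM y j = 1 / P.M j * y j := by
  rw [mulInvM, diagMul_apply, Complex.ofReal_div, Complex.ofReal_one]

theorem inner_mulK (y z : ell2) : inner ℂ (P.mulK y) z = inner ℂ y (P.mulK z) :=
  inner_diagCLM_ofReal P.norm_K_le y z

theorem inner_mulM (y z : ell2) : inner ℂ (P.mulM y) z = inner ℂ y (P.mulM z) :=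
  inner_diagCLM_ofReal P.norm_M_le y z

theorem mulM_mulKM (y : ell2) : P.mulM (P.mulKM y) = P.mulK y := by
  ext j
  have := P.M_ne_zero j
  rw [mulM_apply, mulKM_apply, mulK_apply]
  field_simp

theorem mulM_mulInvM (y : ell2) : P.mulM (P.mulInvM y) = y := by
  ext j
  have := P.M_ne_zero j
  rw [mulM_apply, mulInvM_apply]
  field_simp

/-- Since `K_j` and `M_j` are bounded, the series splits into two `ℓ²` products, and the weights can
be moved across by self-adjointness. -/
theorem energy_eq (p₁ v₁ p₂ v₂ : L2) (y₁ z₁ y₂ z₂ : ell2) :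
    P.energy (p₁, v₁, y₁, z₁) (p₂, v₂, y₂, z₂) =
      (1 / (P.a ^ 2 * P.ρ) : ℂ) * inner ℂ p₁ p₂ + (P.ρ : ℂ) * inner ℂ v₁ v₂ +
        (1 / P.S : ℂ) * (inner ℂ y₁ (P.mulK y₂) + inner ℂ z₁ (P.mulM z₂)) := by
  rw [lp.inner_eq_tsum, lp.inner_eq_tsum, ← (lp.summable_inner _ _).tsum_add
    (lp.summable_inner _ _), energy]
  congr 2
  refine tsum_congr fun j => ?_
  rw [mulK_apply, mulM_apply, RCLike.inner_apply, RCLike.inner_apply]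
  ring

/-! ### The graph of the coupled generator -/

/-- The value of `Â` in terms of the derivatives of `p` and `v` and of the jumps of `p`. -/
def hatValue (p' v' : L2) (y z σ : ell2) : State :=
  (-(P.a ^ 2 * P.ρ : ℂ) • v', -(1 / P.ρ : ℂ) • p', z,
    -(P.mulKM y + (P.S : ℂ) • P.mulInvM σ))

/-- With its converse `exists_hatA_eq`, this replaces the derivatives and jumps chosen inside `hatA`
by any that are exhibited explicitly. -/
theorem hatA_of {p p' v v' : L2} {σ : ell2} (y : ell2) {z : ell2}
    (hp : HasWeakDerivOn P.punctured p p') (hσ : ∀ j, HasJump p (P.s j) (σ j))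
    (hv : HasWeakDerivOn univ v v') (hz : z = P.trace v v') :
    ∃ h : ((p, v, y, z) : State) ∈ P.hatA.domain,
      P.hatA ⟨(p, v, y, z), h⟩ = P.hatValue p' v' y z σ := by
  have hpd : p ∈ P.pressureDomain := ⟨⟨p', hp⟩, σ, hσ⟩
  refine ⟨⟨hpd, ⟨v', hv⟩, fun j => by rw [hz]; exact P.hasTrace_trace hv j⟩, ?_⟩
  have e1 : ddx ⟨v, v', hv⟩ = v' := ddx_eq hv
  have e2 : P.ddxOff ⟨p, p', hp⟩ = p' := P.ddxOff_eq hp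
  have e3 : P.jumps ⟨p, hpd⟩ = σ := P.jumps_eq _ hσ
  refine Prod.ext ?_ (Prod.ext ?_ (Prod.ext rfl ?_))
  · exact congrArg (fun w : L2 => -(P.a ^ 2 * P.ρ : ℂ) • w) e1
  · exact congrArg (fun w : L2 => -(1 / P.ρ : ℂ) • w) e2
  · exact congrArg (fun σ => -(P.mulKM y + (P.S : ℂ) • P.mulInvM σ)) e3

theorem exists_hatA_eq (X : P.hatA.domain) : ∃ (p' v' : L2) (σ : ell2),
    HasWeakDerivOn P.punctured X.1.1 p' ∧ (∀ j, HasJump X.1.1 (P.s j) (σ j)) ∧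
      HasWeakDerivOn univ X.1.2.1 v' ∧ X.1.2.2.2 = P.trace X.1.2.1 v' ∧
        P.hatA X = P.hatValue p' v' X.1.2.2.1 X.1.2.2.2 σ := by
  have h := X.2
  obtain ⟨h1, h2, h3⟩ : X.1.1 ∈ P.pressureDomain ∧ X.1.2.1 ∈ H1 ∧
    ∀ j, HasTrace X.1.2.1 (𝓝 (P.s j)) (X.1.2.2.2 j) := h
  exact ⟨P.ddxOff ⟨X.1.1, h1.1⟩, ddx ⟨X.1.2.1, h2⟩, P.jumps ⟨X.1.1, h1⟩,
    P.hasWeakDerivOn_ddxOff ⟨X.1.1, h1.1⟩, P.hasJump_jumps ⟨X.1.1, h1⟩,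
    hasWeakDerivOn_ddx ⟨X.1.2.1, h2⟩, P.eq_trace (hasWeakDerivOn_ddx ⟨X.1.2.1, h2⟩) h3, rfl⟩

/-! ### Skew-adjointness -/

/-- Integration by parts leaves the boundary terms `⟨σ, z₂⟩` and `⟨z, σ₂⟩`. The weight `M_j / S`
turns the forces `S σ_j / M_j` into exactly these. -/
theorem energy_hatValue {p p' v v' p₂ p₂' v₂ v₂' : L2} {σ y z σ₂ y₂ z₂ : ell2}
    (hp : HasWeakDerivOn P.punctured p p') (hσ : ∀ j, HasJump p (P.s j) (σ j))
    (hv : HasWeakDerivOn univ v v') (hz : z = P.trace v v')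
    (hp₂ : HasWeakDerivOn P.punctured p₂ p₂') (hσ₂ : ∀ j, HasJump p₂ (P.s j) (σ₂ j))
    (hv₂ : HasWeakDerivOn univ v₂ v₂') (hz₂ : z₂ = P.trace v₂ v₂') :
    P.energy (p, v, y, z) (P.hatValue p₂' v₂' y₂ z₂ σ₂) =
      P.energy (-P.hatValue p' v' y z σ) (p₂, v₂, y₂, z₂) := by
  have h1 := P.inner_deriv_of_jumps hp hσ hv₂
  have h2 := congrArg (starRingEnd ℂ) (P.inner_deriv_of_jumps hp₂ hσ₂ hv)
  rw [← hz₂] at h1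
  rw [← hz, map_add, map_neg, inner_conj_symm, inner_conj_symm, inner_conj_symm] at h2
  have ha := P.a_ne_zero
  have hρ := P.ρ_ne_zero
  have hS := P.S_ne_zero
  have e1 : inner ℂ (P.mulKM y) (P.mulM z₂) = inner ℂ y (P.mulK z₂) := by
    rw [← inner_mulM, mulM_mulKM, inner_mulK]
  have e2 : inner ℂ (P.mulInvM σ) (P.mulM z₂) = inner ℂ σ z₂ := by
    rw [← inner_mulM, mulM_mulInvM]
  simp only [hatValue, Prod.neg_mk, energy_eq, map_neg, map_add, map_smul, mulM_mulKM,
    mulM_mulInvM, inner_neg_left, inner_neg_right, inner_add_left, inner_add_right,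
    inner_smul_left, inner_smul_right, neg_smul, neg_neg, map_mul, map_pow, map_div₀, map_one,
    Complex.conj_ofReal, e1, e2]
  field_simp
  linear_combination (-(P.S : ℂ)) * h1 + (-(P.S : ℂ)) * h2

theorem trace_zero : P.trace 0 0 = 0 := by simp [trace]

/-- The energy pairing with the range of `Â`, spelled out. -/
theorem energy_adjoint_identity {p v f g : L2} {y z h k : ell2}
    (H : ∀ X : P.hatA.domain, P.energy (p, v, y, z) (P.hatA X) = P.energy (f, g, h, k) X)
    {q q' u u' : L2} (hq : HasWeakDerivOn univ q q') (hu : HasWeakDerivOn univ u u')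
    (σ w : ell2) :
    -inner ℂ p u' - inner ℂ v (q' + P.liftDeriv σ) +
        (1 / P.S : ℂ) * (inner ℂ y (P.mulK (P.trace u u')) - inner ℂ z (P.mulK w)) -
          inner ℂ z σ =
      (1 / (P.a ^ 2 * P.ρ) : ℂ) * inner ℂ f (q + P.lift σ) + (P.ρ : ℂ) * inner ℂ g u +
        (1 / P.S : ℂ) * (inner ℂ h (P.mulK w) + inner ℂ k (P.mulM (P.trace u u'))) := by
  -- The test vector is `(q + lift σ, u, w, (u(s_j))_j)`, in which `q`, `u`, `σ`, `w` vary
  -- independently.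
  obtain ⟨hX, e⟩ := P.hatA_of w (P.hasWeakDerivOn_add_lift hq σ) (P.hasJump_add_lift hq σ) hu rfl
  have h0 := H ⟨_, hX⟩
  rw [e, hatValue, energy_eq, energy_eq] at h0
  have ha := P.a_ne_zero
  have hρ := P.ρ_ne_zero
  have hS := P.S_ne_zero
  rw [← h0]
  simp only [map_neg, map_add, map_smul, mulM_mulKM, mulM_mulInvM, inner_neg_right,
    inner_add_right, inner_smul_right, neg_smul]
  field_simp
  ring

theorem mulK_injective : Function.Injective P.mulK := by
  intro y z h
  ext j
  have := congrArg (fun w : ell2 => w j) h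
  simp only [mulK_apply] at this
  exact mul_left_cancel₀ (P.K_ne_zero j) this

/-- Each free parameter of `energy_adjoint_identity` yields one condition: `w` gives `z = -h`, `q`
gives the derivative of `v`, `σ` gives `z_j = v(s_j)`, and `u` gives the derivative and the jumps of
`p`. -/
theorem adjoint_hatA {p v f g : L2} {y z h k : ell2}
    (H : ∀ X : P.hatA.domain, P.energy (p, v, y, z) (P.hatA X) = P.energy (f, g, h, k) X) :
    ∃ hD : ((p, v, y, z) : State) ∈ P.hatA.domain, (f, g, h, k) = -P.hatA ⟨_, hD⟩ := by
  have ha := P.a_ne_zero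
  have hρ := P.ρ_ne_zero
  have hS := P.S_ne_zero
  have key := @energy_adjoint_identity P _ _ _ _ _ _ _ _ H
  have hz : z = -h := by
    refine P.mulK_injective (ext_inner_right ℂ fun w => ?_)
    have := key HasWeakDerivOn.zero HasWeakDerivOn.zero 0 w
    simp only [trace_zero, map_zero, inner_zero_right, add_zero, zero_sub, sub_zero, neg_zero,
      mul_zero, zero_add] at this
    rw [inner_mulK, map_neg, inner_neg_left, inner_mulK]
    field_simp at this
    linear_combination -this
  have hv : HasWeakDerivOn univ v ((1 / (P.a ^ 2 * P.ρ) : ℂ) • f : L2) := by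
    refine hasWeakDerivOn_of_inner fun q q' hq => ?_
    have := key hq HasWeakDerivOn.zero 0 0
    simp only [trace_zero, map_zero, inner_zero_right, add_zero, zero_sub, sub_zero, neg_zero,
      mul_zero] at this
    rw [inner_smul_left]
    simp only [map_div₀, map_one, map_mul, map_pow, Complex.conj_ofReal]
    linear_combination -this
  have hzt : z = P.trace v ((1 / (P.a ^ 2 * P.ρ) : ℂ) • f : L2) := by
    refine ext_inner_right ℂ fun σ => ?_
    have h1 := key HasWeakDerivOn.zero HasWeakDerivOn.zero σ 0
    simp only [trace_zero, map_zero, inner_zero_right, add_zero, zero_sub, sub_zero, neg_zero,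
      mul_zero, zero_add] at h1
    have h2 := congrArg (starRingEnd ℂ)
      (P.inner_lift σ v ((1 / (P.a ^ 2 * P.ρ) : ℂ) • f : L2))
    rw [map_add, map_neg, inner_conj_symm, inner_conj_symm, inner_conj_symm, inner_smul_left] at h2
    simp only [map_div₀, map_one, map_mul, map_pow, Complex.conj_ofReal] at h2
    linear_combination -h1 - h2
  -- The jumps are read off from the fourth component of `Φ = -Â Ψ`, namely `M_j k_j = K_j y_j + S
  -- σ_j`.
  set σ : ell2 := (1 / P.S : ℂ) • (P.mulM k - P.mulK y) with hσ
  have hp : HasWeakDerivOn univ (p - P.lift σ : L2) ((P.ρ : ℂ) • g - P.liftDeriv σ : L2) := by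
    refine hasWeakDerivOn_of_inner fun u u' hu => ?_
    have h1 := key HasWeakDerivOn.zero hu 0 0
    simp only [map_zero, inner_zero_right, add_zero, sub_zero, mul_zero, zero_add] at h1
    have h2 := P.inner_lift σ u u'
    have h3 : inner ℂ σ (P.trace u u') = (1 / P.S : ℂ) * (inner ℂ k (P.mulM (P.trace u u')) -
        inner ℂ y (P.mulK (P.trace u u'))) := by
      rw [hσ, inner_smul_left, inner_sub_left, inner_mulM, inner_mulK]
      simp only [map_div₀, map_one, Complex.conj_ofReal]
    rw [inner_sub_left, inner_sub_left, inner_smul_left, Complex.conj_ofReal]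
    linear_combination -h1 - h2 + h3
  have hp' := P.hasWeakDerivOn_add_lift hp σ
  have hj := P.hasJump_add_lift hp σ
  rw [sub_add_cancel] at hp' hj
  rw [sub_add_cancel] at hp'
  obtain ⟨hD, e⟩ := P.hatA_of y hp' hj hv hzt
  refine ⟨hD, ?_⟩
  rw [e, hatValue, Prod.neg_mk, Prod.neg_mk, Prod.neg_mk]
  refine Prod.ext ?_ (Prod.ext ?_ (Prod.ext ?_ ?_))
  · change f = -(-(P.a ^ 2 * P.ρ : ℂ) • ((1 / (P.a ^ 2 * P.ρ) : ℂ) • f))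
    rw [neg_smul, neg_neg, smul_smul, mul_one_div_cancel (mul_ne_zero (pow_ne_zero 2 ha) hρ), one_smul]
  · change g = -(-(1 / P.ρ : ℂ) • ((P.ρ : ℂ) • g))
    rw [neg_smul, neg_neg, smul_smul, one_div_mul_cancel hρ, one_smul]
  · simp only [hz, neg_neg]
  · simp only [neg_neg]
    ext j
    have hM := P.M_ne_zero j
    simp only [hσ, lp.coeFn_add, lp.coeFn_smul, lp.coeFn_sub, Pi.add_apply, Pi.smul_apply,
      Pi.sub_apply, mulKM_apply, map_smul, map_sub, mulInvM_apply, mulM_apply, mulK_apply,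
      smul_eq_mul]
    field_simp
    ring

end Chain

/-- A subspace on which no nonzero continuous functional vanishes is dense. -/
theorem dense_of_forall_dual_eq_zero {E : Type*} [NormedAddCommGroup E] [NormedSpace ℂ E]
    (D : Submodule ℂ E) (H : ∀ ℓ : StrongDual ℂ E, (∀ x ∈ D, ℓ x = 0) → ℓ = 0) :
    Dense (D : Set E) := by
  rw [Submodule.dense_iff_topologicalClosure_eq_top, Submodule.eq_top_iff']
  intro x
  have : IsClosed (D.topologicalClosure : Set E) := D.isClosed_topologicalClosure
  rw [← Submodule.Quotient.mk_eq_zero]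
  -- A functional on the quotient by the closure pulls back to one vanishing on `D`.
  refine SeparatingDual.eq_zero_of_forall_dual_eq_zero (R := ℂ) fun ℓ => ?_
  have h0 := H (ℓ.comp D.topologicalClosure.mkQL) fun y hy => by
    have : D.topologicalClosure.mkQL y = 0 :=
      (Submodule.Quotient.mk_eq_zero _).2 (D.le_topologicalClosure hy)
    rw [ContinuousLinearMap.comp_apply, this, map_zero]
  exact DFunLike.congr_fun h0 x

namespace Chain

variable (P : Chain)

theorem energy_zero_left (Ψ : State) : P.energy 0 Ψ = 0 := by
  obtain ⟨p, v, y, z⟩ := Ψ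
  change P.energy (0, 0, 0, 0) _ = 0
  simp [energy_eq]

/-- A functional vanishing on the domain, rewritten as an energy product with some `Φ`, says that
`(0, Φ)` is in the graph of the adjoint. Then `Φ = -Â 0 = 0` by `adjoint_hatA`. -/
theorem dense_hatDomain : Dense (P.hatA.domain : Set State) := by
  refine dense_of_forall_dual_eq_zero _ fun ℓ hℓ => ?_
  let ℓ₁ : StrongDual ℂ L2 := ℓ.comp (ContinuousLinearMap.inl ℂ _ _)
  let i₂ : (L2 × ell2 × ell2) →L[ℂ] State := ContinuousLinearMap.inr ℂ _ _
  let ℓ₂ : StrongDual ℂ L2 := ℓ.comp (i₂.comp (ContinuousLinearMap.inl ℂ _ _))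
  let i₃ : (ell2 × ell2) →L[ℂ] State := i₂.comp (ContinuousLinearMap.inr ℂ _ _)
  let ℓ₃ : StrongDual ℂ ell2 := ℓ.comp (i₃.comp (ContinuousLinearMap.inl ℂ _ _))
  let ℓ₄ : StrongDual ℂ ell2 := ℓ.comp (i₃.comp (ContinuousLinearMap.inr ℂ _ _))
  have hsum : ∀ p v y z, ℓ (p, v, y, z) = ℓ₁ p + ℓ₂ v + ℓ₃ y + ℓ₄ z := by
    intro p v y z
    change _ = ℓ (p, 0, 0, 0) + ℓ (0, v, 0, 0) + ℓ (0, 0, y, 0) + ℓ (0, 0, 0, z)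
    rw [← map_add, ← map_add, ← map_add]
    simp
  -- The component `y` is unconstrained in the domain, so its functional is treated directly.
  -- Representing it by the energy product would require dividing by `K_j`, which may tend to zero.
  have h₃ : ∀ y, ℓ₃ y = 0 := by
    intro y
    obtain ⟨hX, -⟩ := P.hatA_of (p := 0) (p' := 0) (v := 0) (v' := 0) (σ := 0) y (z := 0)
      HasWeakDerivOn.zero (fun _ => HasJump.zero) HasWeakDerivOn.zero P.trace_zero.symm
    have := hℓ _ hX
    rwa [hsum, map_zero, map_zero, map_zero, zero_add, zero_add, add_zero] at this
  obtain ⟨f, hf⟩ := (InnerProductSpace.toDual ℂ L2).surjective ℓ₁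
  obtain ⟨g, hg⟩ := (InnerProductSpace.toDual ℂ L2).surjective ℓ₂
  obtain ⟨k, hk⟩ := (InnerProductSpace.toDual ℂ ell2).surjective ℓ₄
  have hf' : ∀ p, ℓ₁ p = inner ℂ f p := fun p => by
    rw [← hf, InnerProductSpace.toDual_apply_apply]
  have hg' : ∀ p, ℓ₂ p = inner ℂ g p := fun p => by
    rw [← hg, InnerProductSpace.toDual_apply_apply]
  have hk' : ∀ p, ℓ₄ p = inner ℂ k p := fun p => by
    rw [← hk, InnerProductSpace.toDual_apply_apply]
  have ha := P.a_ne_zero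
  have hρ := P.ρ_ne_zero
  have hS := P.S_ne_zero
  -- The factors compensate the weights of the energy product; the third component is zero because
  -- `ℓ₃ = 0`.
  have main := P.adjoint_hatA (p := 0) (v := 0) (y := 0) (z := 0)
    (f := (P.a ^ 2 * P.ρ : ℂ) • f) (g := (1 / P.ρ : ℂ) • g) (h := 0)
    (k := (P.S : ℂ) • P.mulInvM k) fun X => by
      obtain ⟨⟨p, v, y, z⟩, hX⟩ := X
      have h0 := hℓ _ hX
      rw [hsum, h₃, hf', hg', hk'] at h0
      refine (P.energy_zero_left _).trans ?_
      rw [energy_eq, inner_smul_left, inner_smul_left, inner_smul_left, inner_zero_left,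
        ← inner_mulM, mulM_mulInvM]
      simp only [map_mul, map_pow, map_div₀, map_one, Complex.conj_ofReal]
      field_simp
      linear_combination -(P.S : ℂ) * h0
  obtain ⟨hD, e⟩ := main
  have e0 : P.hatA ⟨((0, 0, 0, 0) : State), hD⟩ = 0 := P.hatA.map_zero
  rw [e0, neg_zero] at e
  have e1 : (P.a ^ 2 * P.ρ : ℂ) • f = 0 := congrArg Prod.fst e
  have e2 : (1 / P.ρ : ℂ) • g = 0 := congrArg (fun Ψ : State => Ψ.2.1) e
  have e4 : (P.S : ℂ) • P.mulInvM k = 0 := congrArg (fun Ψ : State => Ψ.2.2.2) e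
  have f0 : f = 0 := (smul_eq_zero.1 e1).resolve_left (mul_ne_zero (pow_ne_zero 2 ha) hρ)
  have g0 : g = 0 := (smul_eq_zero.1 e2).resolve_left (one_div_ne_zero hρ)
  have k0 : k = 0 := by
    rw [← P.mulM_mulInvM k, (smul_eq_zero.1 e4).resolve_left hS, map_zero]
  refine ContinuousLinearMap.ext fun Ψ => ?_
  obtain ⟨p, v, y, z⟩ := Ψ
  rw [hsum, h₃, hf', hg', hk', f0, g0, k0]
  simp

theorem isSkewAdjoint_hatA : IsSkewAdjoint P.energy P.hatA := by
  refine ⟨P.dense_hatDomain, fun Ψ Φ => ⟨fun H => ?_, ?_⟩⟩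
  · obtain ⟨p, v, y, z⟩ := Ψ
    obtain ⟨f, g, h, k⟩ := Φ
    exact P.adjoint_hatA H
  · rintro ⟨h, rfl⟩ ⟨X, hX⟩
    obtain ⟨p', v', σ, h1, h2, h3, h4, e⟩ := P.exists_hatA_eq ⟨Ψ, h⟩
    obtain ⟨p₂', v₂', σ₂, k1, k2, k3, k4, e₂⟩ := P.exists_hatA_eq ⟨X, hX⟩
    rw [e, e₂]
    exact P.energy_hatValue h1 h2 h3 h4 k1 k2 k3 k4

end Chain

/-! ### Reality -/

theorem HasWeakDerivOn.star {U : Set ℝ} {f g : L2} (h : HasWeakDerivOn U f g) :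
    HasWeakDerivOn U (star f : L2) (star g : L2) := by
  intro φ h1 h2 h3
  have key : ∀ (ψ : ℝ → ℝ) (k : L2), ∫ x, ψ x • (Star.star k : L2) x = conj (∫ x, ψ x • k x) := by
    intro ψ k
    rw [← integral_conj]
    refine integral_congr_ae ?_
    filter_upwards [Lp.coeFn_star k] with x hx
    rw [hx, Pi.star_apply, Complex.real_smul, Complex.real_smul, map_mul, Complex.conj_ofReal]
    rfl
  rw [key, key, h φ h1 h2 h3, map_neg]

theorem HasTrace.star {f : L2} {l : Filter ℝ} {c : ℂ} (h : HasTrace f l c) :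
    HasTrace (star f : L2) l (star c) :=
  HasTrace.congr_ae (f := fun x => Star.star (f x)) (Tendsto.star h) (Lp.coeFn_star f).symm

theorem HasJump.star {f : L2} {x : ℝ} {c : ℂ} (h : HasJump f x c) :
    HasJump (star f : L2) x (star c) := by
  obtain ⟨r, l, hr, hl, rfl⟩ := h
  exact ⟨_, _, hr.star, hl.star, (star_sub _ _).symm⟩

theorem star_ofReal_smul (c : ℝ) (f : L2) : star ((c : ℂ) • f) = (c : ℂ) • star f := by
  refine Lp.ext ?_
  filter_upwards [Lp.coeFn_star ((c : ℂ) • f), Lp.coeFn_smul (c : ℂ) f, Lp.coeFn_star f,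
    Lp.coeFn_smul (c : ℂ) (star f)] with x h1 h2 h3 h4
  rw [h1, h4, Pi.star_apply, h2, Pi.smul_apply, Pi.smul_apply, h3, Pi.star_apply, star_smul]
  simp

/-- Test functions and coefficients are real, so conjugation commutes with weak derivatives, jumps
and traces. -/
theorem Chain.isRealOperator_hatA (P : Chain) : IsRealOperator P.hatA := by
  intro Ψ
  obtain ⟨p', v', σ, h1, h2, h3, h4, e⟩ := P.exists_hatA_eq Ψ
  obtain ⟨⟨p, v, y, z⟩, hΨ⟩ := Ψ
  have hz : star z = P.trace (star v) (star v') := by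
    refine P.eq_trace h3.star fun j => ?_
    have h4' : z j = P.trace v v' j := congrArg (fun w : ell2 => w j) h4
    change HasTrace (star v : L2) _ (star (z j))
    rw [h4']
    exact (P.hasTrace_trace h3 j).star
  obtain ⟨hD, e'⟩ := P.hatA_of (star y) h1.star (σ := star σ) (fun j => (h2 j).star) h3.star hz
  refine ⟨hD, ?_⟩
  rw [e]
  refine e'.trans (Prod.ext ?_ (Prod.ext ?_ (Prod.ext rfl ?_)))
  · have := star_ofReal_smul (-(P.a ^ 2 * P.ρ)) v'
    push_cast at this
    exact this.symm
  · have := star_ofReal_smul (-(1 / P.ρ)) p'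
    push_cast at this
    exact this.symm
  · ext j
    change -(P.mulKM (star y) j + (P.S : ℂ) * P.mulInvM (star σ) j) =
      star (-(P.mulKM y j + (P.S : ℂ) * P.mulInvM σ j))
    rw [P.mulKM_apply, P.mulKM_apply, P.mulInvM_apply, P.mulInvM_apply]
    simp

/-! ### The regular part of the pressure -/

theorem measurable_sign : Measurable Real.sign := by
  unfold Real.sign
  exact Measurable.ite measurableSet_Iio measurable_const
    (Measurable.ite measurableSet_Ioi measurable_const measurable_const)

theorem norm_sign_le (x : ℝ) : ‖(Real.sign x : ℂ)‖ ≤ 1 := by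
  rw [Complex.norm_real]
  rcases Real.sign_apply_eq x with h | h | h <;> rw [h] <;> norm_num

/-- The distributional derivative of `sgn(· - s)` is `2 δ_s`, hence the factor `1 / 2` in the
regular part. -/
theorem integral_deriv_mul_sign {φ : ℝ → ℝ} (h : IsTest φ) (s : ℝ) :
    ∫ x, deriv φ x * Real.sign (x - s) = -2 * φ s := by
  have hi : Integrable fun x => deriv φ x * Real.sign (x - s) := by
    refine h.deriv.integrable.mul_bdd (c := 1)
      (measurable_sign.comp (measurable_id.sub_const s)).aestronglyMeasurable
      (Eventually.of_forall fun x => ?_)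
    simpa only [Complex.norm_real] using norm_sign_le (x - s)
  rw [← integral_add_compl (measurableSet_Iic (a := s)) hi, compl_Iic,
    integral_Iic_eq_integral_Iio]
  have e1 : ∫ x in Iio s, deriv φ x * Real.sign (x - s) = -∫ x in Iio s, deriv φ x := by
    rw [← integral_neg]
    refine setIntegral_congr_fun measurableSet_Iio fun x hx => ?_
    simp only [Real.sign_of_neg (sub_neg.2 hx), mul_neg, mul_one]
  have e2 : ∫ x in Ioi s, deriv φ x * Real.sign (x - s) = ∫ x in Ioi s, deriv φ x := by
    refine setIntegral_congr_fun measurableSet_Ioi fun x hx => ?_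
    simp only [Real.sign_of_pos (sub_pos.2 hx), mul_one]
  rw [e1, e2, ← integral_Iic_eq_integral_Iio,
    h.2.integral_Iic_deriv_eq (h.1.of_le (by simp)) s,
    h.2.integral_Ioi_deriv_eq (h.1.of_le (by simp)) s]
  ring

theorem integral_deriv_eq_zero {φ : ℝ → ℝ} (h : IsTest φ) : ∫ x, deriv φ x = 0 :=
  integral_eq_zero_of_hasDerivAt_of_integrable (fun x => h.hasDerivAt x) h.deriv.integrable
    h.integrable

theorem integrable_test_smul {φ : ℝ → ℝ} (hφ : IsTest φ) {f : ℝ → ℂ}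
    (hf : LocallyIntegrable f) : Integrable fun x => φ x • f x :=
  hf.integrable_smul_left_of_hasCompactSupport hφ.continuous hφ.2

theorem locallyIntegrable_of_memLp_two {f : ℝ → ℂ}
    (hf : ∀ k : Set ℝ, IsCompact k → MemLp f 2 (volume.restrict k)) : LocallyIntegrable f := by
  rw [locallyIntegrable_iff]
  intro k hk
  have : IsFiniteMeasure (volume.restrict k) := ⟨by simpa using hk.measure_lt_top⟩
  exact (hf k hk).integrable (by norm_num)

namespace Chain

variable (P : Chain)

/-- The step function with jumps `σ_j` at `s_j`, normalised to vanish at `0`. -/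
def step (σ : ℕ → ℂ) (x : ℝ) : ℂ :=
  (1 / 2 : ℂ) * ∑' j, σ j * ((Real.sign (x - P.s j) : ℂ) - (Real.sign (0 - P.s j) : ℂ))

/-- The contribution to `step` of finitely many jumps. -/
def stepOn (T : Finset ℕ) (σ : ℕ → ℂ) (x : ℝ) : ℂ :=
  (1 / 2 : ℂ) * ∑ j ∈ T, σ j * ((Real.sign (x - P.s j) : ℂ) - (Real.sign (0 - P.s j) : ℂ))

/-- For `|x| ≤ R < |s_j|` the signs of `x - s_j` and `-s_j` agree, so on a bounded set the same
finite sum represents the series. -/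
theorem exists_step_eq {k : Set ℝ} (hk : Bornology.IsBounded k) :
    ∃ T : Finset ℕ, (∀ j, P.s j ∈ k → j ∈ T) ∧ ∀ σ, ∀ x ∈ k, P.step σ x = P.stepOn T σ x := by
  obtain ⟨R, hR⟩ := hk.subset_closedBall 0
  have hfin := P.finite_setOf_mem (Metric.isBounded_closedBall (x := (0 : ℝ)) (r := R))
  refine ⟨hfin.toFinset, fun j hj => hfin.mem_toFinset.2 (hR hj), fun σ x hx => ?_⟩
  unfold step stepOn
  congr 1
  refine tsum_eq_sum fun j hj => ?_
  have hj' : R < |P.s j| := by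
    by_contra hle
    refine hj (hfin.mem_toFinset.2 ?_)
    rw [mem_ofPred_eq, Metric.mem_closedBall, Real.dist_eq, sub_zero]
    exact not_lt.1 hle
  have hx' : |x| ≤ R := by simpa [Real.dist_eq] using hR hx
  have hx2 := abs_le.1 hx'
  have : Real.sign (x - P.s j) = Real.sign (0 - P.s j) := by
    rcases lt_abs.1 hj' with h | h
    · rw [Real.sign_of_neg (by linarith), Real.sign_of_neg (by linarith)]
    · rw [Real.sign_of_pos (by linarith), Real.sign_of_pos (by linarith)]
  rw [this, sub_self, mul_zero]

theorem memLp_stepOn (T : Finset ℕ) (σ : ℕ → ℂ) {k : Set ℝ} (hk : IsCompact k) :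
    MemLp (P.stepOn T σ) 2 (volume.restrict k) := by
  have : IsFiniteMeasure (volume.restrict k) := ⟨by simpa using hk.measure_lt_top⟩
  have hj : ∀ j ∈ T, MemLp (fun x : ℝ => σ j * ((Real.sign (x - P.s j) : ℂ) -
      (Real.sign (0 - P.s j) : ℂ))) 2 (volume.restrict k) := by
    intro j _
    have hb : MemLp (fun x : ℝ => (Real.sign (x - P.s j) : ℂ) - (Real.sign (0 - P.s j) : ℂ)) 2
        (volume.restrict k) := by
      refine MemLp.of_bound (C := 2) ?_ (Eventually.of_forall fun x => ?_)
      · have := measurable_sign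
        exact Measurable.aestronglyMeasurable (by fun_prop)
      · refine (norm_sub_le _ _).trans ?_
        linarith [norm_sign_le (x - P.s j), norm_sign_le (0 - P.s j)]
    exact hb.const_mul (σ j)
  exact (memLp_finsetSum T hj).const_mul (1 / 2 : ℂ)

theorem memLp_step (σ : ℕ → ℂ) {k : Set ℝ} (hk : IsCompact k) :
    MemLp (P.step σ) 2 (volume.restrict k) := by
  obtain ⟨T, -, hT⟩ := P.exists_step_eq hk.isBounded
  refine (P.memLp_stepOn T σ hk).ae_eq ?_
  rw [Filter.EventuallyEq, ae_restrict_iff' hk.measurableSet]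
  exact Eventually.of_forall fun x hx => (hT σ x hx).symm

theorem integral_deriv_smul_step {φ : ℝ → ℝ} (h : IsTest φ) (σ : ℕ → ℂ) :
    ∫ x, deriv φ x • P.step σ x = -∑' j, φ (P.s j) * σ j := by
  obtain ⟨T, hT1, hT2⟩ := P.exists_step_eq h.2.isCompact.isBounded
  have e1 : ∀ x, deriv φ x • P.step σ x = ∑ j ∈ T,
      (((deriv φ x * Real.sign (x - P.s j) : ℝ) : ℂ) -
        ((deriv φ x * Real.sign (0 - P.s j) : ℝ) : ℂ)) * ((1 / 2 : ℂ) * σ j) := by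
    intro x
    by_cases hx : x ∈ tsupport φ
    · rw [hT2 σ x hx, stepOn, Complex.real_smul, Finset.mul_sum, Finset.mul_sum]
      refine Finset.sum_congr rfl fun j _ => ?_
      push_cast
      ring
    · have : deriv φ x = 0 := by
        by_contra hne
        exact hx (support_deriv_subset hne)
      simp [this]
  have hi1 : ∀ j, Integrable fun x => ((deriv φ x * Real.sign (x - P.s j) : ℝ) : ℂ) := by
    intro j
    refine Integrable.ofReal (h.deriv.integrable.mul_bdd (c := 1)
      (measurable_sign.comp (measurable_id.sub_const _)).aestronglyMeasurable
      (Eventually.of_forall fun x => ?_))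
    simpa only [Complex.norm_real] using norm_sign_le (x - P.s j)
  have hi2 : ∀ j, Integrable fun x => ((deriv φ x * Real.sign (0 - P.s j) : ℝ) : ℂ) := fun j =>
    (h.deriv.integrable.mul_const _).ofReal
  have hi3 : ∀ j ∈ T, Integrable fun x => (((deriv φ x * Real.sign (x - P.s j) : ℝ) : ℂ) -
      ((deriv φ x * Real.sign (0 - P.s j) : ℝ) : ℂ)) * ((1 / 2 : ℂ) * σ j) := fun j _ =>
    ((hi1 j).sub (hi2 j)).mul_const _
  simp only [e1]
  rw [integral_finsetSum _ hi3, tsum_eq_sum (s := T) fun j hj => ?_, ← Finset.sum_neg_distrib]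
  · refine Finset.sum_congr rfl fun j _ => ?_
    rw [integral_mul_const, integral_sub (hi1 j) (hi2 j), integral_complex_ofReal,
      integral_complex_ofReal, integral_deriv_mul_sign h, integral_mul_const,
      integral_deriv_eq_zero h]
    push_cast
    ring
  · have : φ (P.s j) = 0 := by
      by_contra hne
      exact hj (hT1 j (subset_tsupport _ hne))
    rw [this, Complex.ofReal_zero, zero_mul]

theorem inner_testLp_deriv_of_jumps {p g : L2} {σ : ell2} (hp : HasWeakDerivOn P.punctured p g)
    (hσ : ∀ j, HasJump p (P.s j) (σ j)) {φ : ℝ → ℝ} (h : IsTest φ) :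
    inner ℂ (testLp h.deriv) p = -inner ℂ (testLp h) g - ∑' j, φ (P.s j) * σ j := by
  have h1 := hasWeakDerivOn_univ_iff.1 (P.hasWeakDerivOn_sub_lift hp hσ) φ h
  rw [inner_sub_right, inner_sub_right] at h1
  have h2 := P.inner_testLp_lift h σ
  linear_combination h1 + h2

theorem regularPartNormalized_eq (p : ℝ → ℂ) (σ : ℕ → ℂ) :
    P.regularPartNormalized p σ = fun x => p x - P.step σ x := rfl

theorem memLp_regularPartNormalized (p : L2) (σ : ℕ → ℂ) {k : Set ℝ} (hk : IsCompact k) :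
    MemLp (P.regularPartNormalized p σ) 2 (volume.restrict k) :=
  ((Lp.memLp p).restrict k).sub (P.memLp_step σ hk)

/-- Both `p` and the step function have singular derivative `∑ σ_j δ_{s_j}`. The difference keeps
only the derivative off `𝒮`. -/
theorem hasWeakDerivOn_regularPartNormalized {p g : L2} {σ : ell2}
    (hp : HasWeakDerivOn P.punctured p g) (hσ : ∀ j, HasJump p (P.s j) (σ j)) :
    HasWeakDerivOn univ (P.regularPartNormalized p σ) g := by
  intro φ h1 h2 _
  have h : IsTest φ := ⟨h1, h2⟩
  have e1 := P.inner_testLp_deriv_of_jumps hp hσ h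
  rw [inner_testLp, inner_testLp] at e1
  have e2 := P.integral_deriv_smul_step h σ
  simp only [regularPartNormalized_eq, smul_sub]
  rw [integral_sub (integrable_test_smul h.deriv (locallyIntegrable_L2 p))
    (integrable_test_smul h.deriv (locallyIntegrable_of_memLp_two fun k hk => P.memLp_step σ hk))]
  linear_combination e1 - e2

theorem regularPart_eq (p : ℝ → ℂ) {σ : ℕ → ℂ} (hσ : Summable σ) :
    P.regularPart p σ = fun x => P.regularPartNormalized p σ x -
      (1 / 2 : ℂ) * ∑' j, σ j * (Real.sign (0 - P.s j) : ℂ) := by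
  have hs : ∀ x : ℝ, Summable fun j => σ j * (Real.sign (x - P.s j) : ℂ) := by
    intro x
    refine Summable.of_norm_bounded hσ.norm fun j => ?_
    rw [norm_mul]
    exact mul_le_of_le_one_right (norm_nonneg _) (norm_sign_le _)
  funext x
  simp only [regularPart, regularPartNormalized, mul_sub]
  rw [(hs x).tsum_sub (hs 0)]
  ring

end Chain

theorem HasWeakDerivOn.sub_const {f : ℝ → ℂ} {g : ℝ → ℂ} (h : HasWeakDerivOn univ f g)
    (hf : LocallyIntegrable f) (c : ℂ) : HasWeakDerivOn univ (fun x => f x - c) g := by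
  intro φ h1 h2 h3
  have hφ : IsTest φ := ⟨h1, h2⟩
  simp only [smul_sub]
  rw [integral_sub (integrable_test_smul hφ.deriv hf) (hφ.deriv.integrable.smul_const c),
    integral_smul_const, integral_deriv_eq_zero hφ, zero_smul, sub_zero, h φ h1 h2 h3]

namespace Chain

variable (P : Chain)

theorem regularPart_spec (Ψ : P.hatA.domain) (σ : ell2)
    (hσ : ∀ j, HasJump (Ψ : State).1 (P.s j) (σ j)) :
    (MemHomH1 (P.regularPartNormalized (Ψ : State).1 σ) ∧
      ∃ g : L2, HasWeakDerivOn univ (P.regularPartNormalized (Ψ : State).1 σ) g ∧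
        (P.hatA Ψ).2.1 = -(1 / P.ρ : ℂ) • g) ∧
    (Summable (fun j => σ j) →
      MemHomH1 (P.regularPart (Ψ : State).1 σ) ∧
      ∃ g : L2, HasWeakDerivOn univ (P.regularPart (Ψ : State).1 σ) g ∧
        (P.hatA Ψ).2.1 = -(1 / P.ρ : ℂ) • g) := by
  obtain ⟨p', v', _, h1, _, _, _, e⟩ := P.exists_hatA_eq Ψ
  have hm := fun k hk => P.memLp_regularPartNormalized (Ψ : State).1 σ (k := k) hk
  have hw := P.hasWeakDerivOn_regularPartNormalized h1 hσ
  have e' : (P.hatA Ψ).2.1 = -(1 / P.ρ : ℂ) • p' := by rw [e]; rfl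
  refine ⟨⟨⟨hm, p', hw⟩, p', hw, e'⟩, fun hs => ?_⟩
  rw [P.regularPart_eq _ hs]
  have hw' := hw.sub_const (locallyIntegrable_of_memLp_two hm)
    ((1 / 2 : ℂ) * ∑' j, σ j * (Real.sign (0 - P.s j) : ℂ))
  refine ⟨⟨fun k hk => ?_, p', hw'⟩, p', hw', e'⟩
  have : IsFiniteMeasure (volume.restrict k) := ⟨by simpa using hk.measure_lt_top⟩
  exact (hm k hk).sub (memLp_const _)

end Chain

theorem HasWeakDerivOn.congr_right {U : Set ℝ} {f : ℝ → ℂ} {g g' : L2} (h : HasWeakDerivOn U f g)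
    (e : g = g') : HasWeakDerivOn U f g' := e ▸ h

/-! ### Coercive operators and coordinate projections -/

/-- A bounded operator `T` on a complex Hilbert space with `m ‖x‖² ≤ ‖⟨x, T x⟩‖`, `m > 0`, is
invertible. -/
theorem exists_equiv_of_coercive {H : Type*} [NormedAddCommGroup H] [InnerProductSpace ℂ H]
    [CompleteSpace H] (T : H →L[ℂ] H) {m : ℝ} (hm : 0 < m)
    (hT : ∀ x, m * ‖x‖ ^ 2 ≤ ‖(inner ℂ x (T x) : ℂ)‖) : ∃ E : H ≃L[ℂ] H, ∀ x, E x = T x := by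
  have low : ∀ x, m * ‖x‖ ≤ ‖T x‖ := by
    intro x
    have h2 := (hT x).trans (norm_inner_le_norm x (T x))
    rcases eq_or_lt_of_le (norm_nonneg x) with h | h
    · rw [← h, mul_zero]
      exact norm_nonneg _
    · nlinarith
  have anti : AntilipschitzWith (Real.toNNReal m⁻¹) T := by
    refine ContinuousLinearMap.antilipschitz_of_bound _ fun x => ?_
    rw [Real.coe_toNNReal _ (by positivity), inv_mul_eq_div, le_div_iff₀ hm, mul_comm]
    exact low x
  have hclosed : IsClosed (LinearMap.range (T : H →ₗ[ℂ] H) : Set H) :=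
    anti.isClosed_range T.uniformContinuous
  have : CompleteSpace (LinearMap.range (T : H →ₗ[ℂ] H)) := hclosed.completeSpace_coe
  have hrange : LinearMap.range (T : H →ₗ[ℂ] H) = ⊤ := by
    rw [← Submodule.orthogonal_eq_bot_iff, Submodule.eq_bot_iff]
    intro g hg
    have h0 : inner ℂ g (T g) = 0 := inner_eq_zero_symm.1 (hg (T g) ⟨g, rfl⟩)
    have h1 := hT g
    rw [h0, norm_zero] at h1
    have h2 : ‖g‖ ^ 2 ≤ 0 := by
      by_contra hlt
      exact absurd h1 (not_le.2 (mul_pos hm (not_le.1 hlt)))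
    exact norm_eq_zero.1 (pow_eq_zero_iff two_ne_zero |>.1 (le_antisymm h2 (sq_nonneg _)))
  exact ⟨ContinuousLinearEquiv.ofBijective T (LinearMap.ker_eq_bot.2 anti.injective) hrange,
    fun x => rfl⟩

theorem norm_sum_basisVec_le (y : ell2) (s : Finset ℕ) : ‖∑ i ∈ s, basisVec i (y i)‖ ≤ ‖y‖ := by
  have h1 := lp.norm_sum_single (p := 2) (E := fun _ : ℕ => ℂ) (by norm_num) y s
  have h2 := lp.sum_rpow_le_norm_rpow (p := 2) (by norm_num) y s
  rw [← h1] at h2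
  exact (Real.rpow_le_rpow_iff (norm_nonneg _) (norm_nonneg _) (by norm_num)).1 h2

theorem tendsto_sum_basisVec (y : ell2) :
    Tendsto (fun s : Finset ℕ => ∑ i ∈ s, basisVec i (y i)) atTop (𝓝 y) :=
  lp.hasSum_single (p := 2) (by norm_num) y

/-- Truncations of a convergent family converge, jointly in both parameters. -/
theorem tendsto_sum_basisVec_prod {x : Finset ℕ → ell2} {y : ell2} (hx : Tendsto x atTop (𝓝 y)) :
    Tendsto (fun F : Finset ℕ × Finset ℕ => ∑ i ∈ F.1, basisVec i (x F.2 i)) atTop (𝓝 y) := by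
  rw [← prod_atTop_atTop_eq]
  have h1 : Tendsto (fun F : Finset ℕ × Finset ℕ => ∑ i ∈ F.1, basisVec i (y i))
      (atTop ×ˢ atTop) (𝓝 y) := (tendsto_sum_basisVec y).comp tendsto_fst
  have h2 : Tendsto (fun F : Finset ℕ × Finset ℕ => ∑ i ∈ F.1, basisVec i ((x F.2 - y) i))
      (atTop ×ˢ atTop) (𝓝 0) := by
    -- Truncation never increases the norm, so the error `x_J - y` is controlled uniformly in the
    -- truncating set.
    refine squeeze_zero_norm (fun F => norm_sum_basisVec_le _ _) ?_
    have := (hx.comp (tendsto_snd (f := (atTop : Filter (Finset ℕ))))).sub_const y |>.norm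
    simpa using this
  have h3 := h1.add h2
  rw [add_zero] at h3
  refine h3.congr fun F => ?_
  rw [← Finset.sum_add_distrib]
  refine Finset.sum_congr rfl fun i _ => ?_
  rw [basisVec, basisVec, basisVec, ← lp.single_add]
  congr 1
  change y i + (x F.2 i - y i) = x F.2 i
  ring

theorem le_re_inner_diagCLM {c : ℕ → ℂ} {B m : ℝ} (hc : ∀ j, ‖c j‖ ≤ B) (hm : ∀ j, m ≤ (c j).re)
    (σ : ell2) : m * ‖σ‖ ^ 2 ≤ (inner ℂ σ (diagCLM c hc σ)).re := by
  have h1 := (lp.hasSum_inner σ σ).mapL Complex.reCLM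
  have h2 := (lp.hasSum_inner σ (diagCLM c hc σ)).mapL Complex.reCLM
  have h3 : ‖σ‖ ^ 2 = (inner ℂ σ σ).re := by
    rw [inner_self_eq_norm_sq_to_K]
    simp [← Complex.ofReal_pow]
  rw [h3]
  refine hasSum_le (fun j => ?_) (h1.mul_left m) h2
  have e : ∀ d : ℂ, inner ℂ (σ j) (d * σ j) = d * (Complex.normSq (σ j) : ℂ) := fun d => by
    rw [RCLike.inner_apply, mul_assoc, Complex.mul_conj]
  have e1 := e 1
  rw [one_mul, one_mul] at e1
  rw [Complex.reCLM_apply, Complex.reCLM_apply, diagCLM_apply, e1, e, Complex.re_mul_ofReal,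
    Complex.ofReal_re]
  exact mul_le_mul_of_nonneg_right (hm j) (Complex.normSq_nonneg _)

namespace Chain

variable (P : Chain)

/-! ### The resolvent of the acoustic part -/

/-- The characteristic combinations `u₁ = p + aρ v` and `u₂ = p - aρ v` decouple the system into
`u₁' + (ζ/a) u₁ = ρ g + f/a` and `u₂' - (ζ/a) u₂ = ρ g - f/a`. -/
theorem exists_waveResolvent {ζ : ℂ} (hζ : ζ.re ≠ 0) :
    ∃ W : (L2 × L2) →L[ℂ] (L2 × L2), ∀ f g : L2,
      HasWeakDerivOn univ (W (f, g)).1 ((P.ρ : ℂ) • (g - ζ • (W (f, g)).2) : L2) ∧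
      HasWeakDerivOn univ (W (f, g)).2
        ((1 / (P.a ^ 2 * P.ρ) : ℂ) • (f - ζ • (W (f, g)).1) : L2) := by
  have ha := P.a_ne_zero
  have hρ := P.ρ_ne_zero
  have hκ : (ζ / P.a).re ≠ 0 := by
    rw [Complex.div_ofReal_re]
    exact div_ne_zero hζ P.a_pos.ne'
  obtain ⟨T₁, hT₁⟩ := exists_resolvent_deriv hκ
  obtain ⟨T₂, hT₂⟩ := exists_resolvent_deriv (κ := -(ζ / P.a)) (by simpa using hκ)
  let F : (L2 × L2) →L[ℂ] L2 := ContinuousLinearMap.fst ℂ _ _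
  let G : (L2 × L2) →L[ℂ] L2 := ContinuousLinearMap.snd ℂ _ _
  let w₁ : (L2 × L2) →L[ℂ] L2 := T₁.comp ((P.ρ : ℂ) • G + (1 / P.a : ℂ) • F)
  let w₂ : (L2 × L2) →L[ℂ] L2 := T₂.comp ((P.ρ : ℂ) • G - (1 / P.a : ℂ) • F)
  refine ⟨((1 / 2 : ℂ) • (w₁ + w₂)).prod ((1 / (2 * P.a * P.ρ) : ℂ) • (w₁ - w₂)), fun f g => ?_⟩
  have h₁ : HasWeakDerivOn univ (w₁ (f, g)) _ := hT₁ ((P.ρ : ℂ) • g + (1 / P.a : ℂ) • f)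
  have h₂ : HasWeakDerivOn univ (w₂ (f, g)) _ := hT₂ ((P.ρ : ℂ) • g - (1 / P.a : ℂ) • f)
  change HasWeakDerivOn univ ((1 / 2 : ℂ) • (w₁ (f, g) + w₂ (f, g)) : L2) ((P.ρ : ℂ) •
      (g - ζ • ((1 / (2 * P.a * P.ρ) : ℂ) • (w₁ (f, g) - w₂ (f, g)))) : L2) ∧
    HasWeakDerivOn univ ((1 / (2 * P.a * P.ρ) : ℂ) • (w₁ (f, g) - w₂ (f, g)) : L2)
      ((1 / (P.a ^ 2 * P.ρ) : ℂ) • (f - ζ • ((1 / 2 : ℂ) • (w₁ (f, g) + w₂ (f, g)))) : L2)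
  have e₁ : T₁ ((P.ρ : ℂ) • g + (1 / P.a : ℂ) • f) = w₁ (f, g) := rfl
  have e₂ : T₂ ((P.ρ : ℂ) • g - (1 / P.a : ℂ) • f) = w₂ (f, g) := rfl
  rw [e₁] at h₁
  rw [e₂] at h₂
  generalize w₁ (f, g) = u₁ at *
  generalize w₂ (f, g) = u₂ at *
  constructor
  · have := (h₁.add h₂).smul (1 / 2)
    refine this.congr_right ?_
    match_scalars <;> field_simp <;> ring
  · have := (h₁.sub h₂).smul (1 / (2 * P.a * P.ρ))
    refine this.congr_right ?_
    match_scalars <;> field_simp <;> ring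

theorem wave_unique {ζ : ℂ} (hζ : ζ.re ≠ 0) {p v p' v' : L2} (hp : HasWeakDerivOn univ p p')
    (hv : HasWeakDerivOn univ v v') (h1 : (P.a ^ 2 * P.ρ : ℂ) • v' + ζ • p = 0)
    (h2 : (1 / P.ρ : ℂ) • p' + ζ • v = 0) : p = 0 ∧ v = 0 := by
  have ha := P.a_ne_zero
  have hρ := P.ρ_ne_zero
  have hκ : (ζ / P.a).re ≠ 0 := by
    rw [Complex.div_ofReal_re]
    exact div_ne_zero hζ P.a_pos.ne'
  have e1 : v' = (-(ζ / (P.a ^ 2 * P.ρ)) : ℂ) • p := by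
    have : (1 / (P.a ^ 2 * P.ρ) : ℂ) • ((P.a ^ 2 * P.ρ : ℂ) • v' + ζ • p) = 0 := by
      rw [h1, smul_zero]
    rw [smul_add, smul_smul, one_div_mul_cancel (mul_ne_zero (pow_ne_zero 2 ha) hρ), one_smul,
      smul_smul, add_eq_zero_iff_eq_neg, ← neg_smul] at this
    rw [this]
    congr 1
    ring
  have e2 : p' = (-(P.ρ * ζ) : ℂ) • v := by
    have : (P.ρ : ℂ) • ((1 / P.ρ : ℂ) • p' + ζ • v) = 0 := by rw [h2, smul_zero]
    rwa [smul_add, smul_smul, mul_one_div_cancel hρ, one_smul, smul_smul, add_eq_zero_iff_eq_neg,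
      ← neg_smul] at this
  subst e1 e2
  have f1 : p + (P.a * P.ρ : ℂ) • v = 0 := by
    refine eq_zero_of_hasWeakDerivOn_complex_smul (κ := -(ζ / P.a)) (by simpa using hκ) ?_
    refine (hp.add (hv.smul (P.a * P.ρ))).congr_right ?_
    match_scalars <;> field_simp
  have f2 : p - (P.a * P.ρ : ℂ) • v = 0 := by
    refine eq_zero_of_hasWeakDerivOn_complex_smul hκ ?_
    refine (hp.sub (hv.smul (P.a * P.ρ))).congr_right ?_
    match_scalars <;> field_simp
  have f3 : (2 : ℂ) • p = 0 := by
    have := congrArg₂ (· + ·) f1 f2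
    simp only [add_zero] at this
    rw [← this]
    module
  have p0 : p = 0 := (smul_eq_zero.1 f3).resolve_left two_ne_zero
  refine ⟨p0, ?_⟩
  rw [p0, zero_add] at f1
  exact (smul_eq_zero.1 f1).resolve_left (mul_ne_zero ha hρ)

/-- The resolvent of the acoustic part of the uncoupled generator. -/
def waveResolvent (ζ : ℂ) (hζ : ζ.re ≠ 0) : (L2 × L2) →L[ℂ] (L2 × L2) :=
  Classical.choose (P.exists_waveResolvent hζ)

theorem waveResolvent_spec (ζ : ℂ) (hζ : ζ.re ≠ 0) (f g : L2) :
    HasWeakDerivOn univ (P.waveResolvent ζ hζ (f, g)).1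
        ((P.ρ : ℂ) • (g - ζ • (P.waveResolvent ζ hζ (f, g)).2) : L2) ∧
      HasWeakDerivOn univ (P.waveResolvent ζ hζ (f, g)).2
        ((1 / (P.a ^ 2 * P.ρ) : ℂ) • (f - ζ • (P.waveResolvent ζ hζ (f, g)).1) : L2) :=
  Classical.choose_spec (P.exists_waveResolvent hζ) f g

/-! ### The impedance of the oscillators -/

/-- Multiplying by `conj ζ` turns `ζ²` into `|ζ|² ζ`, so both terms have real parts of the same
sign. All bounds on the impedance off the imaginary axis rest on this. -/
theorem re_conj_mul_impedance (ζ : ℂ) (j : ℕ) :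
    (conj ζ * (P.K j + ζ ^ 2 * P.M j)).re = ζ.re * (P.K j + ‖ζ‖ ^ 2 * P.M j) := by
  rw [← Complex.normSq_eq_norm_sq, Complex.normSq_apply]
  simp only [pow_two, Complex.mul_re, Complex.mul_im, Complex.add_re, Complex.add_im,
    Complex.conj_re, Complex.conj_im, Complex.ofReal_re, Complex.ofReal_im]
  ring

theorem impedance_pos (ζ : ℂ) (j : ℕ) : 0 < P.K j + ‖ζ‖ ^ 2 * P.M j := by
  have := P.K_pos j
  have := P.M_pos j
  positivity

theorem le_norm_impedance (ζ : ℂ) (j : ℕ) :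
    |ζ.re| * (P.K j + ‖ζ‖ ^ 2 * P.M j) ≤ ‖ζ‖ * ‖(P.K j + ζ ^ 2 * P.M j : ℂ)‖ := by
  have h1 := Complex.abs_re_le_norm (conj ζ * (P.K j + ζ ^ 2 * P.M j))
  have hK := P.K_pos j
  have hM := P.M_pos j
  rwa [re_conj_mul_impedance, norm_mul, RCLike.norm_conj, abs_mul,
    abs_of_nonneg (by positivity : 0 ≤ P.K j + ‖ζ‖ ^ 2 * P.M j)] at h1

theorem impedance_ne_zero {ζ : ℂ} (hζ : ζ.re ≠ 0) (j : ℕ) :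
    (P.K j + ζ ^ 2 * P.M j : ℂ) ≠ 0 := by
  intro h0
  have h1 := P.le_norm_impedance ζ j
  rw [h0, norm_zero, mul_zero] at h1
  exact absurd h1 (not_le.2 (mul_pos (abs_pos.2 hζ) (P.impedance_pos ζ j)))

theorem exists_norm_inv_impedance_le {ζ : ℂ} (hζ : ζ.re ≠ 0) :
    ∃ B, ∀ j, ‖(1 / (P.K j + ζ ^ 2 * P.M j) : ℂ)‖ ≤ B := by
  obtain ⟨C, hC⟩ := P.invM_bdd
  have hζ0 : 0 < ‖ζ‖ := norm_pos_iff.2 fun h => hζ (by rw [h, Complex.zero_re])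
  have hre : 0 < |ζ.re| := abs_pos.2 hζ
  refine ⟨C / (|ζ.re| * ‖ζ‖), fun j => ?_⟩
  have hK := P.K_pos j
  have hM := P.M_pos j
  have h1 := P.le_norm_impedance ζ j
  -- The term with `K_j` is dropped, since only `1 / M_j` is known to be bounded.
  have h2 : |ζ.re| * ‖ζ‖ * P.M j ≤ ‖(P.K j + ζ ^ 2 * P.M j : ℂ)‖ := by
    refine le_of_mul_le_mul_left ?_ hζ0
    refine le_trans ?_ h1
    nlinarith [mul_pos hre hK]
  have hCj : 1 / P.M j ≤ C := hC ⟨j, rfl⟩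
  rw [norm_div, norm_one]
  calc 1 / ‖(P.K j + ζ ^ 2 * P.M j : ℂ)‖ ≤ 1 / (|ζ.re| * ‖ζ‖ * P.M j) :=
        one_div_le_one_div_of_le (by positivity) h2
    _ = (1 / P.M j) / (|ζ.re| * ‖ζ‖) := by field_simp
    _ ≤ _ := by gcongr

/-- Multiplication by `1 / (K_j + ζ² M_j)` on `ℓ²`. -/
def mulInvImp (ζ : ℂ) (hζ : ζ.re ≠ 0) : ell2 →L[ℂ] ell2 :=
  diagCLM _ (Classical.choose_spec (P.exists_norm_inv_impedance_le hζ))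

theorem mulInvImp_apply (ζ : ℂ) (hζ : ζ.re ≠ 0) (y : ell2) (j : ℕ) :
    P.mulInvImp ζ hζ y j = 1 / (P.K j + ζ ^ 2 * P.M j) * y j := rfl

/-- With `w = K_j + ζ² M_j`, the real part equals `|Re ζ| (K_j + |ζ|² M_j) / |w|²`. Since `|w| ≤ K_j
+ |ζ|² M_j`, upper bounds on `K_j` and `M_j` suffice. -/
theorem exists_le_re_impedance {ζ : ℂ} (hζ : ζ.re ≠ 0) :
    ∃ m > 0, ∀ j, m ≤ ((sgnRe ζ : ℂ) * ζ * (1 / (P.K j + ζ ^ 2 * P.M j))).re := by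
  obtain ⟨C, hC⟩ := P.K_bdd
  obtain ⟨C', hC'⟩ := P.M_bdd
  have hre : 0 < |ζ.re| := abs_pos.2 hζ
  have hCK : ∀ j, P.K j ≤ C := fun j => hC ⟨j, rfl⟩
  have hCM : ∀ j, P.M j ≤ C' := fun j => hC' ⟨j, rfl⟩
  have hC0 : 0 < C := (P.K_pos 0).trans_le (hCK 0)
  have hC0' : 0 < C' := (P.M_pos 0).trans_le (hCM 0)
  refine ⟨|ζ.re| / (C + ‖ζ‖ ^ 2 * C'), by positivity, fun j => ?_⟩
  have hK := P.K_pos j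
  have hM := P.M_pos j
  have hne := P.impedance_ne_zero hζ j
  set w : ℂ := P.K j + ζ ^ 2 * P.M j with hw
  have hpos := P.impedance_pos ζ j
  have hn : 0 < ‖w‖ := norm_pos_iff.2 hne
  have e1 : (sgnRe ζ : ℂ) * ζ * (1 / w) = ((sgnRe ζ / ‖w‖ ^ 2 : ℝ) : ℂ) * conj (conj ζ * w) := by
    have : conj w * w = ((‖w‖ ^ 2 : ℝ) : ℂ) := by
      rw [← Complex.normSq_eq_norm_sq, ← Complex.normSq_eq_conj_mul_self]
    have hn2 : ((‖w‖ ^ 2 : ℝ) : ℂ) ≠ 0 := Complex.ofReal_ne_zero.2 (by positivity)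
    rw [map_mul, Complex.conj_conj, Complex.ofReal_div, div_mul_eq_mul_div, eq_div_iff hn2, ← this]
    field_simp
  have hs : sgnRe ζ * ζ.re = |ζ.re| := by
    rw [sgnRe]
    rcases lt_or_gt_of_ne hζ with h | h
    · rw [Real.sign_of_neg h, abs_of_neg h]
      ring
    · rw [Real.sign_of_pos h, abs_of_pos h]
      ring
  have hwle : ‖w‖ ≤ P.K j + ‖ζ‖ ^ 2 * P.M j := by
    refine (norm_add_le _ _).trans (le_of_eq ?_)
    rw [norm_mul, norm_pow, Complex.norm_real, Complex.norm_real, Real.norm_of_nonneg hK.le,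
      Real.norm_of_nonneg hM.le]
  rw [e1, Complex.re_ofReal_mul, Complex.conj_re, hw, re_conj_mul_impedance, ← hw]
  have e2 : sgnRe ζ / ‖w‖ ^ 2 * (ζ.re * (P.K j + ‖ζ‖ ^ 2 * P.M j)) =
      |ζ.re| * ((P.K j + ‖ζ‖ ^ 2 * P.M j) / ‖w‖ ^ 2) := by
    rw [← hs]
    ring
  rw [e2, div_eq_mul_one_div]
  refine mul_le_mul_of_nonneg_left ?_ hre.le
  rw [div_le_div_iff₀ (by positivity) (by positivity), one_mul]
  calc ‖w‖ ^ 2 ≤ (P.K j + ‖ζ‖ ^ 2 * P.M j) ^ 2 := by gcongr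
    _ = (P.K j + ‖ζ‖ ^ 2 * P.M j) * (P.K j + ‖ζ‖ ^ 2 * P.M j) := by ring
    _ ≤ (P.K j + ‖ζ‖ ^ 2 * P.M j) * (C + ‖ζ‖ ^ 2 * C') := by
        gcongr
        · exact hCK j
        · exact hCM j

end Chain

/-! ### The Green function -/

theorem IsTest.contDiff_ofReal {φ : ℝ → ℝ} (h : IsTest φ) : ContDiff ℝ 1 fun x => (φ x : ℂ) :=
  Complex.ofRealCLM.contDiff.comp (h.1.of_le (by simp))

theorem contDiff_cexp_mul_sub (κ : ℂ) (s : ℝ) :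
    ContDiff ℝ 1 fun x : ℝ => Complex.exp (κ * (x - s)) := by
  have h : ContDiff ℝ 1 fun x : ℝ => κ * ((x : ℂ) - s) :=
    contDiff_const.mul (Complex.ofRealCLM.contDiff.sub contDiff_const)
  exact h.cexp

theorem IsTest.hasDerivAt_mul_cexp {φ : ℝ → ℝ} (h : IsTest φ) (κ : ℂ) (s x : ℝ) :
    HasDerivAt (fun x : ℝ => (φ x : ℂ) * Complex.exp (κ * (x - s)))
      ((((deriv φ x : ℝ) : ℂ) + κ * φ x) * Complex.exp (κ * (x - s))) x := by
  have h1 : HasDerivAt (fun x : ℝ => (φ x : ℂ)) ((deriv φ x : ℝ) : ℂ) x := (h.hasDerivAt x).ofReal_comp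
  have h2 : HasDerivAt (fun x : ℝ => κ * ((x : ℂ) - s)) (κ * 1) x :=
    ((hasDerivAt_id x).ofReal_comp.sub_const _).const_mul κ
  refine (h1.mul h2.cexp).congr_deriv ?_
  ring

theorem IsTest.integrable_mul_cexp {φ : ℝ → ℝ} (h : IsTest φ) (κ : ℂ) (s : ℝ) :
    Integrable fun x : ℝ => (φ x : ℂ) * Complex.exp (κ * (x - s)) := by
  refine Continuous.integrable_of_hasCompactSupport
    (h.contDiff_ofReal.continuous.mul (contDiff_cexp_mul_sub κ s).continuous) ?_
  exact (h.2.comp_left (g := fun x : ℝ => (x : ℂ)) Complex.ofReal_zero).mul_right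

theorem IsTest.integral_Ioi_cexp {φ : ℝ → ℝ} (h : IsTest φ) (κ : ℂ) (s : ℝ) :
    (∫ x in Ioi s, ((deriv φ x : ℝ) : ℂ) * Complex.exp (κ * (x - s))) +
      κ * ∫ x in Ioi s, (φ x : ℂ) * Complex.exp (κ * (x - s)) = -φ s := by
  have hc : HasCompactSupport fun x : ℝ => (φ x : ℂ) * Complex.exp (κ * (x - s)) :=
    (h.2.comp_left (g := fun x : ℝ => (x : ℂ)) Complex.ofReal_zero).mul_right
  have e := hc.integral_Ioi_deriv_eq (h.contDiff_ofReal.mul (contDiff_cexp_mul_sub κ s)) s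
  simp only [(h.hasDerivAt_mul_cexp κ s _).deriv, add_mul, mul_assoc κ] at e
  rw [integral_add (h.deriv.integrable_mul_cexp κ s).integrableOn
    ((h.integrable_mul_cexp κ s).const_mul κ).integrableOn, integral_const_mul] at e
  simpa using e

theorem IsTest.integral_Iic_cexp {φ : ℝ → ℝ} (h : IsTest φ) (κ : ℂ) (s : ℝ) :
    (∫ x in Iic s, ((deriv φ x : ℝ) : ℂ) * Complex.exp (κ * (x - s))) +
      κ * ∫ x in Iic s, (φ x : ℂ) * Complex.exp (κ * (x - s)) = φ s := by
  have hc : HasCompactSupport fun x : ℝ => (φ x : ℂ) * Complex.exp (κ * (x - s)) :=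
    (h.2.comp_left (g := fun x : ℝ => (x : ℂ)) Complex.ofReal_zero).mul_right
  have e := hc.integral_Iic_deriv_eq (h.contDiff_ofReal.mul (contDiff_cexp_mul_sub κ s)) s
  simp only [(h.hasDerivAt_mul_cexp κ s _).deriv, add_mul, mul_assoc κ] at e
  rw [integral_add (h.deriv.integrable_mul_cexp κ s).integrableOn
    ((h.integrable_mul_cexp κ s).const_mul κ).integrableOn, integral_const_mul] at e
  simpa using e

/-- `𝒢_ζ(· - s)` in `L²(ℝ)`. -/
def greenLp {a : ℝ} (ha : 0 < a) {ζ : ℂ} (hζ : ζ.re ≠ 0) (s : ℝ) : L2 :=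
  (memLp_green ha hζ s).toLp

/-- `𝒢_ζ'(· - s)` in `L²(ℝ)`. -/
def greenLp' {a : ℝ} (ha : 0 < a) {ζ : ℂ} (hζ : ζ.re ≠ 0) (s : ℝ) : L2 :=
  (memLp_green' ha hζ s).toLp

theorem sgnRe_sq {ζ : ℂ} (hζ : ζ.re ≠ 0) : (sgnRe ζ : ℂ) * sgnRe ζ = 1 := by
  rw [sgnRe]
  rcases lt_or_gt_of_ne hζ with h | h
  · rw [Real.sign_of_neg h]
    norm_num
  · rw [Real.sign_of_pos h]
    norm_num

theorem green_of_le (a : ℝ) (ζ : ℂ) {s x : ℝ} (hx : x ≤ s) : green a ζ (x - s) =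
    (sgnRe ζ * (a / (2 * ζ))) * Complex.exp ((sgnRe ζ * ζ / a) * (x - s)) := by
  rw [green, abs_of_nonpos (sub_nonpos.2 hx)]
  congr 2
  push_cast
  ring

theorem green_of_lt (a : ℝ) (ζ : ℂ) {s x : ℝ} (hx : s < x) : green a ζ (x - s) =
    (sgnRe ζ * (a / (2 * ζ))) * Complex.exp (-(sgnRe ζ * ζ / a) * (x - s)) := by
  rw [green, abs_of_pos (sub_pos.2 hx)]
  congr 2
  push_cast
  ring

theorem green'_of_lt (a : ℝ) (ζ : ℂ) {s x : ℝ} (hx : s < x) : green' a ζ (x - s) =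
    -(1 / 2) * Complex.exp (-(sgnRe ζ * ζ / a) * (x - s)) := by
  rw [green', abs_of_pos (sub_pos.2 hx), Real.sign_of_pos (sub_pos.2 hx), Complex.ofReal_one,
    mul_one]
  congr 2
  push_cast
  ring

theorem green'_of_gt (a : ℝ) (ζ : ℂ) {s x : ℝ} (hx : x < s) : green' a ζ (x - s) =
    (1 / 2) * Complex.exp ((sgnRe ζ * ζ / a) * (x - s)) := by
  rw [green', abs_of_neg (sub_neg.2 hx), Real.sign_of_neg (sub_neg.2 hx), Complex.ofReal_neg,
    Complex.ofReal_one, mul_neg_one, neg_neg]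
  congr 2
  push_cast
  ring

variable {a : ℝ} {ζ : ℂ} {φ : ℝ → ℝ}

theorem inner_testLp_greenLp (ha : 0 < a) (hζ : ζ.re ≠ 0) (s : ℝ) (h : IsTest φ) :
    inner ℂ (testLp h) (greenLp ha hζ s) = (sgnRe ζ * (a / (2 * ζ))) *
      ((∫ x in Iic s, (φ x : ℂ) * Complex.exp ((sgnRe ζ * ζ / a) * (x - s))) +
        ∫ x in Ioi s, (φ x : ℂ) * Complex.exp (-(sgnRe ζ * ζ / a) * (x - s))) := by
  rw [inner_testLp, ← integral_add_compl (measurableSet_Iic (a := s))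
    (integrable_smul_L2 _ h.continuous h.2), compl_Iic, mul_add, ← integral_const_mul,
    ← integral_const_mul]
  congr 1
  · refine setIntegral_congr_ae measurableSet_Iic ?_
    filter_upwards [(memLp_green ha hζ s).coeFn_toLp] with x hx hxs
    rw [greenLp, hx, green_of_le a ζ hxs, Complex.real_smul]
    ring
  · refine setIntegral_congr_ae measurableSet_Ioi ?_
    filter_upwards [(memLp_green ha hζ s).coeFn_toLp] with x hx hxs
    rw [greenLp, hx, green_of_lt a ζ hxs, Complex.real_smul]
    ring

theorem inner_testLp_greenLp' (ha : 0 < a) (hζ : ζ.re ≠ 0) (s : ℝ) (h : IsTest φ) :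
    inner ℂ (testLp h) (greenLp' ha hζ s) = (1 / 2) *
      ((∫ x in Iic s, (φ x : ℂ) * Complex.exp ((sgnRe ζ * ζ / a) * (x - s))) -
        ∫ x in Ioi s, (φ x : ℂ) * Complex.exp (-(sgnRe ζ * ζ / a) * (x - s))) := by
  rw [inner_testLp, ← integral_add_compl (measurableSet_Iic (a := s))
    (integrable_smul_L2 _ h.continuous h.2), compl_Iic, mul_sub, ← integral_const_mul,
    ← integral_const_mul, sub_eq_add_neg, ← integral_neg]
  have hs : ∀ᵐ x : ℝ, x ≠ s := by simp [ae_iff]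
  congr 1
  · refine setIntegral_congr_ae measurableSet_Iic ?_
    filter_upwards [(memLp_green' ha hζ s).coeFn_toLp, hs] with x hx hne hxs
    rw [greenLp', hx, green'_of_gt a ζ (lt_of_le_of_ne hxs hne), Complex.real_smul]
    ring
  · refine setIntegral_congr_ae measurableSet_Ioi ?_
    filter_upwards [(memLp_green' ha hζ s).coeFn_toLp] with x hx hxs
    rw [greenLp', hx, green'_of_lt a ζ hxs, Complex.real_smul]
    ring

/-- The boundary terms of the two half-lines at `s` cancel because the Green function is continuous
there. -/
theorem hasWeakDerivOn_greenLp (ha : 0 < a) (hζ : ζ.re ≠ 0) (s : ℝ) :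
    HasWeakDerivOn univ (greenLp ha hζ s) (greenLp' ha hζ s) := by
  rw [hasWeakDerivOn_univ_iff]
  intro φ h
  have ha' : (a : ℂ) ≠ 0 := Complex.ofReal_ne_zero.2 ha.ne'
  have hζ' : ζ ≠ 0 := fun h0 => hζ (by rw [h0, Complex.zero_re])
  have e1 := h.integral_Iic_cexp (sgnRe ζ * ζ / a) s
  have e2 := h.integral_Ioi_cexp (-(sgnRe ζ * ζ / a)) s
  have e3 : (sgnRe ζ * (a / (2 * ζ))) * (sgnRe ζ * ζ / a) = (1 / 2 : ℂ) := by
    field_simp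
    rw [pow_two, sgnRe_sq hζ]
  rw [inner_testLp_greenLp, inner_testLp_greenLp']
  linear_combination (sgnRe ζ * (a / (2 * ζ)) : ℂ) * (e1 + e2) -
    e3 * ((∫ x in Iic s, (φ x : ℂ) * Complex.exp ((sgnRe ζ * ζ / a) * (x - s))) -
        ∫ x in Ioi s, (φ x : ℂ) * Complex.exp (-(sgnRe ζ * ζ / a) * (x - s)))

/-- Here the two boundary terms add up. This is `-𝒢'' + (ζ² / a²) 𝒢 = δ_s` in weak form. -/
theorem inner_testLp_deriv_greenLp' (ha : 0 < a) (hζ : ζ.re ≠ 0) (s : ℝ) (h : IsTest φ) :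
    inner ℂ (testLp h.deriv) (greenLp' ha hζ s) +
      inner ℂ (testLp h) ((ζ ^ 2 / a ^ 2 : ℂ) • greenLp ha hζ s) = φ s := by
  have ha' : (a : ℂ) ≠ 0 := Complex.ofReal_ne_zero.2 ha.ne'
  have hζ' : ζ ≠ 0 := fun h0 => hζ (by rw [h0, Complex.zero_re])
  have e1 := h.integral_Iic_cexp (sgnRe ζ * ζ / a) s
  have e2 := h.integral_Ioi_cexp (-(sgnRe ζ * ζ / a)) s
  have e3 : (ζ ^ 2 / a ^ 2) * (sgnRe ζ * (a / (2 * ζ))) = (1 / 2 : ℂ) * (sgnRe ζ * ζ / a) := by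
    field_simp
  rw [inner_smul_right, inner_testLp_greenLp, inner_testLp_greenLp']
  linear_combination (1 / 2 : ℂ) * (e1 - e2) +
    e3 * ((∫ x in Iic s, (φ x : ℂ) * Complex.exp ((sgnRe ζ * ζ / a) * (x - s))) +
        ∫ x in Ioi s, (φ x : ℂ) * Complex.exp (-(sgnRe ζ * ζ / a) * (x - s)))

theorem hasTrace_greenLp (ha : 0 < a) (hζ : ζ.re ≠ 0) (s t : ℝ) :
    HasTrace (greenLp ha hζ s) (𝓝 t) (green a ζ (t - s)) := by
  have hc : Continuous fun x => green a ζ (x - s) := by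
    unfold green
    fun_prop
  exact HasTrace.congr_ae ((hc.tendsto t).mono_left inf_le_left)
    (memLp_green ha hζ s).coeFn_toLp.symm

namespace Chain

variable (P : Chain)

/-- `-𝒢'` and the sawtooth at `s_j` have the same unit jump, so their singular derivatives cancel.
The jumps of `-𝒢'` can then be read off from those of `lift`. -/
theorem hasWeakDerivOn_neg_greenLp'_sub (hζ : ζ.re ≠ 0) (j : ℕ) :
    HasWeakDerivOn univ (-greenLp' P.a_pos hζ (P.s j) - P.lift (basisVec j 1) : L2)
      (-((ζ ^ 2 / P.a ^ 2 : ℂ) • greenLp P.a_pos hζ (P.s j)) - P.liftDeriv (basisVec j 1) :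
        L2) := by
  rw [hasWeakDerivOn_univ_iff]
  intro φ h
  have e1 := inner_testLp_deriv_greenLp' P.a_pos hζ (P.s j) h
  have e2 := congrArg (starRingEnd ℂ) (inner_saw_testLp P.gap_pos (P.s j) h)
  rw [map_add, map_neg, Complex.conj_ofReal, inner_conj_symm, inner_conj_symm] at e2
  rw [lift_single, liftDeriv_single, inner_sub_right, inner_sub_right, inner_neg_right,
    inner_neg_right]
  linear_combination -e1 - e2

theorem hasWeakDerivOn_neg_greenLp' (hζ : ζ.re ≠ 0) (j : ℕ) :
    HasWeakDerivOn P.punctured (-greenLp' P.a_pos hζ (P.s j) : L2)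
      (-((ζ ^ 2 / P.a ^ 2 : ℂ) • greenLp P.a_pos hζ (P.s j)) : L2) := by
  have := P.hasWeakDerivOn_add_lift (P.hasWeakDerivOn_neg_greenLp'_sub hζ j) (basisVec j 1)
  rwa [sub_add_cancel, sub_add_cancel] at this

theorem hasJump_neg_greenLp' (hζ : ζ.re ≠ 0) (j i : ℕ) :
    HasJump (-greenLp' P.a_pos hζ (P.s j) : L2) (P.s i) (basisVec j 1 i) := by
  have := P.hasJump_add_lift (P.hasWeakDerivOn_neg_greenLp'_sub hζ j) (basisVec j 1) i
  rwa [sub_add_cancel] at this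

end Chain

namespace Chain

variable (P : Chain)

/-! ### The resolvent equation with prescribed jumps -/

/-- `Ψ = (p, v, y, z)` solves the resolvent equation with right-hand side `Φ`, the pressure having
jumps `σ` and no condition being imposed on the traces of `v`. -/
def SolvesWithJumps (ζ : ℂ) (Ψ : State) (σ : ell2) (Φ : State) : Prop :=
  ∃ p' v' : L2, HasWeakDerivOn P.punctured Ψ.1 p' ∧ (∀ j, HasJump Ψ.1 (P.s j) (σ j)) ∧
    HasWeakDerivOn univ Ψ.2.1 v' ∧
    (P.a ^ 2 * P.ρ : ℂ) • v' + ζ • Ψ.1 = Φ.1 ∧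
    (1 / P.ρ : ℂ) • p' + ζ • Ψ.2.1 = Φ.2.1 ∧
    -Ψ.2.2.2 + ζ • Ψ.2.2.1 = Φ.2.2.1 ∧
    P.mulKM Ψ.2.2.1 + (P.S : ℂ) • P.mulInvM σ + ζ • Ψ.2.2.2 = Φ.2.2.2

variable {P} {ζ : ℂ}

theorem SolvesWithJumps.add {Ψ Ψ₂ Φ Φ₂ : State} {σ σ₂ : ell2} (h : P.SolvesWithJumps ζ Ψ σ Φ)
    (h₂ : P.SolvesWithJumps ζ Ψ₂ σ₂ Φ₂) :
    P.SolvesWithJumps ζ (Ψ + Ψ₂) (σ + σ₂) (Φ + Φ₂) := by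
  obtain ⟨p', v', a1, a2, a3, a4, a5, a6, a7⟩ := h
  obtain ⟨q', u', b1, b2, b3, b4, b5, b6, b7⟩ := h₂
  refine ⟨p' + q', v' + u', a1.add b1, fun j => (a2 j).add (b2 j), a3.add b3, ?_, ?_, ?_, ?_⟩
  · rw [Prod.fst_add, Prod.fst_add, ← a4, ← b4]
    module
  · simp only [Prod.snd_add, Prod.fst_add, ← a5, ← b5]
    module
  · simp only [Prod.snd_add, Prod.fst_add, ← a6, ← b6]
    module
  · simp only [Prod.snd_add, Prod.fst_add, map_add, ← a7, ← b7]
    module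

theorem SolvesWithJumps.smul {Ψ Φ : State} {σ : ell2} (h : P.SolvesWithJumps ζ Ψ σ Φ) (k : ℂ) :
    P.SolvesWithJumps ζ (k • Ψ) (k • σ) (k • Φ) := by
  obtain ⟨p', v', a1, a2, a3, a4, a5, a6, a7⟩ := h
  refine ⟨k • p', k • v', a1.smul k, fun j => (a2 j).smul k, a3.smul k, ?_, ?_, ?_, ?_⟩
  · rw [Prod.smul_fst, Prod.smul_fst, ← a4]
    module
  · simp only [Prod.smul_snd, Prod.smul_fst, ← a5]
    module
  · simp only [Prod.smul_snd, Prod.smul_fst, ← a6]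
    module
  · simp only [Prod.smul_snd, Prod.smul_fst, map_smul, ← a7]
    module

/-- Without jumps the field and the oscillators decouple: the field vanishes by `wave_unique`, and
each oscillator because its impedance is nonzero. -/
theorem SolvesWithJumps.eq_zero (hζ : ζ.re ≠ 0) {Ψ : State} (h : P.SolvesWithJumps ζ Ψ 0 0) :
    Ψ = 0 := by
  obtain ⟨p', v', a1, a2, a3, a4, a5, a6, a7⟩ := h
  obtain ⟨p, v, y, z⟩ := Ψ
  have hp : HasWeakDerivOn univ p p' := P.hasWeakDerivOn_univ_of_jump_zero
    (locallyIntegrable_L2 _) (locallyIntegrable_L2 _) a1 a2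
  obtain ⟨hp0, hv0⟩ := P.wave_unique hζ hp a3 a4 a5
  have hz : ∀ j, z j = ζ * y j := fun j => by
    have := congrArg (fun w : ell2 => w j) a6
    change -z j + ζ * y j = 0 at this
    linear_combination -this
  have hy : ∀ j, y j = 0 := fun j => by
    have h7 := congrArg (fun w : ell2 => w j) a7
    rw [map_zero, smul_zero, add_zero] at h7
    change P.mulKM y j + ζ * z j = 0 at h7
    rw [P.mulKM_apply, hz] at h7
    have hM := P.M_ne_zero j
    have : (P.K j + ζ ^ 2 * P.M j) * y j = 0 := by
      field_simp at h7
      linear_combination h7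
    exact (mul_eq_zero.1 this).resolve_left (P.impedance_ne_zero hζ j)
  have hy0 : y = 0 := lp.ext (funext hy)
  have hz0 : z = 0 := lp.ext (funext fun j => by rw [hz, hy, mul_zero]; rfl)
  rw [hy0, hz0]
  exact Prod.ext hp0 (Prod.ext hv0 rfl)

theorem SolvesWithJumps.unique (hζ : ζ.re ≠ 0) {Ψ Ψ₂ Φ : State} {σ : ell2}
    (h : P.SolvesWithJumps ζ Ψ σ Φ) (h₂ : P.SolvesWithJumps ζ Ψ₂ σ Φ) : Ψ = Ψ₂ := by
  have := h.add (h₂.smul (-1))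
  simp only [neg_smul, one_smul, add_neg_cancel] at this
  exact add_neg_eq_zero.1 (this.eq_zero hζ)

variable (P) (ζ)

/-! ### The free resolvent and the field generated by the jumps -/

/-- The resolvent `(-A + ζ)⁻¹`. -/
def freeResolvent (hζ : ζ.re ≠ 0) : State →L[ℂ] State :=
  let f : State →L[ℂ] L2 := ContinuousLinearMap.fst ℂ _ _
  let r : State →L[ℂ] (L2 × ell2 × ell2) := ContinuousLinearMap.snd ℂ _ _
  let g : State →L[ℂ] L2 := (ContinuousLinearMap.fst ℂ _ _).comp r
  let q : State →L[ℂ] (ell2 × ell2) := (ContinuousLinearMap.snd ℂ _ _).comp r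
  let h : State →L[ℂ] ell2 := (ContinuousLinearMap.fst ℂ _ _).comp q
  let k : State →L[ℂ] ell2 := (ContinuousLinearMap.snd ℂ _ _).comp q
  let w : State →L[ℂ] (L2 × L2) := (P.waveResolvent ζ hζ).comp (f.prod g)
  -- Eliminating `z = ζ y - h` from the last equation gives `(K_j + ζ² M_j) y_j = M_j (ζ h_j +
  -- k_j)`.
  let y : State →L[ℂ] ell2 := (P.mulInvImp ζ hζ).comp (P.mulM.comp (ζ • h + k))
  ((ContinuousLinearMap.fst ℂ _ _).comp w).prod
    (((ContinuousLinearMap.snd ℂ _ _).comp w).prod (y.prod (ζ • y - h)))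

theorem freeResolvent_apply (hζ : ζ.re ≠ 0) (f g : L2) (h k : ell2) :
    P.freeResolvent ζ hζ (f, g, h, k) =
      ((P.waveResolvent ζ hζ (f, g)).1, (P.waveResolvent ζ hζ (f, g)).2,
        P.mulInvImp ζ hζ (P.mulM (ζ • h + k)),
        ζ • P.mulInvImp ζ hζ (P.mulM (ζ • h + k)) - h) := rfl

theorem solvesWithJumps_freeResolvent (hζ : ζ.re ≠ 0) (Φ : State) :
    P.SolvesWithJumps ζ (P.freeResolvent ζ hζ Φ) 0 Φ := by
  obtain ⟨f, g, h, k⟩ := Φ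
  obtain ⟨h1, h2⟩ := P.waveResolvent_spec ζ hζ f g
  have ha := P.a_ne_zero
  have hρ := P.ρ_ne_zero
  rw [freeResolvent_apply]
  refine ⟨_, _, h1.mono (subset_univ _), fun j => (P.hasTrace_trace h1 j).hasJump_zero, h2,
    ?_, ?_, ?_, ?_⟩
  · change _ = f
    rw [smul_smul, mul_one_div_cancel (mul_ne_zero (pow_ne_zero 2 ha) hρ), one_smul,
      sub_add_cancel]
  · change _ = g
    rw [smul_smul, one_div_mul_cancel hρ, one_smul, sub_add_cancel]
  · change -(ζ • P.mulInvImp ζ hζ (P.mulM (ζ • h + k)) - h) +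
      ζ • P.mulInvImp ζ hζ (P.mulM (ζ • h + k)) = h
    abel
  · ext j
    rw [map_zero, smul_zero, add_zero]
    change P.mulKM (P.mulInvImp ζ hζ (P.mulM (ζ • h + k))) j +
      ζ * (ζ * P.mulInvImp ζ hζ (P.mulM (ζ • h + k)) j - h j) = k j
    rw [mulKM_apply, mulInvImp_apply, mulM_apply]
    change P.K j / P.M j * (1 / (P.K j + ζ ^ 2 * P.M j) * (P.M j * (ζ * h j + k j))) +
      ζ * (ζ * (1 / (P.K j + ζ ^ 2 * P.M j) * (P.M j * (ζ * h j + k j))) - h j) = k j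
    have hM := P.M_ne_zero j
    have hI := P.impedance_ne_zero hζ j
    generalize hD : (P.K j + ζ ^ 2 * P.M j : ℂ) = D at hI ⊢
    field_simp
    rw [← hD]
    ring

/-- The solution `∑ⱼ σ_j G_ζ^j` of the homogeneous resolvent equation with jumps `σ`. -/
def jumpField (hζ : ζ.re ≠ 0) : ell2 →L[ℂ] State :=
  -- Writing `p = q + lift σ` moves the lift to the right-hand side of the wave equations for `q`
  -- and `v`. The oscillators satisfy `(K_j + ζ² M_j) y_j = -S σ_j` and `z = ζ y`.
  let w : ell2 →L[ℂ] (L2 × L2) := (P.waveResolvent ζ hζ).comp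
    ((-ζ • P.lift).prod (-(1 / P.ρ : ℂ) • P.liftDeriv))
  let y : ell2 →L[ℂ] ell2 := -(P.S : ℂ) • P.mulInvImp ζ hζ
  ((ContinuousLinearMap.fst ℂ _ _).comp w + P.lift).prod
    (((ContinuousLinearMap.snd ℂ _ _).comp w).prod (y.prod (ζ • y)))

theorem jumpField_apply (hζ : ζ.re ≠ 0) (σ : ell2) :
    P.jumpField ζ hζ σ =
      ((P.waveResolvent ζ hζ (-ζ • P.lift σ, -(1 / P.ρ : ℂ) • P.liftDeriv σ)).1 + P.lift σ,
        (P.waveResolvent ζ hζ (-ζ • P.lift σ, -(1 / P.ρ : ℂ) • P.liftDeriv σ)).2,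
        -(P.S : ℂ) • P.mulInvImp ζ hζ σ, ζ • (-(P.S : ℂ) • P.mulInvImp ζ hζ σ)) := rfl

theorem solvesWithJumps_jumpField (hζ : ζ.re ≠ 0) (σ : ell2) :
    P.SolvesWithJumps ζ (P.jumpField ζ hζ σ) σ 0 := by
  have h0 := P.waveResolvent_spec ζ hζ (-ζ • P.lift σ) (-(1 / P.ρ : ℂ) • P.liftDeriv σ)
  have ha := P.a_ne_zero
  have hρ := P.ρ_ne_zero
  rw [jumpField_apply]
  generalize P.waveResolvent ζ hζ (-ζ • P.lift σ, -(1 / P.ρ : ℂ) • P.liftDeriv σ) = w at h0 ⊢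
  obtain ⟨q, v⟩ := w
  obtain ⟨h1, h2⟩ := h0
  refine ⟨_, _, P.hasWeakDerivOn_add_lift h1 σ, P.hasJump_add_lift h1 σ, h2, ?_, ?_, ?_, ?_⟩
  · change (P.a ^ 2 * P.ρ : ℂ) • ((1 / (P.a ^ 2 * P.ρ) : ℂ) • (-ζ • P.lift σ - ζ • q)) +
      ζ • (q + P.lift σ) = 0
    rw [smul_smul, mul_one_div_cancel (mul_ne_zero (pow_ne_zero 2 ha) hρ)]
    module
  · change (1 / P.ρ : ℂ) • ((P.ρ : ℂ) • (-(1 / P.ρ : ℂ) • P.liftDeriv σ - ζ • v) +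
      P.liftDeriv σ) + ζ • v = 0
    match_scalars <;> field_simp <;> ring
  · change -(ζ • (-(P.S : ℂ) • P.mulInvImp ζ hζ σ)) + ζ • (-(P.S : ℂ) • P.mulInvImp ζ hζ σ) = 0
    exact neg_add_cancel _
  · ext j
    change P.mulKM (-(P.S : ℂ) • P.mulInvImp ζ hζ σ) j + P.S * P.mulInvM σ j +
      ζ * (ζ * (-(P.S : ℂ) * P.mulInvImp ζ hζ σ j)) = 0
    rw [map_smul]
    change -(P.S : ℂ) * P.mulKM (P.mulInvImp ζ hζ σ) j + P.S * P.mulInvM σ j +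
      ζ * (ζ * (-(P.S : ℂ) * P.mulInvImp ζ hζ σ j)) = 0
    rw [mulKM_apply, mulInvImp_apply, mulInvM_apply]
    have hM := P.M_ne_zero j
    have hI := P.impedance_ne_zero hζ j
    generalize hD : (P.K j + ζ ^ 2 * P.M j : ℂ) = D at hI ⊢
    field_simp
    rw [← hD]
    ring

theorem solvesWithJumps_vecG (hζ : ζ.re ≠ 0) (j : ℕ) :
    P.SolvesWithJumps ζ (P.vecG ζ hζ j) (basisVec j 1) 0 := by
  have ha := P.a_ne_zero
  have hρ := P.ρ_ne_zero
  refine ⟨_, _, P.hasWeakDerivOn_neg_greenLp' hζ j, P.hasJump_neg_greenLp' hζ j,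
    (hasWeakDerivOn_greenLp P.a_pos hζ (P.s j)).smul (ζ / (P.a ^ 2 * P.ρ)), ?_, ?_, ?_, ?_⟩
  · change (P.a ^ 2 * P.ρ : ℂ) • ((ζ / (P.a ^ 2 * P.ρ) : ℂ) • greenLp' P.a_pos hζ (P.s j)) +
      ζ • (-greenLp' P.a_pos hζ (P.s j)) = 0
    match_scalars
    field_simp
    ring
  · change (1 / P.ρ : ℂ) • (-((ζ ^ 2 / P.a ^ 2 : ℂ) • greenLp P.a_pos hζ (P.s j))) +
      ζ • ((ζ / (P.a ^ 2 * P.ρ) : ℂ) • greenLp P.a_pos hζ (P.s j)) = 0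
    match_scalars
    field_simp
    ring
  · change -basisVec j (-ζ * P.S / (P.K j + ζ ^ 2 * P.M j)) +
      ζ • basisVec j (-P.S / (P.K j + ζ ^ 2 * P.M j)) = 0
    rw [basisVec, basisVec, ← lp.single_smul, ← lp.single_neg, ← lp.single_add]
    convert lp.single_zero 2 j using 2
    rw [smul_eq_mul]
    ring
  · ext i
    change P.mulKM (basisVec j (-P.S / (P.K j + ζ ^ 2 * P.M j))) i +
      P.S * P.mulInvM (basisVec j 1) i +
        ζ * basisVec j (-ζ * P.S / (P.K j + ζ ^ 2 * P.M j)) i = 0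
    rw [mulKM_apply, mulInvM_apply]
    by_cases hij : i = j
    · subst hij
      rw [lp.single_apply_self, lp.single_apply_self, lp.single_apply_self]
      have hM := P.M_ne_zero i
      have hI := P.impedance_ne_zero hζ i
      generalize hD : (P.K i + ζ ^ 2 * P.M i : ℂ) = D at hI ⊢
      field_simp
      rw [← hD]
      ring
    · rw [lp.single_apply_ne _ _ _ hij, lp.single_apply_ne _ _ _ hij,
        lp.single_apply_ne _ _ _ hij]
      simp

/-- Both solve the same relaxed problem, so uniqueness identifies them without an explicit kernel
for `waveResolvent`. -/
theorem jumpField_basisVec (hζ : ζ.re ≠ 0) (j : ℕ) :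
    P.jumpField ζ hζ (basisVec j 1) = P.vecG ζ hζ j :=
  (P.solvesWithJumps_jumpField ζ hζ _).unique hζ (P.solvesWithJumps_vecG ζ hζ j)

/-! ### The coupling condition -/

/-- For a solution `Ψ = (p, v, y, z)` of the resolvent equation whose right-hand side has first
component `f`, the sequence `(v(s_j) - z_j)_j`. -/
def defect : (State × L2) →L[ℂ] ell2 :=
  let Ψ : (State × L2) →L[ℂ] State := ContinuousLinearMap.fst ℂ _ _
  let f : (State × L2) →L[ℂ] L2 := ContinuousLinearMap.snd ℂ _ _
  let p : (State × L2) →L[ℂ] L2 := (ContinuousLinearMap.fst ℂ _ _).comp Ψ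
  let r : (State × L2) →L[ℂ] (L2 × ell2 × ell2) := (ContinuousLinearMap.snd ℂ _ _).comp Ψ
  let v : (State × L2) →L[ℂ] L2 := (ContinuousLinearMap.fst ℂ _ _).comp r
  let z : (State × L2) →L[ℂ] ell2 :=
    (ContinuousLinearMap.snd ℂ _ _).comp ((ContinuousLinearMap.snd ℂ _ _).comp r)
  (-((ContinuousLinearMap.adjoint P.lift).comp ((1 / (P.a ^ 2 * P.ρ) : ℂ) • (f - ζ • p))) -
    (ContinuousLinearMap.adjoint P.liftDeriv).comp v - z)

theorem defect_apply (Ψ : State) (f : L2) : P.defect ζ (Ψ, f) =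
    P.trace Ψ.2.1 ((1 / (P.a ^ 2 * P.ρ) : ℂ) • (f - ζ • Ψ.1)) - Ψ.2.2.2 := rfl

variable {P} {ζ}

/-- The first equation expresses `v'` as `(f - ζ p) / (a²ρ)`. This is why the defect is a bounded
function of `(Ψ, f)` although point values are not bounded on `L²`. -/
theorem SolvesWithJumps.defect_eq {Ψ Φ : State} {σ : ell2} (h : P.SolvesWithJumps ζ Ψ σ Φ)
    {v' : L2} (hv : HasWeakDerivOn univ Ψ.2.1 v') :
    P.defect ζ (Ψ, Φ.1) = P.trace Ψ.2.1 v' - Ψ.2.2.2 := by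
  obtain ⟨p', u', a1, a2, a3, a4, a5, a6, a7⟩ := h
  have e : u' = v' := HasWeakDerivOn.unique isOpen_univ (by simp) a3 hv
  rw [defect_apply, ← a4, add_sub_cancel_right, smul_smul, one_div_mul_cancel
    (mul_ne_zero (pow_ne_zero 2 P.a_ne_zero) P.ρ_ne_zero), one_smul, e]

/-- Energy balance of the field: pairing the two wave equations with `p` and with `v` makes the
derivative terms combine into the boundary term. -/
theorem SolvesWithJumps.inner_trace {Ψ : State} {σ : ell2} (h : P.SolvesWithJumps ζ Ψ σ 0)
    {v' : L2} (hv : HasWeakDerivOn univ Ψ.2.1 v') :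
    inner ℂ σ (P.trace Ψ.2.1 v') = ζ * ((1 / (P.a ^ 2 * P.ρ) * ‖Ψ.1‖ ^ 2 : ℝ) : ℂ) +
      conj ζ * ((P.ρ * ‖Ψ.2.1‖ ^ 2 : ℝ) : ℂ) := by
  obtain ⟨p', u', a1, a2, a3, a4, a5, a6, a7⟩ := h
  have ha := P.a_ne_zero
  have hρ := P.ρ_ne_zero
  have e : u' = v' := HasWeakDerivOn.unique isOpen_univ (by simp) a3 hv
  subst e
  have h1 := P.inner_deriv_of_jumps a1 a2 a3
  have h2 : inner ℂ Ψ.1 ((P.a ^ 2 * P.ρ : ℂ) • u' + ζ • Ψ.1) = 0 := by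
    rw [a4]
    exact inner_zero_right _
  have h3 : inner ℂ ((1 / P.ρ : ℂ) • p' + ζ • Ψ.2.1) Ψ.2.1 = 0 := by
    rw [a5]
    exact inner_zero_left _
  rw [inner_add_right, inner_smul_right, inner_smul_right, inner_self_eq_norm_sq_to_K] at h2
  rw [inner_add_left, inner_smul_left, inner_smul_left, inner_self_eq_norm_sq_to_K] at h3
  simp only [map_div₀, map_one, Complex.conj_ofReal, Complex.coe_algebraMap] at h2 h3
  push_cast
  field_simp at h2 h3 ⊢
  linear_combination ((P.a : ℂ) ^ 2 * P.ρ) * h1 - h2 - (P.a : ℂ) ^ 2 * P.ρ * h3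

variable (P) (ζ)

/-- The operator `Γ(ζ)` on `ℓ²`. -/
def gammaOp (hζ : ζ.re ≠ 0) : ell2 →L[ℂ] ell2 :=
  -((P.defect ζ).comp ((P.jumpField ζ hζ).prod 0))

theorem gammaOp_apply (hζ : ζ.re ≠ 0) (σ : ell2) :
    P.gammaOp ζ hζ σ = -P.defect ζ (P.jumpField ζ hζ σ, 0) := rfl

/-- After multiplication by the sign of `Re ζ`, the field and the oscillators contribute to `-⟨σ, Γ
σ⟩` with nonnegative real parts. The oscillator part alone is at least `S m ‖σ‖²`. -/
theorem exists_coercive_gammaOp (hζ : ζ.re ≠ 0) :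
    ∃ m > 0, ∀ σ, m * ‖σ‖ ^ 2 ≤ ‖(inner ℂ σ (P.gammaOp ζ hζ σ) : ℂ)‖ := by
  obtain ⟨m, hm, hmj⟩ := P.exists_le_re_impedance hζ
  obtain ⟨B, hB⟩ := P.exists_norm_inv_impedance_le hζ
  have hs1 : ‖(sgnRe ζ : ℂ)‖ ≤ 1 := norm_sign_le _
  have hs : sgnRe ζ * ζ.re = |ζ.re| := by
    rw [sgnRe]
    rcases lt_or_gt_of_ne hζ with h | h
    · rw [Real.sign_of_neg h, abs_of_neg h]
      ring
    · rw [Real.sign_of_pos h, abs_of_pos h]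
      ring
  refine ⟨P.S * m, mul_pos P.S_pos hm, fun σ => ?_⟩
  have hsol := P.solvesWithJumps_jumpField ζ hζ σ
  obtain ⟨p', v', -, -, hv, -⟩ := id hsol
  have e1 := hsol.inner_trace hv
  have e2 : P.gammaOp ζ hζ σ = -(P.trace (P.jumpField ζ hζ σ).2.1 v' -
      ζ • (-(P.S : ℂ) • P.mulInvImp ζ hζ σ)) := by
    rw [gammaOp_apply]
    exact congrArg Neg.neg (hsol.defect_eq hv)
  have hc : ∀ j, ‖(sgnRe ζ : ℂ) * ζ * (1 / (P.K j + ζ ^ 2 * P.M j))‖ ≤ ‖(sgnRe ζ : ℂ) * ζ‖ * B :=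
    fun j => by
      rw [norm_mul]
      exact mul_le_mul_of_nonneg_left (hB j) (norm_nonneg _)
  have e3 : diagCLM _ hc σ = ((sgnRe ζ : ℂ) * ζ) • P.mulInvImp ζ hζ σ := by
    ext j
    change (sgnRe ζ : ℂ) * ζ * (1 / (P.K j + ζ ^ 2 * P.M j)) * σ j =
      (sgnRe ζ : ℂ) * ζ * (P.mulInvImp ζ hζ σ j)
    rw [mulInvImp_apply]
    ring
  have e4 := le_re_inner_diagCLM hc hmj σ
  rw [e3, inner_smul_right] at e4
  set A : ℝ := 1 / (P.a ^ 2 * P.ρ) * ‖(P.jumpField ζ hζ σ).1‖ ^ 2 with hA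
  set C : ℝ := P.ρ * ‖(P.jumpField ζ hζ σ).2.1‖ ^ 2 with hC
  have hA0 : 0 ≤ A := by
    have := P.a_pos
    have := P.ρ_pos
    positivity
  have hC0 : 0 ≤ C := by
    have := P.ρ_pos
    positivity
  have e5 : -(sgnRe ζ : ℂ) * inner ℂ σ (P.gammaOp ζ hζ σ) =
      (sgnRe ζ : ℂ) * (ζ * (A : ℂ) + conj ζ * (C : ℂ)) +
        (P.S : ℂ) * ((sgnRe ζ : ℂ) * ζ * inner ℂ σ (P.mulInvImp ζ hζ σ)) := by
    rw [e2, inner_neg_right, inner_sub_right, inner_smul_right, inner_smul_right, e1]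
    ring
  have e6 : P.S * m * ‖σ‖ ^ 2 ≤ (-(sgnRe ζ : ℂ) * inner ℂ σ (P.gammaOp ζ hζ σ)).re := by
    rw [e5, Complex.add_re, Complex.re_ofReal_mul, Complex.re_ofReal_mul, Complex.add_re,
      Complex.re_mul_ofReal, Complex.re_mul_ofReal, Complex.conj_re]
    have h1 : sgnRe ζ * (ζ.re * A + ζ.re * C) = |ζ.re| * (A + C) := by
      rw [← hs]
      ring
    rw [h1]
    have h2 : 0 ≤ |ζ.re| * (A + C) := by positivity
    nlinarith [mul_le_mul_of_nonneg_left e4 P.S_pos.le]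
  refine e6.trans ((Complex.re_le_norm _).trans ?_)
  rw [norm_mul, norm_neg]
  exact mul_le_of_le_one_left (norm_nonneg _) hs1

theorem gammaOp_basisVec (hζ : ζ.re ≠ 0) (i j : ℕ) :
    P.gammaOp ζ hζ (basisVec j 1) i = P.gammaEntry ζ i j := by
  have ha := P.a_ne_zero
  have hρ := P.ρ_ne_zero
  have hζ' : ζ ≠ 0 := fun h0 => hζ (by rw [h0, Complex.zero_re])
  have hsol := P.solvesWithJumps_vecG ζ hζ j
  have hv := (hasWeakDerivOn_greenLp P.a_pos hζ (P.s j)).smul (ζ / (P.a ^ 2 * P.ρ))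
  have e0 : P.gammaOp ζ hζ (basisVec j 1) = -(P.trace
      ((ζ / (P.a ^ 2 * P.ρ) : ℂ) • greenLp P.a_pos hζ (P.s j))
      ((ζ / (P.a ^ 2 * P.ρ) : ℂ) • greenLp' P.a_pos hζ (P.s j)) -
        basisVec j (-ζ * P.S / (P.K j + ζ ^ 2 * P.M j))) := by
    rw [gammaOp_apply, jumpField_basisVec]
    exact congrArg Neg.neg (hsol.defect_eq hv)
  have e1 : P.trace ((ζ / (P.a ^ 2 * P.ρ) : ℂ) • greenLp P.a_pos hζ (P.s j))
      ((ζ / (P.a ^ 2 * P.ρ) : ℂ) • greenLp' P.a_pos hζ (P.s j)) i =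
        (ζ / (P.a ^ 2 * P.ρ) : ℂ) * green P.a ζ (P.s i - P.s j) :=
    (P.hasTrace_trace hv i).unique ((hasTrace_greenLp P.a_pos hζ (P.s j) (P.s i)).smul _)
  rw [e0]
  change -(P.trace ((ζ / (P.a ^ 2 * P.ρ) : ℂ) • greenLp P.a_pos hζ (P.s j))
      ((ζ / (P.a ^ 2 * P.ρ) : ℂ) • greenLp' P.a_pos hζ (P.s j)) i -
        basisVec j (-ζ * P.S / (P.K j + ζ ^ 2 * P.M j)) i) = _
  have hI := P.impedance_ne_zero hζ j
  rw [e1, green, gammaEntry]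
  by_cases hij : i = j
  · subst hij
    rw [lp.single_apply_self, if_pos rfl]
    field_simp
    ring
  · rw [lp.single_apply_ne _ _ _ hij, if_neg hij]
    field_simp
    ring

/-- The energy product with `Ğ` gives the trace defect of the free resolvent. -/
theorem energy_breveG (hζ : ζ.re ≠ 0) (j : ℕ) {Ψ Φ : State} (h : P.SolvesWithJumps ζ Ψ 0 Φ) :
    P.energy (P.breveG (conj ζ) (conj_re_ne_zero hζ) j) Φ = P.defect ζ (Ψ, Φ.1) j := by
  have ha := P.a_ne_zero
  have hρ := P.ρ_ne_zero
  have hS := P.S_ne_zero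
  have hζ' := conj_re_ne_zero hζ
  obtain ⟨p', v', a1, a2, a3, a4, a5, a6, a7⟩ := id h
  rw [h.defect_eq a3]
  obtain ⟨p, v, y, z⟩ := Ψ
  obtain ⟨f, g, k, l⟩ := Φ
  have hp : HasWeakDerivOn univ p p' := P.hasWeakDerivOn_univ_of_jump_zero
    (locallyIntegrable_L2 _) (locallyIntegrable_L2 _) a1 a2
  have hf : f = (P.a ^ 2 * P.ρ : ℂ) • v' + ζ • p := a4.symm
  have hg : g = (1 / P.ρ : ℂ) • p' + ζ • v := a5.symm
  have hk : k j = -z j + ζ * y j := congrArg (fun w : ell2 => w j) a6.symm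
  have hl : l j = P.K j / P.M j * y j + ζ * z j := by
    have := congrArg (fun w : ell2 => w j) a7.symm
    rw [map_zero, smul_zero, add_zero] at this
    change l j = P.mulKM y j + ζ * z j at this
    rwa [mulKM_apply] at this
  -- The unit jump of `-𝒢'` at `s_j` produces `v(s_j)`, whereas `𝒢 ∈ H¹(ℝ)` pairs with `p` without a
  -- boundary term.
  have b1 := P.inner_deriv_of_jumps (P.hasWeakDerivOn_neg_greenLp' hζ' j)
    (P.hasJump_neg_greenLp' hζ' j) a3
  have b2 := inner_deriv_left (hasWeakDerivOn_greenLp P.a_pos hζ' (P.s j)) hp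
  rw [lp.inner_single_left] at b1
  change _ = P.trace v v' j - z j
  change P.energy (greenLp' P.a_pos hζ' (P.s j),
    (conj ζ / (P.a ^ 2 * P.ρ) : ℂ) • greenLp P.a_pos hζ' (P.s j),
    basisVec j (P.S / (P.K j + (conj ζ) ^ 2 * P.M j)),
    basisVec j (-(conj ζ) * P.S / (P.K j + (conj ζ) ^ 2 * P.M j))) (f, g, k, l) = _
  rw [energy_eq, lp.inner_single_left, lp.inner_single_left, mulK_apply, mulM_apply, hk, hl, hf,
    hg]
  have hI := P.impedance_ne_zero hζ j
  have hM := P.M_ne_zero j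
  simp only [RCLike.inner_apply, inner_add_right, inner_smul_left, inner_smul_right,
    inner_neg_left, map_div₀, map_mul, map_add, map_neg, map_pow, map_one, Complex.conj_conj,
    Complex.conj_ofReal, mul_one] at b1 ⊢
  -- The coefficients of `Ğ` are such that `K_j (-z_j + ζ y_j) - ζ (K_j y_j + ζ M_j z_j) = -(K_j +
  -- ζ² M_j) z_j`.
  have b3 : (1 / P.S : ℂ) * (P.K j * (-z j + ζ * y j) * (P.S / (P.K j + ζ ^ 2 * P.M j)) +
      P.M j * (P.K j / P.M j * y j + ζ * z j) * (-ζ * P.S / (P.K j + ζ ^ 2 * P.M j))) = -z j := by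
    generalize hD : (P.K j + ζ ^ 2 * P.M j : ℂ) = D at hI ⊢
    field_simp
    rw [← hD]
    ring
  rw [b3, b2]
  field_simp at b1 ⊢
  linear_combination -(P.ρ : ℂ) * b1

end Chain

namespace Chain

variable {P : Chain} {ζ : ℂ}

/-! ### The resolvents -/

theorem solvesWithJumps_of_freeA (X : P.freeA.domain) :
    P.SolvesWithJumps ζ X 0 (-P.freeA X + ζ • (X : State)) := by
  have h := X.2
  obtain ⟨h1, h2, -⟩ : X.1.1 ∈ H1 ∧ X.1.2.1 ∈ H1 ∧ _ := h
  have hp := hasWeakDerivOn_ddx ⟨X.1.1, h1⟩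
  refine ⟨ddx ⟨X.1.1, h1⟩, ddx ⟨X.1.2.1, h2⟩, hp.mono (subset_univ _),
    fun j => (P.hasTrace_trace hp j).hasJump_zero, hasWeakDerivOn_ddx ⟨X.1.2.1, h2⟩,
    ?_, ?_, rfl, ?_⟩
  · change _ = -(-(P.a ^ 2 * P.ρ : ℂ) • ddx ⟨X.1.2.1, h2⟩) + ζ • X.1.1
    module
  · change _ = -(-(1 / P.ρ : ℂ) • ddx ⟨X.1.1, h1⟩) + ζ • X.1.2.1
    module
  · change _ = -(-P.mulKM X.1.2.2.1) + ζ • X.1.2.2.2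
    rw [map_zero, smul_zero, add_zero, neg_neg]

theorem SolvesWithJumps.freeA_eq {Ψ Φ : State} (h : P.SolvesWithJumps ζ Ψ 0 Φ) :
    ∃ hΨ : Ψ ∈ P.freeA.domain, -P.freeA ⟨Ψ, hΨ⟩ + ζ • Ψ = Φ := by
  obtain ⟨p', v', a1, a2, a3, a4, a5, a6, a7⟩ := h
  have hp : HasWeakDerivOn univ Ψ.1 p' := P.hasWeakDerivOn_univ_of_jump_zero
    (locallyIntegrable_L2 _) (locallyIntegrable_L2 _) a1 a2
  refine ⟨⟨⟨p', hp⟩, ⟨v', a3⟩, trivial⟩, ?_⟩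
  refine Prod.ext ?_ (Prod.ext ?_ (Prod.ext a6 ?_))
  · change -(-(P.a ^ 2 * P.ρ : ℂ) • ddx ⟨Ψ.2.1, v', a3⟩) + ζ • Ψ.1 = Φ.1
    rw [ddx_eq a3, ← a4]
    module
  · change -(-(1 / P.ρ : ℂ) • ddx ⟨Ψ.1, p', hp⟩) + ζ • Ψ.2.1 = Φ.2.1
    rw [ddx_eq hp, ← a5]
    module
  · change -(-P.mulKM Ψ.2.2.1) + ζ • Ψ.2.2.2 = Φ.2.2.2
    rw [← a7, map_zero, smul_zero, add_zero, neg_neg]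

variable (P) in
theorem isResolvent_freeResolvent (hζ : ζ.re ≠ 0) :
    IsResolvent P.freeA ζ (P.freeResolvent ζ hζ) :=
  ⟨fun Φ => (P.solvesWithJumps_freeResolvent ζ hζ Φ).freeA_eq, fun X =>
    (P.solvesWithJumps_freeResolvent ζ hζ _).unique hζ (solvesWithJumps_of_freeA X)⟩

theorem exists_solvesWithJumps_of_hatA (X : P.hatA.domain) :
    ∃ σ, P.SolvesWithJumps ζ X σ (-P.hatA X + ζ • (X : State)) ∧
      P.defect ζ (X, (-P.hatA X + ζ • (X : State)).1) = 0 := by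
  obtain ⟨p', v', σ, h1, h2, h3, h4, h5⟩ := P.exists_hatA_eq X
  have h : P.SolvesWithJumps ζ X σ (-P.hatA X + ζ • (X : State)) := by
    rw [h5]
    refine ⟨p', v', h1, h2, h3, ?_, ?_, rfl, ?_⟩
    · change _ = -(-(P.a ^ 2 * P.ρ : ℂ) • v') + ζ • X.1.1
      module
    · change _ = -(-(1 / P.ρ : ℂ) • p') + ζ • X.1.2.1
      module
    · change _ = -(-(P.mulKM X.1.2.2.1 + (P.S : ℂ) • P.mulInvM σ)) + ζ • X.1.2.2.2
      rw [neg_neg]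
  exact ⟨σ, h, by rw [h.defect_eq h3, h4, sub_self]⟩

theorem SolvesWithJumps.hatA_eq {Ψ Φ : State} {σ : ell2} (h : P.SolvesWithJumps ζ Ψ σ Φ)
    (h0 : P.defect ζ (Ψ, Φ.1) = 0) :
    ∃ hΨ : Ψ ∈ P.hatA.domain, -P.hatA ⟨Ψ, hΨ⟩ + ζ • Ψ = Φ := by
  obtain ⟨p', v', a1, a2, a3, a4, a5, a6, a7⟩ := id h
  rw [h.defect_eq a3, sub_eq_zero] at h0
  obtain ⟨hΨ, e⟩ := P.hatA_of Ψ.2.2.1 a1 a2 a3 h0.symm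
  refine ⟨hΨ, ?_⟩
  have e' : P.hatA ⟨Ψ, hΨ⟩ = P.hatValue p' v' Ψ.2.2.1 Ψ.2.2.2 σ := e
  rw [e']
  refine Prod.ext ?_ (Prod.ext ?_ (Prod.ext a6 ?_))
  · change -(-(P.a ^ 2 * P.ρ : ℂ) • v') + ζ • Ψ.1 = Φ.1
    rw [← a4]
    module
  · change -(-(1 / P.ρ : ℂ) • p') + ζ • Ψ.2.1 = Φ.2.1
    rw [← a5]
    module
  · change -(-(P.mulKM Ψ.2.2.1 + (P.S : ℂ) • P.mulInvM σ)) + ζ • Ψ.2.2.2 = Φ.2.2.2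
    rw [← a7, neg_neg]

variable (P) (ζ)

/-- The sequence `(v(s_j) - z_j)_j` for `(p, v, y, z) = (-A + ζ)⁻¹ Φ`. -/
def freeDefect (hζ : ζ.re ≠ 0) : State →L[ℂ] ell2 :=
  (P.defect ζ).comp ((P.freeResolvent ζ hζ).prod (ContinuousLinearMap.fst ℂ _ _))

theorem freeDefect_apply (hζ : ζ.re ≠ 0) (Φ : State) :
    P.freeDefect ζ hζ Φ = P.defect ζ (P.freeResolvent ζ hζ Φ, Φ.1) := rfl

theorem defect_add_jumpField (hζ : ζ.re ≠ 0) (Φ : State) (σ : ell2) :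
    P.defect ζ (P.freeResolvent ζ hζ Φ + P.jumpField ζ hζ σ, Φ.1) =
      P.freeDefect ζ hζ Φ - P.gammaOp ζ hζ σ := by
  rw [freeDefect_apply, gammaOp_apply, sub_neg_eq_add, ← map_add]
  exact congrArg (P.defect ζ) (Prod.ext rfl (add_zero Φ.1).symm)

theorem solvesWithJumps_add_jumpField (hζ : ζ.re ≠ 0) (Φ : State) (σ : ell2) :
    P.SolvesWithJumps ζ (P.freeResolvent ζ hζ Φ + P.jumpField ζ hζ σ) σ Φ := by
  have h := (P.solvesWithJumps_freeResolvent ζ hζ Φ).add (P.solvesWithJumps_jumpField ζ hζ σ)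
  rwa [zero_add, add_zero] at h

/-- Among the relaxed solutions `R₀ Φ + ∑ σ_j G^j`, those in the domain of `Â` are given by `Γ σ =
freeDefect Φ`. Invertibility of `Γ` gives both existence and uniqueness. -/
theorem isResolvent_hatA (hζ : ζ.re ≠ 0) {Γ : ell2 ≃L[ℂ] ell2}
    (hΓ : ∀ σ, Γ σ = P.gammaOp ζ hζ σ) :
    IsResolvent P.hatA ζ (P.freeResolvent ζ hζ +
      (P.jumpField ζ hζ).comp ((Γ.symm : ell2 →L[ℂ] ell2).comp (P.freeDefect ζ hζ))) := by
  refine ⟨fun Φ => ?_, fun X => ?_⟩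
  · refine (P.solvesWithJumps_add_jumpField ζ hζ Φ (Γ.symm (P.freeDefect ζ hζ Φ))).hatA_eq ?_
    rw [defect_add_jumpField, ← hΓ, ContinuousLinearEquiv.apply_symm_apply, sub_self]
  · obtain ⟨σ, h, h0⟩ := exists_solvesWithJumps_of_hatA (ζ := ζ) X
    generalize -P.hatA X + ζ • (X : State) = Φ at h h0
    have e := h.unique hζ (P.solvesWithJumps_add_jumpField ζ hζ Φ σ)
    rw [e, defect_add_jumpField, ← hΓ, sub_eq_zero] at h0
    change P.freeResolvent ζ hζ Φ + P.jumpField ζ hζ (Γ.symm (P.freeDefect ζ hζ Φ)) = X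
    rw [h0, ContinuousLinearEquiv.symm_apply_apply, e]

theorem basisVec_eq_smul (j : ℕ) (c : ℂ) : basisVec j c = c • basisVec j 1 := by
  rw [basisVec, basisVec, ← lp.single_smul, smul_eq_mul, mul_one]

/-- The set `J` truncates the defect before `Γ⁻¹` is applied, and `I` truncates the resulting
coefficients. Boundedness of `Γ⁻¹` and of `jumpField` carries both limits to the state space. -/
theorem tendsto_resolvent_sum (hζ : ζ.re ≠ 0) (Γ : ell2 ≃L[ℂ] ell2) (Φ : State) :
    Tendsto (fun F : Finset ℕ × Finset ℕ => P.freeResolvent ζ hζ Φ + ∑ i ∈ F.1, ∑ j ∈ F.2,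
        ((Γ.symm (basisVec j 1) : ℕ → ℂ) i *
          P.energy (P.breveG (conj ζ) (conj_re_ne_zero hζ) j) Φ) • P.vecG ζ hζ i)
      atTop (𝓝 (P.freeResolvent ζ hζ Φ +
        P.jumpField ζ hζ (Γ.symm (P.freeDefect ζ hζ Φ)))) := by
  set t := P.freeDefect ζ hζ Φ
  have ht : ∀ j, P.energy (P.breveG (conj ζ) (conj_re_ne_zero hζ) j) Φ = t j := fun j =>
    P.energy_breveG ζ hζ j (P.solvesWithJumps_freeResolvent ζ hζ Φ)
  have h1 : Tendsto (fun J : Finset ℕ => Γ.symm (∑ j ∈ J, basisVec j (t j))) atTop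
      (𝓝 (Γ.symm t)) := (Γ.symm.continuous.tendsto t).comp (tendsto_sum_basisVec t)
  have h2 := ((P.jumpField ζ hζ).continuous.tendsto _).comp (tendsto_sum_basisVec_prod h1)
  refine (h2.const_add (P.freeResolvent ζ hζ Φ)).congr fun F => ?_
  congr 1
  change P.jumpField ζ hζ (∑ i ∈ F.1, basisVec i (Γ.symm (∑ j ∈ F.2, basisVec j (t j)) i)) = _
  rw [map_sum]
  refine Finset.sum_congr rfl fun i _ => ?_
  rw [basisVec_eq_smul, map_smul, jumpField_basisVec, ← Finset.sum_smul]
  congr 1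
  rw [map_sum, lp.coeFn_sum, Finset.sum_apply]
  refine Finset.sum_congr rfl fun j _ => ?_
  rw [ht, basisVec_eq_smul, map_smul, mul_comm]
  rfl

end Chain

end Acoustic

end

/-! ### Assembly of the four assertions -/

theorem theorem3 (P : Acoustic.Chain) :
    -- the operator is real and skew-adjoint for the energy scalar product
    Acoustic.IsRealOperator P.hatA ∧
    Acoustic.IsSkewAdjoint P.energy P.hatA ∧
    -- the regular part of `p` lies in the homogeneous Sobolev space and gives the second component
    (∀ (Ψ : P.hatA.domain) (σ : Acoustic.ell2),
      (∀ j, Acoustic.HasJump (Ψ : Acoustic.State).1 (P.s j) (σ j)) →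
      (Acoustic.MemHomH1 (P.regularPartNormalized (Ψ : Acoustic.State).1 σ) ∧
        ∃ g : Acoustic.L2,
          Acoustic.HasWeakDerivOn Set.univ
            (P.regularPartNormalized (Ψ : Acoustic.State).1 σ) g ∧
          (P.hatA Ψ).2.1 = -(1 / P.ρ : ℂ) • g) ∧
      (Summable (fun j => σ j) →
        Acoustic.MemHomH1 (P.regularPart (Ψ : Acoustic.State).1 σ) ∧
        ∃ g : Acoustic.L2,
          Acoustic.HasWeakDerivOn Set.univ (P.regularPart (Ψ : Acoustic.State).1 σ) g ∧
          (P.hatA Ψ).2.1 = -(1 / P.ρ : ℂ) • g)) ∧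
    -- the resolvent formula
    (∀ (ζ : ℂ) (hζ : ζ.re ≠ 0),
      ∃ (R₀ R : Acoustic.State →L[ℂ] Acoustic.State)
        (Γ : Acoustic.ell2 ≃L[ℂ] Acoustic.ell2),
        Acoustic.IsResolvent P.freeA ζ R₀ ∧
        Acoustic.IsResolvent P.hatA ζ R ∧
        (∀ i j, (Γ (Acoustic.basisVec j 1) : ℕ → ℂ) i = P.gammaEntry ζ i j) ∧
        ∀ Φ : Acoustic.State,
          Filter.Tendsto
            (fun F : Finset ℕ × Finset ℕ =>
              R₀ Φ + ∑ i ∈ F.1, ∑ j ∈ F.2,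
                ((Γ.symm (Acoustic.basisVec j 1) : ℕ → ℂ) i *
                  P.energy (P.breveG ((starRingEnd ℂ) ζ) (Acoustic.conj_re_ne_zero hζ) j) Φ) • P.vecG ζ hζ i)
            Filter.atTop (nhds (R Φ))) := by
  refine ⟨P.isRealOperator_hatA, P.isSkewAdjoint_hatA,
    fun Ψ σ hσ => P.regularPart_spec Ψ σ hσ, fun ζ hζ => ?_⟩
  obtain ⟨m, hm, hco⟩ := P.exists_coercive_gammaOp ζ hζ
  obtain ⟨Γ, hΓ⟩ := Acoustic.exists_equiv_of_coercive (P.gammaOp ζ hζ) hm hco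
  refine ⟨_, _, Γ, P.isResolvent_freeResolvent hζ, P.isResolvent_hatA ζ hζ hΓ, fun i j => ?_,
    P.tendsto_resolvent_sum ζ hζ Γ⟩
  rw [hΓ, P.gammaOp_basisVec ζ hζ i j]
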